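/- Consider the symmetric cubic near-Hamiltonian system $$\dot x=H_y+\varepsilon p(x,y),\qquad \dot y=-H_x+\varepsilon q(x,y),\tag{1}$$ with $$H(x,y)=\left(\tfrac12-h_{22}\right)x^2-\tfrac14y^2+h_{40}x^4+h_{31}x^3y+h_{22}x^2y^2+\tfrac18y^4,$$ $$p=\sum_{i+j=1,3}a_{ij}x^iy^j,\quad q=\sum_{i+j=1,3}b_{ij}x^iy^j,\quad p_x+q_y=c_{00}+c_{20}x^2+c_{11}xy+c_{02}y^2.$$ (This $H$ is the even quartic Hamiltonian $\sum_{i+j=2,4}h_{ij}x^iy^j$ with critical points $(0,\pm1)$ and $h_{11}=0$, for which $(0,\pm1)$ are elementary centers, i.e. $h_{02}(h_{20}+h_{22})<0$, normalised by $h_{20}+h_{22}=\frac12$, $h_{02}=-\frac14$.) In the coordinates $u=-(y-1)$, $v=x$, system (1) becomes $$\dot u=\frac{\partial H_1}{\partial v}+\varepsilon\hat p,\qquad \dot v=-\frac{\partial H_1}{\partial u}+\varepsilon\hat q,\tag{2}$$ where $\hat p(u,v)=-q(v,1-u)$, $\hat q(u,v)=p(v,1-u)$ and $$H_1(u,v)=\tfrac12(u^2+v^2)-\tfrac12u^3-2h_{22}uv^2+h_{31}v^3+\tfrac18u^4+h_{22}u^2v^2-h_{31}uv^3+h_{40}v^4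 .$$ Put $\delta=(c_{00},c_{02},c_{11},c_{20})$ and $\sigma=(h_{31},h_{22},h_{40})$, and let $\delta_0=(c_{00}^*,c_{02}^*,c_{11}^*,c_{20}^*)$ and $\sigma_0=(h_{31}^*,h_{22}^*,h_{40}^*)$ be real vectors satisfying, for one of the two choices of the sign $\pm$, $$c_{00}^*=-c_{02}^*,\qquad c_{20}^*=3h_{31}^*c_{11}^*+(2+4h_{22}^*)c_{02}^*,\qquad c_{11}^*\neq0,$$ $$c_{02}^*=\frac{h_{31}^*\left[20(h_{22}^*)^2-8h_{22}^*-10h_{40}^*-1\right]}{-2+20(h_{31}^*)^2+8(h_{22}^*)^2-4h_{40}^*}\,c_{11}^*,$$ $$h_{31}^*\neq0,\qquad h_{22}^*=\frac12-\frac{105\pm56\sqrt3}{4}(h_{31}^*)^2,\qquad h_{40}^*=\frac1{14}\left[28(h_{22}^*)^2-21(h_{31}^*)^2-12h_{22}^*-1\right].$$ Then for some $(\varepsilon,\delta,\sigma)$ near $(0,\delta_0,\sigma_0)$ with $\varepsilon>0$, system (2) has (at least) $5$ limit cycles near the origin; equivalently, system (1) has $5$ limit cycles near $(0,1)$. By symmetry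 it also has $5$ limit cycles near $(0,-1)$, hence at least $10$ limit cycles near $(0,\pm1)$ in total. More precisely: for every $\eta>0$ there are $\delta,\sigma$ whose entries differ from those of $\delta_0,\sigma_0$ by less than $\eta$ such that, for every $p,q$ of the above form with divergence coefficients $\delta$, there is $\varepsilon\in(0,\eta)$ for which all these limit cycles exist at distance less than $\eta$ (in the maximum norm on the plane) from the respective centers. Here a limit cycle is a nonconstant periodic orbit that has a neighbourhood containing no other periodic orbit. -/

import Mathlib

/-- A periodic orbit of the planar autonomous system `z' = X z`: the trace of a nonconstant
periodic solution. -/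
def IsPeriodicOrbit (X : ℝ × ℝ → ℝ × ℝ) (C : Set (ℝ × ℝ)) : Prop :=
  ∃ (γ : ℝ → ℝ × ℝ) (T : ℝ), 0 < T ∧ (∀ t, HasDerivAt γ (X (γ t)) t) ∧
    (∀ t, γ (t + T) = γ t) ∧ (∃ t, γ t ≠ γ 0) ∧ C = Set.range γ

/-- A limit cycle: a periodic orbit that is isolated, i.e. has a neighbourhood containing no
other periodic orbit. -/
def IsLimitCycle (X : ℝ × ℝ → ℝ × ℝ) (C : Set (ℝ × ℝ)) : Prop :=
  IsPeriodicOrbit X C ∧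
    ∃ U : Set (ℝ × ℝ), IsOpen U ∧ C ⊆ U ∧ ∀ C', IsPeriodicOrbit X C' → C' ⊆ U → C' = C

/-- The limit cycles of `X` contained in the ball of radius `r` about `z₀`. -/
def limitCyclesNear (X : ℝ × ℝ → ℝ × ℝ) (z₀ : ℝ × ℝ) (r : ℝ) : Set (Set (ℝ × ℝ)) :=
  {C | IsLimitCycle X C ∧ C ⊆ Metric.ball z₀ r}

/-- The near-Hamiltonian vector field `(H_y + ε p, -H_x + ε q)`. -/
noncomputable def nearHamiltonianField (H p q : ℝ → ℝ → ℝ) (ε : ℝ) (z : ℝ × ℝ) : ℝ × ℝ :=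
  (deriv (fun y => H z.1 y) z.2 + ε * p z.1 z.2, -deriv (fun x => H x z.2) z.1 + ε * q z.1 z.2)

/-- The general Hamiltonian `∑_{i+j=2,4} h_{ij} x^i y^j`. -/
def symHamiltonian (h20 h11 h02 h40 h31 h22 h13 h04 x y : ℝ) : ℝ :=
  h20 * x ^ 2 + h11 * (x * y) + h02 * y ^ 2 +
    h40 * x ^ 4 + h31 * (x ^ 3 * y) + h22 * (x ^ 2 * y ^ 2) + h13 * (x * y ^ 3) + h04 * y ^ 4

/-- The Hamiltonian with `h₁₁ = 0` and an elementary center at `(0, 1)`, normalised by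
`h₂₀ + h₂₂ = 1/2` and `-8 h₀₂ (h₂₀ + h₂₂) = 1`; the critical points at `(0, ±1)` force
`h₁₃ = -h₁₁` and `h₀₄ = -h₀₂ / 2`. -/
noncomputable def centerHamiltonian (h31 h22 h40 : ℝ) : ℝ → ℝ → ℝ :=
  symHamiltonian (1 / 2 - h22) 0 (-1 / 4) h40 h31 h22 0 (1 / 8)

/-- The normal form of the Hamiltonian in the coordinates `u = -(y - 1)`, `v = x`. -/
noncomputable def normalHamiltonian (h31 h22 h40 u v : ℝ) : ℝ :=
  1 / 2 * (u ^ 2 + v ^ 2) - 1 / 2 * u ^ 3 - 2 * h22 * u * v ^ 2 + h31 * v ^ 3 +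
    1 / 8 * u ^ 4 + h22 * u ^ 2 * v ^ 2 - h31 * u * v ^ 3 + h40 * v ^ 4

/-- `p` is a real polynomial of the form `∑_{i+j=1,3} a_{ij} x^i y^j`. -/
def IsOddCubic (p : ℝ → ℝ → ℝ) : Prop :=
  ∃ a10 a01 a30 a21 a12 a03 : ℝ, ∀ x y, p x y =
    a10 * x + a01 * y + a30 * x ^ 3 + a21 * (x ^ 2 * y) + a12 * (x * y ^ 2) + a03 * y ^ 3

/-- `p_x + q_y = c₀₀ + c₂₀ x² + c₁₁ x y + c₀₂ y²`. -/
def HasDivergence (p q : ℝ → ℝ → ℝ) (c00 c02 c11 c20 : ℝ) : Prop :=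
  ∀ x y : ℝ, deriv (fun x' => p x' y) x + deriv (fun y' => q x y') y =
    c00 + c20 * x ^ 2 + c11 * (x * y) + c02 * y ^ 2

/-- The symmetric near-Hamiltonian system in the original coordinates `(x, y)`. -/
noncomputable def symField (h31 h22 h40 : ℝ) (p q : ℝ → ℝ → ℝ) (ε : ℝ) : ℝ × ℝ → ℝ × ℝ :=
  nearHamiltonianField (centerHamiltonian h31 h22 h40) p q ε

/-- Its normal form near `(0, 1)`, in the coordinates `u = -(y - 1)`, `v = x`; the perturbation
terms become `u' = -y' ↦ -q(v, 1 - u)` and `v' = x' ↦ p(v, 1 - u)`. -/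
noncomputable def normalField (h31 h22 h40 : ℝ) (p q : ℝ → ℝ → ℝ) (ε : ℝ) : ℝ × ℝ → ℝ × ℝ :=
  nearHamiltonianField (normalHamiltonian h31 h22 h40)
    (fun u v => -q v (1 - u)) (fun u v => p v (1 - u)) ε

open Set Filter Topology MeasureTheory

/-! In the coordinates t = x / y, W = y² the Hamiltonian is quadratic in W, and completing the
square gives 8H + 1 = S² + V² with S a function of t alone (`sCoord`, `vCoord`). In (S, V) the
unperturbed orbits around (0, 1) are circles, the perturbed system is a perturbed rotation
(`svCoord_twField`), and its orbits satisfy dρ/dφ = ε g(φ, ε, ρ). Averaging shows that a simple zero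
of the mean of g(·, 0, ρ) gives an isolated closed orbit for small ε > 0
(`exists_unique_periodic_solution`, `eventually_exists_isLimitCycle`).

By Green's theorem that mean is 2ρ M(ρ) with M(ρ) = ∫ cos²φ · G(T(ρ sin φ)) dφ, where G is an
explicit algebraic kernel and T inverts S (`radialAverage_eq_meanFun`). Only the part of G ∘ T that
is even in s = ρ sin φ contributes. Since t√C/u is an odd function of s and Y = t²C/u² an even one,
products (t√C/u) f(Y) drop out. Removing such products leaves a remainder whose leading coefficient
decides the sign of M near 0 (`IsChart.eventually_meanFun_pos`). At orders 0, 2, 4, 6, 8, 10 in s,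
each computed once the previous ones vanish, the coefficients are up to nonzero constants: c₀₀ +
c₀₂; c₂₀ - 3hc₁₁ - (4 - l)c₀₂; an expression affine in c₀₂; Ph(8l - 14n + 42h²); Ph(l² - 210h²l +
1617h⁴); and a last one. Here h = h₃₁, l = 2 - 4h₂₂, n = (1 - 2h₂₂)² - 2h₄₀ and P is `kernelCoeff`.
The hypotheses on (δ₀, σ₀) say exactly that the first five vanish, and then the last one does not.

The five equations are released one at a time, from the highest order to the lowest. Each release
gives M a prescribed new sign close to 0, while the signs found before persist by continuity
(`Alternates.frequently_succ`, `frequently_alternates`). This produces six points of alternating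
sign, hence five zeros. As M is affine in c₀₀ with positive slope, a Sard argument makes the zeros
simple after a small change of c₀₀ (`exists_forall_zero_simple`). The five limit cycles lie in
disjoint ranges of S² + V², and z ↦ -z supplies five more at (0, -1). -/

/-! ### Averaging for scalar periodic equations -/

/-- A function of an angle, a small parameter and a state, periodic in the angle, is uniformly
continuous on compact ranges of the other two variables. -/
lemma Function.Periodic.exists_uniform_close {g : ℝ → ℝ → ℝ → ℝ} {P e₀ a b : ℝ} (hP : 0 < P)
    (hper : Function.Periodic g P) (he : 0 ≤ e₀)
    (hg : ContinuousOn (fun p : ℝ × ℝ × ℝ => g p.1 p.2.1 p.2.2)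
      (univ ×ˢ Icc 0 e₀ ×ˢ Icc a b)) {η : ℝ} (hη : 0 < η) :
    ∃ δ > 0, ∀ ε ∈ Icc 0 e₀, ε ≤ δ → ∀ φ, ∀ x ∈ Icc a b, ∀ y ∈ Icc a b, |x - y| ≤ δ →
      |g φ ε x - g φ 0 y| < η := by
  have hK : IsCompact (Icc (0 : ℝ) P ×ˢ Icc 0 e₀ ×ˢ Icc a b) :=
    isCompact_Icc.prod (isCompact_Icc.prod isCompact_Icc)
  have hu := hK.uniformContinuousOn_of_continuous
    (hg.mono (prod_mono (subset_univ _) Subset.rfl))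
  rw [Metric.uniformContinuousOn_iff] at hu
  obtain ⟨δ, hδ, h⟩ := hu η hη
  refine ⟨δ / 2, by positivity, fun ε hε hεδ φ x hx y hy hxy => ?_⟩
  obtain ⟨φ', hφ', hgφ⟩ := hper.exists_mem_Ico₀ hP φ
  rw [hgφ]
  have := h (φ', ε, x) ⟨Ico_subset_Icc_self hφ', hε, hx⟩ (φ', 0, y)
    ⟨Ico_subset_Icc_self hφ', ⟨le_rfl, he⟩, hy⟩ ?_
  · simpa [Real.dist_eq] using this
  · simp only [Prod.dist_eq, dist_self, Real.dist_eq, sub_zero, abs_of_nonneg hε.1]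
    refine max_lt hδ (max_lt ?_ ?_) <;> linarith

lemma Function.Periodic.exists_uniform_bound {g : ℝ → ℝ → ℝ → ℝ} {P e₀ a b : ℝ} (hP : 0 < P)
    (hper : Function.Periodic g P)
    (hg : ContinuousOn (fun p : ℝ × ℝ × ℝ => g p.1 p.2.1 p.2.2)
      (univ ×ˢ Icc 0 e₀ ×ˢ Icc a b)) :
    ∃ B > 0, ∀ φ, ∀ ε ∈ Icc 0 e₀, ∀ x ∈ Icc a b, |g φ ε x| ≤ B := by
  have hK : IsCompact (Icc (0 : ℝ) P ×ˢ Icc 0 e₀ ×ˢ Icc a b) :=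
    isCompact_Icc.prod (isCompact_Icc.prod isCompact_Icc)
  obtain ⟨B, hB⟩ := hK.exists_bound_of_continuousOn
    (hg.mono (prod_mono (subset_univ _) Subset.rfl))
  refine ⟨max B 1, by positivity, fun φ ε hε x hx => ?_⟩
  obtain ⟨φ', hφ', hgφ⟩ := hper.exists_mem_Ico₀ hP φ
  rw [hgφ]
  exact (hB (φ', ε, x) ⟨Ico_subset_Icc_self hφ', hε, hx⟩).trans (le_max_left _ _)

/-- A solution over one period that closes up extends to a periodic solution on the line. -/
lemma exists_periodic_extension {v : ℝ → ℝ → ℝ} {P : ℝ} (hP : 0 < P)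
    (hper : Function.Periodic v P) {α : ℝ → ℝ}
    (hα : ∀ t ∈ Icc 0 P, HasDerivWithinAt α (v t (α t)) (Icc 0 P) t) (hc : α P = α 0) :
    ∃ β : ℝ → ℝ, Function.Periodic β P ∧ (∀ t ∈ Icc 0 P, β t = α t) ∧
      ∀ t, HasDerivAt β (v t (β t)) t := by
  set β : ℝ → ℝ := fun t => α (toIcoMod hP 0 t) with hβ
  have hβper : Function.Periodic β P := fun t => by simp [hβ]
  have hβeq : ∀ t ∈ Icc 0 P, β t = α t := by
    intro t ht
    rcases ht.2.eq_or_lt with h | h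
    · have : β P = β 0 := by simpa using hβper 0
      rw [h, this, hc]
      simp only [hβ]
      rw [(toIcoMod_eq_self hP).2 (by simpa using hP)]
    · simp only [hβ]
      rw [(toIcoMod_eq_self hP).2 (by simpa using ⟨ht.1, h⟩)]
  have hIcc : ∀ t ∈ Icc 0 P, HasDerivWithinAt β (v t (β t)) (Icc 0 P) t := by
    intro t ht
    rw [hβeq t ht]
    exact (hα t ht).congr hβeq (hβeq t ht)
  -- The seam is the only delicate point: the left derivative at 0 is the left derivative at P,
  -- carried over by translation.
  have h0 : HasDerivAt β (v 0 (β 0)) 0 := by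
    have hr : HasDerivWithinAt β (v 0 (β 0)) (Ici 0) 0 :=
      (hIcc 0 ⟨le_rfl, hP.le⟩).mono_of_mem_nhdsWithin (Icc_mem_nhdsGE hP)
    have hl : HasDerivWithinAt β (v P (β P)) (Iic P) P :=
      (hIcc P ⟨hP.le, le_rfl⟩).mono_of_mem_nhdsWithin (Icc_mem_nhdsLE hP)
    have hl' : HasDerivWithinAt β (v 0 (β 0)) (Iic 0) 0 := by
      have e1 : β P = β 0 := by simpa using hβper 0
      have e2 : v P = v 0 := by simpa using hper 0
      rw [e1, e2] at hl
      have hsh : HasDerivWithinAt (fun t : ℝ => t + P) 1 (Iic 0) 0 :=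
        ((hasDerivAt_id (0 : ℝ)).add_const P).hasDerivWithinAt
      have hl2 : HasDerivWithinAt β (v 0 (β 0)) (Iic P) ((fun t : ℝ => t + P) 0) := by
        simpa using hl
      have := hl2.scomp (0 : ℝ) hsh (fun t (ht : t ≤ 0) => by
        simpa using ht)
      have e3 : β ∘ (fun t : ℝ => t + P) = β := funext hβper
      rw [e3] at this
      simpa using this
    have := hl'.union hr
    rwa [Iic_union_Ici, hasDerivWithinAt_univ] at this
  have hIco : ∀ t ∈ Ico 0 P, HasDerivAt β (v t (β t)) t := by
    intro t ht
    rcases ht.1.eq_or_lt with h | h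
    · rw [← h]; exact h0
    · exact (hIcc t ⟨ht.1, ht.2.le⟩).hasDerivAt (Icc_mem_nhds h ht.2)
  refine ⟨β, hβper, hβeq, fun t => ?_⟩
  have hk : t = toIcoMod hP 0 t + toIcoDiv hP 0 t • P := (toIcoMod_add_toIcoDiv_zsmul hP 0 t).symm
  set k := toIcoDiv hP 0 t
  set t' := toIcoMod hP 0 t with ht'
  have hmem : t' ∈ Ico 0 P := by simpa using toIcoMod_mem_Ico hP 0 t
  have hb : ∀ s, β (s - k • P) = β s := fun s => hβper.sub_zsmul_eq k
  have hv : v t = v t' := by rw [hk]; exact hper.zsmul k t'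
  have hsub : t - k • P = t' := by rw [hk]; ring
  have h1 := hIco t' hmem
  rw [← hv, ← hsub, hb] at h1
  have h2 := HasDerivAt.comp_sub_const t (k • P) h1
  simpa only [hb] using h2

/-- Two periodic solutions of `x' = ε g` near a point where the averaged slope does not vanish
coincide. -/
lemma periodic_solution_unique {v v' : ℝ → ℝ → ℝ} {A : ℝ → ℝ} {P Q a b d κ ε : ℝ} (hP : 0 < P)
    (hε : 0 < ε) (hA : Continuous A) (hAper : Function.Periodic A P)
    (hAint : ∫ φ in (0 : ℝ)..P, A φ = d * P) (hκ : κ < |d|)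
    (hd : ∀ φ, ∀ x ∈ Ioo a b, HasDerivAt (v φ) (v' φ x) x)
    (hclose : ∀ φ, ∀ x ∈ Ioo a b, |v' φ x - A φ| ≤ κ)
    {B : ℝ} (hB : ∀ φ, |A φ| ≤ B)
    {k : ℕ} (hk : 0 < k) (hQ : Q = k * P)
    {α β : ℝ → ℝ} (hα : ∀ φ, HasDerivAt α (ε * v φ (α φ)) φ) (hαm : ∀ φ, α φ ∈ Ioo a b)
    (hβ : ∀ φ, HasDerivAt β (ε * v φ (β φ)) φ) (hβm : ∀ φ, β φ ∈ Ioo a b)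
    (hαQ : Function.Periodic α Q) (hβQ : Function.Periodic β Q) : α = β := by
  have hQ0 : 0 < Q := by rw [hQ]; positivity
  have hlip : ∀ φ, LipschitzOnWith (Real.toNNReal (ε * (B + κ))) (fun x => ε * v φ x)
      (Ioo a b) := by
    intro φ
    refine (convex_Ioo a b).lipschitzOnWith_of_nnnorm_hasDerivWithin_le
      (f' := fun x => ε * v' φ x)
      (fun x hx => ((hd φ x hx).const_mul ε).hasDerivWithinAt) (fun x hx => ?_)
    rw [← NNReal.coe_le_coe, coe_nnnorm, Real.norm_eq_abs, abs_mul, abs_of_pos hε]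
    refine le_trans ?_ (Real.le_coe_toNNReal _)
    have h1 := hclose φ x hx
    have h2 := hB φ
    have : |v' φ x| ≤ B + κ := by
      rw [abs_le] at *
      constructor <;> linarith
    gcongr
  by_contra hne
  -- Distinct solutions never meet, so the logarithm of their difference can be differentiated at
  -- every angle.
  have hdiff : ∀ φ, α φ - β φ ≠ 0 := by
    intro φ h0
    exact hne (ODE_solution_unique_univ (v := fun φ x => ε * v φ x) (s := fun _ => Ioo a b)
      (t₀ := φ) hlip (fun t => ⟨hα t, hαm t⟩) (fun t => ⟨hβ t, hβm t⟩) (sub_eq_zero.1 h0))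
  -- `A - d` has mean zero, so its primitive is periodic. Subtracting `ε * a'` from the logarithm
  -- replaces the oscillating rate `A` by its mean `d`.
  set a' : ℝ → ℝ := fun φ => (∫ s in (0 : ℝ)..φ, A s) - d * φ with ha'
  have ha'd : ∀ φ, HasDerivAt a' (A φ - d) φ := by
    intro φ
    have h1 : HasDerivAt (fun φ => ∫ s in (0 : ℝ)..φ, A s) (A φ) φ :=
      intervalIntegral.integral_hasDerivAt_right (hA.intervalIntegrable _ _)
        (hA.stronglyMeasurableAtFilter _ _) hA.continuousAt
    exact (h1.sub ((hasDerivAt_id φ).const_mul d)).congr_deriv (by ring)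
  have ha'per : a' Q = a' 0 := by
    have : (∫ s in (0 : ℝ)..Q, A s) = k * (d * P) := by
      have := hAper.intervalIntegral_add_zsmul_eq k 0 (fun _ _ => hA.intervalIntegrable _ _)
      rw [zero_add, zero_add, hAint] at this
      rw [hQ]
      simpa using this
    simp only [ha', this, intervalIntegral.integral_same]
    rw [hQ]
    ring
  -- `Real.log` is log |·|, so the sign of `α - β` is irrelevant. The derivative of `q` is `ε * m`
  -- with `m` within `κ < |d|` of `d`, hence never zero, although `q` agrees at 0 and `Q`: this
  -- contradicts the mean value theorem.
  set q : ℝ → ℝ := fun φ => Real.log (α φ - β φ) - ε * a' φ with hq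
  have hqd : ∀ φ, ∃ m, |m - d| ≤ κ ∧ HasDerivAt q (ε * m) φ := by
    intro φ
    obtain ⟨x, hx, hxe⟩ : ∃ x ∈ Ioo a b, v φ (α φ) - v φ (β φ) = v' φ x * (α φ - β φ) := by
      rcases lt_or_gt_of_ne (sub_ne_zero.1 (hdiff φ)) with h | h
      · obtain ⟨x, hx, hxe⟩ := exists_hasDerivAt_eq_slope (v φ) (v' φ) h
          (fun y hy => ((hd φ y ⟨(hαm φ).1.trans_le hy.1, hy.2.trans_lt (hβm φ).2⟩).continuousAt).continuousWithinAt)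
          (fun y hy => hd φ y ⟨(hαm φ).1.trans hy.1, hy.2.trans (hβm φ).2⟩)
        refine ⟨x, ⟨(hαm φ).1.trans hx.1, hx.2.trans (hβm φ).2⟩, ?_⟩
        rw [hxe]
        have : β φ - α φ ≠ 0 := by linarith [h] |> fun (h : 0 < β φ - α φ) => h.ne'
        field_simp
        ring
      · obtain ⟨x, hx, hxe⟩ := exists_hasDerivAt_eq_slope (v φ) (v' φ) h
          (fun y hy => ((hd φ y ⟨(hβm φ).1.trans_le hy.1, hy.2.trans_lt (hαm φ).2⟩).continuousAt).continuousWithinAt)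
          (fun y hy => hd φ y ⟨(hβm φ).1.trans hy.1, hy.2.trans (hαm φ).2⟩)
        refine ⟨x, ⟨(hβm φ).1.trans hx.1, hx.2.trans (hαm φ).2⟩, ?_⟩
        rw [hxe]
        have := hdiff φ
        field_simp
    refine ⟨v' φ x - A φ + d, ?_, ?_⟩
    · simpa using hclose φ x hx
    · have h1 := (((hα φ).sub (hβ φ)).log (hdiff φ)).sub ((ha'd φ).const_mul ε)
      refine h1.congr_deriv ?_
      rw [← mul_sub, hxe]
      have := hdiff φ
      simp only [Pi.sub_apply]
      field_simp
      ring
  have hqper : q Q = q 0 := by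
    simp only [hq, ha'per]
    rw [show α Q = α 0 by simpa using hαQ 0, show β Q = β 0 by simpa using hβQ 0]
  choose m hm hmd using hqd
  obtain ⟨φ, hφ, he⟩ := exists_hasDerivAt_eq_slope q (fun φ => ε * m φ) hQ0
    (fun y _ => (hmd y).continuousAt.continuousWithinAt) (fun y _ => hmd y)
  rw [hqper, sub_self, zero_div] at he
  have hm0 : m φ = 0 := by
    rcases mul_eq_zero.1 he with h | h
    · exact absurd h hε.ne'
    · exact h
  have := hm φ
  rw [hm0, zero_sub, abs_neg] at this
  linarith

lemma exists_zero_of_mul_neg {F : ℝ → ℝ} {a b : ℝ} (hab : a ≤ b) (hF : ContinuousOn F (Icc a b))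
    (h : F a * F b < 0) : ∃ x ∈ Ioo a b, F x = 0 := by
  have h0 : (0 : ℝ) ∈ F '' Icc a b := by
    rcases mul_neg_iff.1 h with h | h
    · exact intermediate_value_Icc' hab hF ⟨h.2.le, h.1.le⟩
    · exact intermediate_value_Icc hab hF ⟨h.1.le, h.2.le⟩
  obtain ⟨x, hx, hx0⟩ := h0
  refine ⟨x, ⟨lt_of_le_of_ne hx.1 ?_, lt_of_le_of_ne hx.2 ?_⟩, hx0⟩
  · rintro rfl; simp [hx0] at h
  · rintro rfl; simp [hx0] at h

/-- Where the averaged right-hand side changes sign there is a periodic solution. -/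
lemma exists_periodic_solution {g : ℝ → ℝ → ℝ → ℝ} {P e₀ lo hi a b : ℝ} {K : NNReal} (hP : 0 < P)
    (hper : Function.Periodic g P) (he : 0 < e₀)
    (hg : ContinuousOn (fun p : ℝ × ℝ × ℝ => g p.1 p.2.1 p.2.2)
      (univ ×ˢ Icc 0 e₀ ×ˢ Icc lo hi))
    (hlip : ∀ φ, ∀ ε ∈ Icc 0 e₀, LipschitzOnWith K (g φ ε) (Icc lo hi))
    (hla : lo < a) (hab : a < b) (hbh : b < hi)
    (hsign : (∫ φ in (0 : ℝ)..P, g φ 0 a) * (∫ φ in (0 : ℝ)..P, g φ 0 b) < 0) :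
    ∀ᶠ ε in 𝓝[>] (0 : ℝ), ∃ β : ℝ → ℝ, Function.Periodic β P ∧ (∀ φ, β φ ∈ Ioo lo hi) ∧
      ∀ φ, HasDerivAt β (ε * g φ ε (β φ)) φ := by
  obtain ⟨B, hB0, hB⟩ := hper.exists_uniform_bound hP hg
  set fb : ℝ → ℝ := fun x => ∫ φ in (0 : ℝ)..P, g φ 0 x with hfb
  have hlohi : lo ≤ hi := by linarith
  have hne : fb a ≠ 0 ∧ fb b ≠ 0 := by
    constructor <;> intro h <;> simp [hfb] at h hsign <;> simp [h] at hsign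
  -- An error `η` in the slope, accumulated over one period, must not reverse the sign of the
  -- average at `a` or `b`.
  obtain ⟨η, hη, hηa, hηb⟩ : ∃ η > 0, η * P < |fb a| ∧ η * P < |fb b| := by
    refine ⟨min |fb a| |fb b| / (2 * P), ?_, ?_, ?_⟩
    · have := abs_pos.2 hne.1
      have := abs_pos.2 hne.2
      positivity
    all_goals
      have e : min |fb a| |fb b| / (2 * P) * P = min |fb a| |fb b| / 2 := by field_simp
      rw [e]
      have h1 := min_le_left |fb a| |fb b|
      have h2 := min_le_right |fb a| |fb b|
      have := abs_pos.2 hne.1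
      have := abs_pos.2 hne.2
      linarith
  obtain ⟨δ, hδ, hclose⟩ := hper.exists_uniform_close hP he.le hg hη
  have hμ : ∃ μ > 0, lo < a - μ ∧ b + μ < hi := by
    refine ⟨min (a - lo) (hi - b) / 2, ?_, ?_, ?_⟩
    · have : 0 < a - lo := by linarith
      have : 0 < hi - b := by linarith
      positivity
    · have := min_le_left (a - lo) (hi - b)
      linarith
    · have := min_le_right (a - lo) (hi - b)
      linarith
  obtain ⟨μ, hμ0, hμa, hμb⟩ := hμ
  have hsmall : ∀ᶠ ε in 𝓝[>] (0 : ℝ), 0 < ε ∧ ε < min (min e₀ δ) (min δ μ / (B * P)) := by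
    have : (0 : ℝ) < min (min e₀ δ) (min δ μ / (B * P)) := by positivity
    filter_upwards [Ioo_mem_nhdsGT this] with ε hε using hε
  filter_upwards [hsmall] with ε ⟨hε0, hε⟩
  have hεe : ε ∈ Icc 0 e₀ := ⟨hε0.le, by
    have := (lt_min_iff.1 hε).1; exact (lt_min_iff.1 this).1.le⟩
  have hεδ : ε ≤ δ := by have := (lt_min_iff.1 hε).1; exact (lt_min_iff.1 this).2.le
  have hεB : ε * B * P < min δ μ := by
    have := (lt_min_iff.1 hε).2
    rw [lt_div_iff₀ (by positivity)] at this
    linarith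
  -- Clamping the state to `[lo, hi]` makes the field bounded and Lipschitz on the whole line.
  -- Solutions starting in `[a, b]` stay in `(lo, hi)` over one period, so the clamp is removed at
  -- the end.
  set pr : ℝ → ℝ := fun x => (projIcc lo hi hlohi x : ℝ) with hpr
  have hprm : ∀ x, pr x ∈ Icc lo hi := fun x => (projIcc lo hi hlohi x).2
  have hpre : ∀ x ∈ Icc lo hi, pr x = x := fun x hx => by simp [hpr, projIcc_of_mem hlohi hx]
  set v : ℝ → ℝ → ℝ := fun φ x => ε * g φ ε (pr x) with hv
  have hvb : ∀ φ x, |v φ x| ≤ ε * B := fun φ x => by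
    simp only [hv, abs_mul, abs_of_pos hε0]
    have := hB φ ε hεe (pr x) (hprm x)
    gcongr
  set c : ℝ := (a + b) / 2
  set r : NNReal := ⟨(b - a) / 2, by linarith⟩
  have hrad : 0 ≤ (b - a) / 2 + ε * B * P := by
    have : 0 ≤ ε * B * P := by positivity
    linarith
  have hball : ∀ x ∈ Icc a b, x ∈ Metric.closedBall c r := by
    intro x hx
    rw [Metric.mem_closedBall, Real.dist_eq, abs_le]
    change -((b - a) / 2) ≤ x - (a + b) / 2 ∧ x - (a + b) / 2 ≤ (b - a) / 2
    constructor <;> linarith [hx.1, hx.2]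
  -- The radius exceeds that of `[a, b]` by `ε * B * P`, the greatest distance travelled in one
  -- period, so solutions exist on all of `[0, P]`.
  have hPL : IsPicardLindelof v (tmin := 0) (tmax := P) ⟨0, le_rfl, hP.le⟩ c
      ⟨(b - a) / 2 + ε * B * P, hrad⟩ r ⟨ε * B, by positivity⟩ (Real.toNNReal ε * K) := by
    refine ⟨fun t _ => LipschitzOnWith.of_dist_le_mul fun x _ y _ => ?_, fun x _ => ?_,
      fun t _ x _ => hvb t x, ?_⟩
    · have h1 := (hlip t ε hεe).dist_le_mul _ (hprm x) _ (hprm y)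
      have h2 : dist (pr x) (pr y) ≤ dist x y := by
        have := (LipschitzWith.projIcc hlohi).dist_le_mul x y
        simpa [hpr, Subtype.dist_eq] using this
      have h3 : dist (v t x) (v t y) = ε * dist (g t ε (pr x)) (g t ε (pr y)) := by
        simp only [hv, Real.dist_eq, ← mul_sub, abs_mul, abs_of_pos hε0]
      rw [h3]
      rw [NNReal.coe_mul, Real.coe_toNNReal _ hε0.le, mul_assoc]
      have : (K : ℝ) * dist (pr x) (pr y) ≤ K * dist x y := by gcongr
      exact mul_le_mul_of_nonneg_left (h1.trans this) hε0.le
    · have : ContinuousOn (fun t : ℝ => ((t, ε, pr x) : ℝ × ℝ × ℝ)) (Icc 0 P) := by fun_prop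
      exact continuousOn_const.mul
        (hg.comp this (fun t _ => ⟨mem_univ _, hεe, hprm x⟩))
    · change ε * B * max (P - 0) (0 - 0) ≤ (b - a) / 2 + ε * B * P - (b - a) / 2
      rw [sub_zero, sub_zero, max_eq_left hP.le]
      linarith
  obtain ⟨α, hα, L', hL'⟩ := hPL.exists_forall_mem_closedBall_eq_hasDerivWithinAt_lipschitzOnWith
  have hstay : ∀ x ∈ Icc a b, ∀ t ∈ Icc 0 P, |α x t - x| ≤ ε * B * P := by
    intro x hx t ht
    have h := norm_image_sub_le_of_norm_deriv_le_segment' (f := α x) (C := ε * B)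
      (fun s hs => (hα x (hball x hx)).2 s hs) (fun s _ => hvb s _) t ht
    have e0 : α x 0 = x := (hα x (hball x hx)).1
    rw [e0, Real.norm_eq_abs] at h
    refine h.trans ?_
    have : t - 0 ≤ P := by linarith [ht.2]
    gcongr
  have hIcc : ∀ x ∈ Icc a b, ∀ t ∈ Icc 0 P, α x t ∈ Ioo lo hi := by
    intro x hx t ht
    have h1 := abs_le.1 (hstay x hx t ht)
    have h2 : ε * B * P < μ := hεB.trans_le (min_le_right _ _)
    constructor <;> linarith [hx.1, hx.2, h1.1, h1.2]
  -- First-order expansion of the return map: the displacement is ε times the average, up to `ε * η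
  -- * P`.
  have hret : ∀ x ∈ Icc a b, |α x P - x - ε * fb x| ≤ ε * η * P := by
    intro x hx
    have hxI : x ∈ Icc lo hi := ⟨hla.le.trans hx.1, hx.2.trans hbh.le⟩
    have hcont : Continuous fun t => g t 0 x :=
      continuousOn_univ.1 <| hg.comp (f := fun t : ℝ => ((t, 0, x) : ℝ × ℝ × ℝ))
        (by fun_prop) (fun t _ => ⟨mem_univ _, ⟨le_rfl, he.le⟩, hxI⟩)
    have hder : ∀ s ∈ Icc 0 P, HasDerivWithinAt (fun t => α x t - ε * ∫ φ in (0 : ℝ)..t, g φ 0 x)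
        (v s (α x s) - ε * g s 0 x) (Icc 0 P) s := by
      intro s hs
      have h1 : HasDerivAt (fun t => ∫ φ in (0 : ℝ)..t, g φ 0 x) (g s 0 x) s :=
        intervalIntegral.integral_hasDerivAt_right (hcont.intervalIntegrable _ _)
          (hcont.stronglyMeasurableAtFilter _ _) hcont.continuousAt
      exact ((hα x (hball x hx)).2 s hs).sub ((h1.const_mul ε).hasDerivWithinAt)
    have h := norm_image_sub_le_of_norm_deriv_le_segment' (C := ε * η) hder (fun s hs => ?_) P
      ⟨hP.le, le_rfl⟩
    · have e0 : α x 0 = x := (hα x (hball x hx)).1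
      simp only [e0, intervalIntegral.integral_same, mul_zero, sub_zero, Real.norm_eq_abs] at h
      have e1 : α x P - x - ε * fb x = α x P - ε * (∫ φ in (0 : ℝ)..P, g φ 0 x) - x := by
        simp only [hfb]; ring
      rw [e1]
      exact h
    · have hs' : s ∈ Icc 0 P := ⟨hs.1, hs.2.le⟩
      have hm := Ioo_subset_Icc_self (hIcc x hx s hs')
      simp only [hv]
      rw [hpre _ hm, ← mul_sub, Real.norm_eq_abs, abs_mul, abs_of_pos hε0]
      have := hclose ε hεe hεδ s (α x s) hm x hxI
        ((hstay x hx s hs').trans (hεB.le.trans (min_le_left _ _)))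
      gcongr
  have hsgn : ∀ x ∈ Icc a b, η * P < |fb x| → 0 < (α x P - x) * fb x := by
    intro x hx h
    have h1 := abs_le.1 (hret x hx)
    have h2 : ε * (η * P) < ε * |fb x| := by gcongr
    rcases lt_trichotomy (fb x) 0 with h0 | h0 | h0
    · rw [abs_of_neg h0] at h2
      nlinarith [h1.2]
    · rw [h0, abs_zero] at h
      have : 0 < η * P := by positivity
      linarith
    · rw [abs_of_pos h0] at h2
      nlinarith [h1.1]
  have ha : a ∈ Icc a b := ⟨le_rfl, hab.le⟩
  have hb : b ∈ Icc a b := ⟨hab.le, le_rfl⟩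
  obtain ⟨x, hx, hx0⟩ := exists_zero_of_mul_neg (F := fun x => α x P - x) hab.le
    ((((hL' P ⟨hP.le, le_rfl⟩).continuousOn).mono hball).sub continuousOn_id) (by
      have h1 := hsgn a ha hηa
      have h2 := hsgn b hb hηb
      have h3 : 0 < ((α a P - a) * (α b P - b)) * (fb a * fb b) := by nlinarith
      by_contra hcon
      push Not at hcon
      have : fb a * fb b < 0 := hsign
      nlinarith)
  have hx' := Ioo_subset_Icc_self hx
  have hvper : Function.Periodic v P := fun t => by simp only [hv]; rw [hper t]
  have e0 : α x 0 = x := (hα x (hball x hx')).1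
  obtain ⟨β, hβp, hβe, hβd⟩ := exists_periodic_extension hP hvper (hα x (hball x hx')).2
    (by rw [e0]; linarith)
  have hβm : ∀ φ, β φ ∈ Ioo lo hi := by
    intro φ
    obtain ⟨φ', hφ', h⟩ := hβp.exists_mem_Ico₀ hP φ
    rw [h, hβe φ' (Ico_subset_Icc_self hφ')]
    exact hIcc x hx' φ' (Ico_subset_Icc_self hφ')
  refine ⟨β, hβp, hβm, fun φ => ?_⟩
  have := hβd φ
  simp only [hv] at this
  rwa [hpre _ (Ioo_subset_Icc_self (hβm φ))] at this

/-- Averaging: near a simple zero of the averaged right-hand side, `x' = ε g` has exactly one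
periodic solution for small `ε > 0`. -/
theorem exists_unique_periodic_solution {g g' : ℝ → ℝ → ℝ → ℝ} {P e₀ x₀ r₀ D : ℝ} (hP : 0 < P)
    (hper : Function.Periodic g P) (hper' : Function.Periodic g' P) (he : 0 < e₀) (hr₀ : 0 < r₀)
    (hg : ContinuousOn (fun p : ℝ × ℝ × ℝ => g p.1 p.2.1 p.2.2)
      (univ ×ˢ Icc 0 e₀ ×ˢ Icc (x₀ - r₀) (x₀ + r₀)))
    (hg' : ContinuousOn (fun p : ℝ × ℝ × ℝ => g' p.1 p.2.1 p.2.2)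
      (univ ×ˢ Icc 0 e₀ ×ˢ Icc (x₀ - r₀) (x₀ + r₀)))
    (hd : ∀ φ, ∀ ε ∈ Icc 0 e₀, ∀ x ∈ Icc (x₀ - r₀) (x₀ + r₀), HasDerivAt (g φ ε) (g' φ ε x) x)
    (hz : ∫ φ in (0 : ℝ)..P, g φ 0 x₀ = 0)
    (hD : HasDerivAt (fun x => ∫ φ in (0 : ℝ)..P, g φ 0 x) D x₀)
    (hDi : ∫ φ in (0 : ℝ)..P, g' φ 0 x₀ = D) (hD0 : D ≠ 0) :
    ∃ r ∈ Ioc 0 r₀, ∀ᶠ ε in 𝓝[>] (0 : ℝ), ∃ β : ℝ → ℝ, Function.Periodic β P ∧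
      (∀ φ, β φ ∈ Ioo (x₀ - r) (x₀ + r)) ∧ (∀ φ, HasDerivAt β (ε * g φ ε (β φ)) φ) ∧
      ∀ k : ℕ, 0 < k → ∀ α : ℝ → ℝ, Function.Periodic α (k * P) →
        (∀ φ, α φ ∈ Ioo (x₀ - r) (x₀ + r)) →
        (∀ φ, HasDerivAt α (ε * g φ ε (α φ)) φ) → α = β := by
  have hx₀ : x₀ ∈ Icc (x₀ - r₀) (x₀ + r₀) := ⟨by linarith, by linarith⟩
  have hκ : 0 < |D / P| / 2 := by
    have : D / P ≠ 0 := div_ne_zero hD0 hP.ne'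
    positivity
  obtain ⟨δ, hδ, hclose⟩ := hper'.exists_uniform_close hP he.le hg' hκ
  obtain ⟨B, hB0, hB⟩ := hper'.exists_uniform_bound hP hg'
  -- On this interval and for small ε the derivative stays within `|D / P| / 2` of its value at
  -- `x₀`, `ε = 0`, so existence and uniqueness hold on the same interval.
  set r := min δ r₀ with hr
  have hr0 : 0 < r := by positivity
  have hrr : r ≤ r₀ := min_le_right _ _
  have hsub : Icc (x₀ - r) (x₀ + r) ⊆ Icc (x₀ - r₀) (x₀ + r₀) :=
    Icc_subset_Icc (by linarith) (by linarith)
  have hlip : ∀ φ, ∀ ε ∈ Icc 0 e₀, LipschitzOnWith (Real.toNNReal B) (g φ ε)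
      (Icc (x₀ - r) (x₀ + r)) := by
    intro φ ε hε
    refine (convex_Icc _ _).lipschitzOnWith_of_nnnorm_hasDerivWithin_le
      (fun x hx => (hd φ ε hε x (hsub hx)).hasDerivWithinAt) (fun x hx => ?_)
    rw [← NNReal.coe_le_coe, coe_nnnorm, Real.norm_eq_abs]
    exact (hB φ ε hε x (hsub hx)).trans (Real.le_coe_toNNReal _)
  obtain ⟨s, hs0, hsr, hsign⟩ : ∃ s > 0, s < r ∧
      (∫ φ in (0 : ℝ)..P, g φ 0 (x₀ - s)) * (∫ φ in (0 : ℝ)..P, g φ 0 (x₀ + s)) < 0 := by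
    have hlim := hD.tendsto_slope
    have hev : ∀ᶠ x in 𝓝[≠] x₀, 0 < slope (fun x => ∫ φ in (0 : ℝ)..P, g φ 0 x) x₀ x * D := by
      have : Tendsto (fun x => slope (fun x => ∫ φ in (0 : ℝ)..P, g φ 0 x) x₀ x * D) (𝓝[≠] x₀)
          (𝓝 (D * D)) := hlim.mul_const D
      exact this.eventually (lt_mem_nhds (mul_self_pos.2 hD0))
    rw [eventually_nhdsWithin_iff, Metric.eventually_nhds_iff] at hev
    obtain ⟨ζ, hζ, h⟩ := hev
    refine ⟨min ζ r / 2, by positivity, by have := min_le_right ζ r; linarith, ?_⟩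
    set s := min ζ r / 2 with hs
    have hs0 : 0 < s := by positivity
    have hsζ : s < ζ := by have := min_le_left ζ r; linarith
    have h1 := @h (x₀ - s) (by simp [abs_of_pos hs0, hsζ]) (by simp [hs0.ne'])
    have h2 := @h (x₀ + s) (by simp [abs_of_pos hs0, hsζ]) (by simp [hs0.ne'])
    simp only [slope_def_field, hz, sub_zero] at h1 h2
    rw [show x₀ - s - x₀ = -s by ring, div_mul_eq_mul_div, lt_div_iff_of_neg (by linarith),
      zero_mul] at h1
    rw [show x₀ + s - x₀ = s by ring, div_mul_eq_mul_div, lt_div_iff₀ hs0, zero_mul] at h2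
    have h3 := mul_neg_of_neg_of_pos h1 h2
    by_contra hcon
    push Not at hcon
    nlinarith [mul_nonneg hcon (mul_self_nonneg D)]
  refine ⟨r, ⟨hr0, hrr⟩, ?_⟩
  have hex := exists_periodic_solution hP hper he
    (hg.mono (prod_mono Subset.rfl (prod_mono Subset.rfl hsub))) hlip
    (a := x₀ - s) (b := x₀ + s) (by linarith) (by linarith) (by linarith) hsign
  have hsmall : ∀ᶠ ε in 𝓝[>] (0 : ℝ), ε ∈ Ioo 0 (min e₀ δ) := Ioo_mem_nhdsGT (by positivity)
  have hcontA : Continuous fun φ => g' φ 0 x₀ :=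
    continuousOn_univ.1 <| hg'.comp (f := fun t : ℝ => ((t, 0, x₀) : ℝ × ℝ × ℝ))
      (by fun_prop) (fun t _ => ⟨mem_univ _, ⟨le_rfl, he.le⟩, hx₀⟩)
  filter_upwards [hex, hsmall] with ε ⟨β, hβp, hβm, hβd⟩ hε
  have hεe : ε ∈ Icc 0 e₀ := ⟨hε.1.le, (hε.2.trans_le (min_le_left _ _)).le⟩
  refine ⟨β, hβp, hβm, hβd, fun k hk α hαp hαm hαd => ?_⟩
  refine periodic_solution_unique (v := fun φ => g φ ε) (v' := fun φ => g' φ ε)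
    (A := fun φ => g' φ 0 x₀) (d := D / P) (κ := |D / P| / 2) hP hε.1 hcontA
    (fun φ => by simp only [hper' φ]) (by rw [hDi]; field_simp) (by linarith)
    (fun φ x hx => hd φ ε hεe x (hsub (Ioo_subset_Icc_self hx))) (fun φ x hx => ?_)
    (fun φ => hB φ 0 ⟨le_rfl, he.le⟩ x₀ hx₀) hk rfl hαd hαm hβd hβm hαp
    (by simpa using hβp.nsmul k)
  refine (hclose ε hεe (hε.2.trans_le (min_le_right _ _)).le φ x (hsub (Ioo_subset_Icc_self hx))
    x₀ hx₀ ?_).le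
  rw [abs_le]
  have : r ≤ δ := min_le_left _ _
  constructor <;> linarith [hx.1, hx.2]

/-! ### Reparametrisation and differentiation under the integral sign -/

/-- A derivative bounded below by `m > 0` forces at least linear growth in both directions, hence
surjectivity. It serves both to pass from angle to time and from time to angle. -/
lemma exists_inverse_of_le_deriv {φ ω : ℝ → ℝ} {m : ℝ} (hm : 0 < m)
    (hφ : ∀ t, HasDerivAt φ (ω t) t) (hω : ∀ t, m ≤ ω t) :
    ∃ ψ : ℝ → ℝ, (∀ x, φ (ψ x) = x) ∧ (∀ t, ψ (φ t) = t) ∧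
      ∀ x, HasDerivAt ψ (ω (ψ x))⁻¹ x := by
  have hmono : StrictMono φ := strictMono_of_deriv_pos fun t => by
    rw [(hφ t).deriv]; exact hm.trans_le (hω t)
  have hcont : Continuous φ := continuous_iff_continuousAt.2 fun t => (hφ t).continuousAt
  have hmono' : Monotone fun t => φ t - m * t := by
    refine monotone_of_deriv_nonneg (fun t => ?_) fun t => ?_
    · exact ((hφ t).sub ((hasDerivAt_id t).const_mul m)).differentiableAt
    · have h := ((hφ t).sub ((hasDerivAt_id t).const_mul m)).deriv
      have e : (φ - fun y => m * id y) = fun t => φ t - m * t := rfl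
      rw [e] at h
      rw [h, mul_one, sub_nonneg]
      exact hω t
  have hsurj : Function.Surjective φ := by
    refine hcont.surjective ?_ ?_
    · refine tendsto_atTop_mono' _ (f₁ := fun t => φ 0 + m * t) ?_
        (tendsto_atTop_add_const_left _ _ (tendsto_id.const_mul_atTop hm))
      filter_upwards [eventually_ge_atTop 0] with t ht
      have := hmono' ht
      simp only [mul_zero, sub_zero] at this
      linarith
    · refine tendsto_atBot_mono' _ (f₁ := fun t => φ 0 + m * t) ?_
        (tendsto_atBot_add_const_left _ _ (tendsto_id.const_mul_atBot hm))
      filter_upwards [eventually_le_atBot 0] with t ht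
      have := hmono' ht
      simp only [mul_zero, sub_zero] at this
      linarith
  set e := hmono.orderIsoOfSurjective φ hsurj
  have h1 : ∀ x, φ (e.symm x) = x := fun x => e.apply_symm_apply x
  have h2 : ∀ t, e.symm (φ t) = t := fun t => e.symm_apply_apply t
  refine ⟨e.symm, h1, h2, fun x => ?_⟩
  exact HasDerivAt.of_local_left_inverse e.symm.continuous.continuousAt (hφ _)
    (hm.trans_le (hω _)).ne' (Eventually.of_forall h1)

lemma hasDerivAt_intervalIntegral_param {F F' : ℝ → ℝ → ℝ} {a b x₀ r : ℝ} (hr : 0 < r)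
    (hF : ∀ x ∈ Icc (x₀ - r) (x₀ + r), Continuous fun φ => F φ x)
    (hF' : ContinuousOn (fun p : ℝ × ℝ => F' p.1 p.2) (univ ×ˢ Icc (x₀ - r) (x₀ + r)))
    (hd : ∀ φ, ∀ x ∈ Icc (x₀ - r) (x₀ + r), HasDerivAt (F φ) (F' φ x) x) :
    HasDerivAt (fun x => ∫ φ in a..b, F φ x) (∫ φ in a..b, F' φ x₀) x₀ := by
  have hs : Ioo (x₀ - r) (x₀ + r) ∈ 𝓝 x₀ := Ioo_mem_nhds (by linarith) (by linarith)
  have hx₀ : x₀ ∈ Icc (x₀ - r) (x₀ + r) := ⟨by linarith, by linarith⟩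
  obtain ⟨B, hB⟩ := (isCompact_uIcc.prod isCompact_Icc).exists_bound_of_continuousOn
    (hF'.mono (prod_mono (subset_univ (uIcc a b)) Subset.rfl))
  have hF'c : Continuous fun φ => F' φ x₀ :=
    continuousOn_univ.1 <| hF'.comp (f := fun t : ℝ => ((t, x₀) : ℝ × ℝ))
      (by fun_prop) (fun t _ => ⟨mem_univ _, hx₀⟩)
  refine (intervalIntegral.hasDerivAt_integral_of_dominated_loc_of_deriv_le
    (F := fun x φ => F φ x) (F' := fun x φ => F' φ x) (bound := fun _ => B) hs ?_ ?_ ?_ ?_ ?_ ?_).2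
  · filter_upwards [hs] with x hx
    exact (hF x (Ioo_subset_Icc_self hx)).aestronglyMeasurable
  · exact (hF x₀ hx₀).intervalIntegrable _ _
  · exact hF'c.aestronglyMeasurable
  · exact Eventually.of_forall fun φ hφ x hx =>
      hB (φ, x) ⟨uIoc_subset_uIcc hφ, Ioo_subset_Icc_self hx⟩
  · exact intervalIntegrable_const
  · exact Eventually.of_forall fun φ _ x hx => hd φ x (Ioo_subset_Icc_self hx)

/-! ### Planar fields close to a rotation -/

/-- The point with clockwise polar coordinates `(ρ, φ)`, the angle measured from the second axis. -/
noncomputable def polarPoint (ρ φ : ℝ) : ℝ × ℝ := (ρ * Real.sin φ, ρ * Real.cos φ)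

/-- The perturbed rotation `z' = J(z) (z₂, -z₁) + ε K(z)`. -/
def rotationField (J K₁ K₂ : ℝ × ℝ → ℝ) (ε : ℝ) (z : ℝ × ℝ) : ℝ × ℝ :=
  (J z * z.2 + ε * K₁ z, -(J z * z.1) + ε * K₂ z)

/-- Angular velocity of `rotationField` in polar coordinates. -/
noncomputable def angularSpeed (J K₁ K₂ : ℝ × ℝ → ℝ) (φ ε ρ : ℝ) : ℝ :=
  J (polarPoint ρ φ) +
    ε / ρ * (Real.cos φ * K₁ (polarPoint ρ φ) - Real.sin φ * K₂ (polarPoint ρ φ))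

/-- The right-hand side of the orbit equation `dρ/dφ = ε g` of `rotationField`. -/
noncomputable def radialSlope (J K₁ K₂ : ℝ × ℝ → ℝ) (φ ε ρ : ℝ) : ℝ :=
  (Real.sin φ * K₁ (polarPoint ρ φ) + Real.cos φ * K₂ (polarPoint ρ φ)) /
    angularSpeed J K₁ K₂ φ ε ρ

lemma polarPoint_add_two_pi (ρ φ : ℝ) : polarPoint ρ (φ + 2 * Real.pi) = polarPoint ρ φ := by
  simp [polarPoint]

lemma polarPoint_sq (ρ φ : ℝ) : (polarPoint ρ φ).1 ^ 2 + (polarPoint ρ φ).2 ^ 2 = ρ ^ 2 := by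
  simp only [polarPoint]
  linear_combination ρ ^ 2 * Real.sin_sq_add_cos_sq φ

lemma angularSpeed_periodic (J K₁ K₂ : ℝ × ℝ → ℝ) :
    Function.Periodic (angularSpeed J K₁ K₂) (2 * Real.pi) := fun φ => by
  ext ε ρ
  simp [angularSpeed, polarPoint_add_two_pi]

lemma radialSlope_periodic (J K₁ K₂ : ℝ × ℝ → ℝ) :
    Function.Periodic (radialSlope J K₁ K₂) (2 * Real.pi) := fun φ => by
  ext ε ρ
  simp [radialSlope, polarPoint_add_two_pi, angularSpeed_periodic J K₁ K₂ φ]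

section RotationField

variable {J K₁ K₂ : ℝ × ℝ → ℝ} {ε : ℝ}

/-- A closed solution of the orbit equation is a periodic orbit of the field. -/
lemma isPeriodicOrbit_of_radial {β : ℝ → ℝ} (hβp : Function.Periodic β (2 * Real.pi))
    (hβ0 : ∀ φ, 0 < β φ)
    (hβ : ∀ φ, HasDerivAt β (ε * radialSlope J K₁ K₂ φ ε (β φ)) φ)
    (hω : ∀ φ, 0 < angularSpeed J K₁ K₂ φ ε (β φ))
    (hωc : Continuous fun φ => angularSpeed J K₁ K₂ φ ε (β φ)) :
    IsPeriodicOrbit (rotationField J K₁ K₂ ε) (range fun φ => polarPoint (β φ) φ) := by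
  have h2π : 0 < 2 * Real.pi := by positivity
  set ω : ℝ → ℝ := fun φ => angularSpeed J K₁ K₂ φ ε (β φ) with hωdef
  have hωp : Function.Periodic ω (2 * Real.pi) := fun φ => by
    simp only [hωdef, angularSpeed_periodic J K₁ K₂ φ, hβp φ]
  have hic : Continuous fun φ => (ω φ)⁻¹ := hωc.inv₀ fun φ => (hω φ).ne'
  obtain ⟨M, hM⟩ := isCompact_Icc.exists_bound_of_continuousOn
    (s := Icc 0 (2 * Real.pi)) hωc.continuousOn
  have hM' : ∀ φ, ω φ ≤ max M 1 := fun φ => by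
    obtain ⟨φ', hφ', h⟩ := hωp.exists_mem_Ico₀ h2π φ
    rw [h]
    exact (le_abs_self _).trans ((hM φ' (Ico_subset_Icc_self hφ')).trans (le_max_left _ _))
  -- Time as a function of the angle; its inverse `ψ` parametrises the orbit by time, with period `τ
  -- (2π)`.
  set τ : ℝ → ℝ := fun φ => ∫ s in (0 : ℝ)..φ, (ω s)⁻¹ with hτ
  have hτd : ∀ φ, HasDerivAt τ (ω φ)⁻¹ φ := fun φ =>
    intervalIntegral.integral_hasDerivAt_right (hic.intervalIntegrable _ _)
      (hic.stronglyMeasurableAtFilter _ _) hic.continuousAt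
  obtain ⟨ψ, h1, h2, h3⟩ := exists_inverse_of_le_deriv (m := (max M 1)⁻¹) (by positivity) hτd
    (fun φ => inv_anti₀ (hω φ) (hM' φ))
  have hτp : ∀ φ, τ (φ + 2 * Real.pi) = τ φ + τ (2 * Real.pi) := by
    intro φ
    have hp : Function.Periodic (fun s => (ω s)⁻¹) (2 * Real.pi) := fun s => by
      simp only [hωp s]
    have := hp.intervalIntegral_add_eq φ 0
    simp only [hτ]
    rw [← intervalIntegral.integral_add_adjacent_intervals (hic.intervalIntegrable 0 φ)
      (hic.intervalIntegrable φ (φ + 2 * Real.pi)), this, zero_add]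
  have hTpos : 0 < τ (2 * Real.pi) := by
    have := intervalIntegral.intervalIntegral_pos_of_pos (hic.intervalIntegrable 0 (2 * Real.pi))
      (fun s => inv_pos.2 (hω s)) h2π
    exact this
  have hΓ : ∀ φ, HasDerivAt (fun φ => polarPoint (β φ) φ)
      ((ω φ)⁻¹ • rotationField J K₁ K₂ ε (polarPoint (β φ) φ)) φ := by
    intro φ
    have hs := (hβ φ).mul (Real.hasDerivAt_sin φ)
    have hc := (hβ φ).mul (Real.hasDerivAt_cos φ)
    refine (hs.prodMk hc).congr_deriv ?_
    have hω0 := (hω φ).ne'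
    have hβ0' := (hβ0 φ).ne'
    have hsc := Real.sin_sq_add_cos_sq φ
    have e2 : radialSlope J K₁ K₂ φ ε (β φ) = (Real.sin φ * K₁ (polarPoint (β φ) φ) +
      Real.cos φ * K₂ (polarPoint (β φ) φ)) / ω φ := rfl
    have e3 : ω φ * β φ = J (polarPoint (β φ) φ) * β φ + ε * (Real.cos φ * K₁ (polarPoint (β φ) φ)
      - Real.sin φ * K₂ (polarPoint (β φ) φ)) := by
      simp only [hωdef, angularSpeed]; field_simp
    have hω0' : ω φ ≠ 0 := hω0
    rw [e2]
    simp only [rotationField, Prod.smul_mk, smul_eq_mul]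
    generalize J (polarPoint (β φ) φ) = j at *
    generalize K₁ (polarPoint (β φ) φ) = k₁ at *
    generalize K₂ (polarPoint (β φ) φ) = k₂ at *
    simp only [polarPoint]
    ext
    · field_simp
      linear_combination Real.cos φ * e3 + ε * k₁ * hsc
    · field_simp
      linear_combination -Real.sin φ * e3 + ε * k₂ * hsc
  refine ⟨fun t => polarPoint (β (ψ t)) (ψ t), τ (2 * Real.pi), hTpos, fun t => ?_, fun t => ?_,
    ⟨τ (ψ 0 + Real.pi), ?_⟩, ?_⟩
  · have := (hΓ (ψ t)).scomp t (h3 t)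
    refine this.congr_deriv ?_
    have hω0 : ω (ψ t) ≠ 0 := (hω _).ne'
    rw [inv_inv, smul_smul, mul_inv_cancel₀ hω0, one_smul]
  · have e : ψ (t + τ (2 * Real.pi)) = ψ t + 2 * Real.pi := by
      rw [← h2 (ψ t + 2 * Real.pi), hτp, h1]
    simp only [e, hβp (ψ t), polarPoint_add_two_pi]
  -- Half a turn later the point lies on the opposite ray, so equality would make sine and cosine
  -- vanish together.
  · intro h
    simp only [h2, polarPoint, Real.sin_add_pi, Real.cos_add_pi, Prod.mk.injEq] at h
    have hs := h.1
    have hc := h.2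
    have hb1 := hβ0 (ψ 0 + Real.pi)
    have hb2 := hβ0 (ψ 0)
    have hs' : (β (ψ 0 + Real.pi) + β (ψ 0)) * Real.sin (ψ 0) = 0 := by linear_combination -hs
    have hc' : (β (ψ 0 + Real.pi) + β (ψ 0)) * Real.cos (ψ 0) = 0 := by linear_combination -hc
    have hne : β (ψ 0 + Real.pi) + β (ψ 0) ≠ 0 := by positivity
    have hs2 := (mul_eq_zero.1 hs').resolve_left hne
    have hc2 := (mul_eq_zero.1 hc').resolve_left hne
    have := Real.sin_sq_add_cos_sq (ψ 0)
    rw [hs2, hc2] at this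
    norm_num at this
  · ext z
    constructor
    · rintro ⟨φ, rfl⟩
      exact ⟨τ φ, by simp only [h2]⟩
    · rintro ⟨t, rfl⟩
      exact ⟨ψ t, rfl⟩

lemma exists_polarPoint_eq (z : ℝ × ℝ) :
    ∃ φ, z = polarPoint (Real.sqrt (z.1 ^ 2 + z.2 ^ 2)) φ := by
  -- The angle is measured from the second axis, so the second coordinate becomes the real part.
  set w : ℂ := ⟨z.2, z.1⟩
  have hn : ‖w‖ = Real.sqrt (z.1 ^ 2 + z.2 ^ 2) := by
    rw [Complex.norm_eq_sqrt_sq_add_sq]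
    simp [w, add_comm]
  refine ⟨w.arg, ?_⟩
  rw [← hn]
  ext
  · simp [polarPoint, Complex.norm_mul_sin_arg, w]
  · simp [polarPoint, Complex.norm_mul_cos_arg, w]

/-- A periodic orbit around the origin along which the angle increases is given by a periodic
solution of the orbit equation. -/
lemma exists_radial_of_isPeriodicOrbit {C : Set (ℝ × ℝ)} {U : Set (ℝ × ℝ)}
    (hJ : ContinuousOn J U) (hK₁ : ContinuousOn K₁ U) (hK₂ : ContinuousOn K₂ U)
    (hC : IsPeriodicOrbit (rotationField J K₁ K₂ ε) C) (hCU : C ⊆ U)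
    (h0 : ∀ z ∈ U, 0 < z.1 ^ 2 + z.2 ^ 2) {m : ℝ} (hm : 0 < m)
    (hω : ∀ φ ρ, 0 < ρ → polarPoint ρ φ ∈ U → m ≤ angularSpeed J K₁ K₂ φ ε ρ) :
    ∃ (k : ℕ) (α : ℝ → ℝ), 0 < k ∧ Function.Periodic α (k * (2 * Real.pi)) ∧
      (∀ φ, HasDerivAt α (ε * radialSlope J K₁ K₂ φ ε (α φ)) φ) ∧ (∀ φ, 0 < α φ) ∧
      C = range fun φ => polarPoint (α φ) φ := by
  obtain ⟨γ, T, hT, hγ, hγT, -, rfl⟩ := hC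
  have hU : ∀ t, γ t ∈ U := fun t => hCU ⟨t, rfl⟩
  have hγc : Continuous γ := continuous_iff_continuousAt.2 fun t => (hγ t).continuousAt
  have hJc : Continuous fun t => J (γ t) := hJ.comp_continuous hγc hU
  have hK₁c : Continuous fun t => K₁ (γ t) := hK₁.comp_continuous hγc hU
  have hK₂c : Continuous fun t => K₂ (γ t) := hK₂.comp_continuous hγc hU
  set s : ℝ → ℝ := fun t => (γ t).1
  set w : ℝ → ℝ := fun t => (γ t).2
  have hs : ∀ t, HasDerivAt s (J (γ t) * w t + ε * K₁ (γ t)) t := fun t => (hγ t).fst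
  have hw : ∀ t, HasDerivAt w (-(J (γ t) * s t) + ε * K₂ (γ t)) t := fun t => (hγ t).snd
  set ρ : ℝ → ℝ := fun t => Real.sqrt (s t ^ 2 + w t ^ 2) with hρdef
  have hpos : ∀ t, 0 < s t ^ 2 + w t ^ 2 := fun t => h0 _ (hU t)
  have hρ0 : ∀ t, 0 < ρ t := fun t => Real.sqrt_pos.2 (hpos t)
  have hρ2 : ∀ t, ρ t ^ 2 = s t ^ 2 + w t ^ 2 := fun t => Real.sq_sqrt (hpos t).le
  have hρd : ∀ t, HasDerivAt ρ (ε * (s t * K₁ (γ t) + w t * K₂ (γ t)) / ρ t) t := by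
    intro t
    have := (((hs t).pow 2).add ((hw t).pow 2)).sqrt (hpos t).ne'
    refine this.congr_deriv ?_
    have e : Real.sqrt ((s ^ 2 + w ^ 2) t) = ρ t := rfl
    rw [e]
    have := (hρ0 t).ne'
    field_simp
    simp
    ring
  have hsc : Continuous s := hγc.fst
  have hwc : Continuous w := hγc.snd
  have hρc : Continuous ρ := by fun_prop
  set Ω : ℝ → ℝ := fun t => J (γ t) + ε * (w t * K₁ (γ t) - s t * K₂ (γ t)) / ρ t ^ 2 with hΩ
  have hΩc : Continuous Ω := by
    refine hJc.add (Continuous.div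
      (continuous_const.mul ((hwc.mul hK₁c).sub (hsc.mul hK₂c))) (hρc.pow 2) fun t => ?_)
    have := (hρ0 t).ne'
    positivity
  obtain ⟨φ₀, hφ₀⟩ := exists_polarPoint_eq (γ 0)
  -- A continuous angle along the orbit is obtained by integrating the angular velocity from a polar
  -- angle of the initial point.
  set φ : ℝ → ℝ := fun t => φ₀ + ∫ x in (0 : ℝ)..t, Ω x with hφdef
  have hφd : ∀ t, HasDerivAt φ (Ω t) t := fun t =>
    (intervalIntegral.integral_hasDerivAt_right (hΩc.intervalIntegrable _ _)
      (hΩc.stronglyMeasurableAtFilter _ _) hΩc.continuousAt).const_add φ₀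
  -- `c₁` and `c₂` are the cosine and sine of the gap between the true polar angle and `φ`. They are
  -- constant and start at 1 and 0.
  set c₁ : ℝ → ℝ := fun t => (s t * Real.sin (φ t) + w t * Real.cos (φ t)) / ρ t with hc₁
  set c₂ : ℝ → ℝ := fun t => (s t * Real.cos (φ t) - w t * Real.sin (φ t)) / ρ t with hc₂
  have hd₁ : ∀ t, HasDerivAt c₁ 0 t := by
    intro t
    refine ((((hs t).mul (hφd t).sin).add ((hw t).mul (hφd t).cos)).div (hρd t)
      (hρ0 t).ne').congr_deriv ?_
    have h1 := (hρ0 t).ne'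
    have h2 := hρ2 t
    have h3 : Ω t * ρ t ^ 2 = J (γ t) * ρ t ^ 2 + ε * (w t * K₁ (γ t) - s t * K₂ (γ t)) := by
      simp only [hΩ]; field_simp
    simp only [Pi.add_apply, Pi.mul_apply]
    rw [div_eq_zero_iff]
    left
    have h4 : ρ t * (ε * (s t * K₁ (γ t) + w t * K₂ (γ t)) / ρ t) =
      ε * (s t * K₁ (γ t) + w t * K₂ (γ t)) := by field_simp
    apply mul_left_cancel₀ h1
    rw [mul_zero]
    linear_combination (s t * Real.cos (φ t) - w t * Real.sin (φ t)) * h3 +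
      ε * (K₁ (γ t) * Real.sin (φ t) + K₂ (γ t) * Real.cos (φ t)) * h2 -
      (s t * Real.sin (φ t) + w t * Real.cos (φ t)) * h4
  have hd₂ : ∀ t, HasDerivAt c₂ 0 t := by
    intro t
    refine ((((hs t).mul (hφd t).cos).sub ((hw t).mul (hφd t).sin)).div (hρd t)
      (hρ0 t).ne').congr_deriv ?_
    have h1 := (hρ0 t).ne'
    have h2 := hρ2 t
    have h3 : Ω t * ρ t ^ 2 = J (γ t) * ρ t ^ 2 + ε * (w t * K₁ (γ t) - s t * K₂ (γ t)) := by
      simp only [hΩ]; field_simp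
    simp only [Pi.sub_apply, Pi.mul_apply]
    rw [div_eq_zero_iff]
    left
    have h4 : ρ t * (ε * (s t * K₁ (γ t) + w t * K₂ (γ t)) / ρ t) =
      ε * (s t * K₁ (γ t) + w t * K₂ (γ t)) := by field_simp
    apply mul_left_cancel₀ h1
    rw [mul_zero]
    linear_combination -(s t * Real.sin (φ t) + w t * Real.cos (φ t)) * h3 +
      ε * (K₁ (γ t) * Real.cos (φ t) - K₂ (γ t) * Real.sin (φ t)) * h2 -
      (s t * Real.cos (φ t) - w t * Real.sin (φ t)) * h4
  have hφz : φ 0 = φ₀ := by simp [hφdef]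
  have hs0 : s 0 = ρ 0 * Real.sin φ₀ := congrArg Prod.fst hφ₀
  have hw0 : w 0 = ρ 0 * Real.cos φ₀ := congrArg Prod.snd hφ₀
  have hc₁1 : ∀ t, c₁ t = 1 := by
    intro t
    rw [is_const_of_deriv_eq_zero (fun t => (hd₁ t).differentiableAt) (fun t => (hd₁ t).deriv) t 0]
    simp only [hc₁, hφz, hs0, hw0]
    have := (hρ0 0).ne'
    field_simp
    linear_combination Real.sin_sq_add_cos_sq φ₀
  have hc₂0 : ∀ t, c₂ t = 0 := by
    intro t
    rw [is_const_of_deriv_eq_zero (fun t => (hd₂ t).differentiableAt) (fun t => (hd₂ t).deriv) t 0]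
    simp only [hc₂, hφz, hs0, hw0]
    ring
  have hsw : ∀ t, s t = ρ t * Real.sin (φ t) ∧ w t = ρ t * Real.cos (φ t) := by
    intro t
    have h1 := hc₁1 t
    have h2 := hc₂0 t
    simp only [hc₁, hc₂, div_eq_zero_iff, (hρ0 t).ne', or_false] at h1 h2
    rw [div_eq_one_iff_eq (hρ0 t).ne'] at h1
    have h3 := Real.sin_sq_add_cos_sq (φ t)
    constructor
    · linear_combination Real.sin (φ t) * h1 + Real.cos (φ t) * h2 - s t * h3
    · linear_combination Real.cos (φ t) * h1 - Real.sin (φ t) * h2 - w t * h3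
  have hγpol : ∀ t, γ t = polarPoint (ρ t) (φ t) := fun t => Prod.ext (hsw t).1 (hsw t).2
  have hΩeq : ∀ t, Ω t = angularSpeed J K₁ K₂ (φ t) ε (ρ t) := by
    intro t
    simp only [hΩ, angularSpeed]
    rw [← hγpol, (hsw t).1, (hsw t).2]
    have := (hρ0 t).ne'
    field_simp
  have hΩm : ∀ t, m ≤ Ω t := fun t => by
    rw [hΩeq]
    exact hω _ _ (hρ0 t) (by rw [← hγpol]; exact hU t)
  obtain ⟨ψ, h1, h2, h3⟩ := exists_inverse_of_le_deriv hm hφd hΩm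
  have hsT : ∀ t, s (t + T) = s t := fun t => by simp only [s, hγT t]
  have hwT : ∀ t, w (t + T) = w t := fun t => by simp only [w, hγT t]
  have hρT : ∀ t, ρ (t + T) = ρ t := fun t => by simp only [hρdef, hsT, hwT]
  have hΩT : Function.Periodic Ω T := fun t => by simp only [hΩ, hγT, hsT, hwT, hρT]
  set Φ := ∫ x in (0 : ℝ)..T, Ω x with hΦ
  have hφT : ∀ t, φ (t + T) = φ t + Φ := by
    intro t
    have := hΩT.intervalIntegral_add_eq t 0
    simp only [hφdef]
    rw [← intervalIntegral.integral_add_adjacent_intervals (hΩc.intervalIntegrable 0 t)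
      (hΩc.intervalIntegrable t (t + T)), this, zero_add, add_assoc]
  have hΦ0 : 0 < Φ := intervalIntegral.intervalIntegral_pos_of_pos (hΩc.intervalIntegrable 0 T)
      (fun t => hm.trans_le (hΩm t)) hT
  -- A closed orbit might wind `k` times before closing, so its radius is only known to be
  -- `2πk`-periodic. This is why uniqueness was proved for every multiple of the period.
  obtain ⟨k, hk0, hk⟩ : ∃ k : ℕ, 0 < k ∧ Φ = k * (2 * Real.pi) := by
    have hs1 : Real.sin (φ 0 + Φ) = Real.sin (φ 0) := by
      rw [← hφT 0]
      apply mul_left_cancel₀ (hρ0 0).ne'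
      rw [← (hsw 0).1, ← hsT 0, (hsw _).1, hρT]
    have hc1 : Real.cos (φ 0 + Φ) = Real.cos (φ 0) := by
      rw [← hφT 0]
      apply mul_left_cancel₀ (hρ0 0).ne'
      rw [← (hsw 0).2, ← hwT 0, (hsw _).2, hρT]
    obtain ⟨k, hk⟩ := Real.Angle.angle_eq_iff_two_pi_dvd_sub.1 (Real.Angle.cos_sin_inj hc1 hs1)
    have hk' : Φ = 2 * Real.pi * k := by linarith
    have hkpos : 0 < k := by
      have : (0 : ℝ) < k := by
        by_contra hcon
        push Not at hcon
        have : 2 * Real.pi * k ≤ 0 := mul_nonpos_of_nonneg_of_nonpos (by positivity) hcon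
        linarith
      exact_mod_cast this
    obtain ⟨n, rfl⟩ := Int.eq_ofNat_of_zero_le hkpos.le
    refine ⟨n, by exact_mod_cast hkpos, ?_⟩
    rw [hk']
    push_cast
    ring
  refine ⟨k, fun x => ρ (ψ x), hk0, fun x => ?_, fun x => ?_, fun x => hρ0 _, ?_⟩
  · have e : ψ (x + k * (2 * Real.pi)) = ψ x + T := by
      rw [← h2 (ψ x + T), hφT, h1, hk]
    simp only [e, hρT]
  · have := (hρd (ψ x)).scomp x (h3 x)
    refine this.congr_deriv ?_
    have h5 := hsw (ψ x)
    have h6 := hΩeq (ψ x)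
    have h7 := hγpol (ψ x)
    rw [h1] at h5 h6 h7
    simp only [radialSlope, smul_eq_mul]
    rw [← h6, ← h7, h5.1, h5.2]
    have := (hρ0 (ψ x)).ne'
    have := (hm.trans_le (hΩm (ψ x))).ne'
    field_simp
  · ext z
    constructor
    · rintro ⟨t, rfl⟩
      exact ⟨φ t, by simp only [h2, hγpol t]⟩
    · rintro ⟨x, rfl⟩
      refine ⟨ψ x, ?_⟩
      rw [hγpol, h1]

/-- The averaged right-hand side of the orbit equation of `rotationField`. -/
noncomputable def radialAverage (J K₁ K₂ : ℝ × ℝ → ℝ) (ρ : ℝ) : ℝ :=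
  ∫ φ in (0 : ℝ)..2 * Real.pi, radialSlope J K₁ K₂ φ 0 ρ

/-- A simple zero of the averaged function yields a limit cycle near the corresponding circle. -/
theorem eventually_exists_isLimitCycle {R ρ₀ D r : ℝ}
    (hJ : ContDiffOn ℝ 1 J {z | z.1 ^ 2 + z.2 ^ 2 < R ^ 2})
    (hK₁ : ContDiffOn ℝ 1 K₁ {z | z.1 ^ 2 + z.2 ^ 2 < R ^ 2})
    (hK₂ : ContDiffOn ℝ 1 K₂ {z | z.1 ^ 2 + z.2 ^ 2 < R ^ 2})
    (hJ0 : ∀ z : ℝ × ℝ, z.1 ^ 2 + z.2 ^ 2 < R ^ 2 → 0 < J z)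
    (hρ₀ : 0 < ρ₀) (hρR : ρ₀ < R) (hr : 0 < r)
    (hz : radialAverage J K₁ K₂ ρ₀ = 0) (hD : HasDerivAt (radialAverage J K₁ K₂) D ρ₀)
    (hD0 : D ≠ 0) :
    ∀ᶠ ε in 𝓝[>] (0 : ℝ), ∃ C, IsLimitCycle (rotationField J K₁ K₂ ε) C ∧
      ∀ z ∈ C, √(z.1 ^ 2 + z.2 ^ 2) ∈ Ioo (ρ₀ - r) (ρ₀ + r) := by
  set B : Set (ℝ × ℝ) := {z | z.1 ^ 2 + z.2 ^ 2 < R ^ 2} with hB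
  have hBo : IsOpen B := isOpen_lt (by fun_prop) (by fun_prop)
  obtain ⟨r₀, hr₀, hr₀r, hr₀l, hr₀R⟩ : ∃ r₀ > 0, r₀ ≤ r ∧ r₀ < ρ₀ ∧ ρ₀ + r₀ < R := by
    refine ⟨min r (min ρ₀ (R - ρ₀) / 2), ?_, min_le_left _ _, ?_, ?_⟩
    · have : 0 < R - ρ₀ := by linarith
      positivity
    · have h1 := min_le_right r (min ρ₀ (R - ρ₀) / 2)
      have h2 := min_le_left ρ₀ (R - ρ₀)
      linarith
    · have h1 := min_le_right r (min ρ₀ (R - ρ₀) / 2)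
      have h2 := min_le_right ρ₀ (R - ρ₀)
      linarith
  set I := Icc (ρ₀ - r₀) (ρ₀ + r₀) with hI
  have hI0 : ∀ x ∈ I, 0 < x := fun x hx => by linarith [hx.1]
  have hIR : ∀ x ∈ I, x < R := fun x hx => by linarith [hx.2]
  have hpB : ∀ φ x, 0 < x → x < R → polarPoint x φ ∈ B := by
    intro φ x h1 h2
    simp only [hB, mem_ofPred_eq, polarPoint_sq]
    gcongr
  have hpolar : ContDiff ℝ 1 fun p : ℝ × ℝ × ℝ => polarPoint p.2.2 p.1 := by
    unfold polarPoint
    fun_prop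
  set V : Set (ℝ × ℝ × ℝ) := {p | 0 < p.2.2 ∧ p.2.2 < R} with hV
  have hVo : IsOpen V := by
    have h1 : IsOpen {p : ℝ × ℝ × ℝ | 0 < p.2.2} := isOpen_lt (by fun_prop) (by fun_prop)
    have h2 : IsOpen {p : ℝ × ℝ × ℝ | p.2.2 < R} := isOpen_lt (by fun_prop) (by fun_prop)
    exact h1.inter h2
  have hmaps : MapsTo (fun p : ℝ × ℝ × ℝ => polarPoint p.2.2 p.1) V B :=
    fun p hp => hpB _ _ hp.1 hp.2
  have hJV := hJ.comp hpolar.contDiffOn hmaps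
  have hK₁V := hK₁.comp hpolar.contDiffOn hmaps
  have hK₂V := hK₂.comp hpolar.contDiffOn hmaps
  have hsin : ContDiffOn ℝ 1 (fun p : ℝ × ℝ × ℝ => Real.sin p.1) V := by fun_prop
  have hcos : ContDiffOn ℝ 1 (fun p : ℝ × ℝ × ℝ => Real.cos p.1) V := by fun_prop
  have hωV : ContDiffOn ℝ 1 (fun p : ℝ × ℝ × ℝ => angularSpeed J K₁ K₂ p.1 p.2.1 p.2.2) V := by
    have hdiv : ContDiffOn ℝ 1 (fun p : ℝ × ℝ × ℝ => p.2.1 / p.2.2) V :=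
      ContDiffOn.div (by fun_prop) (by fun_prop) fun p hp => hp.1.ne'
    exact hJV.add (hdiv.mul ((hcos.mul hK₁V).sub (hsin.mul hK₂V)))
  -- The orbit equation divides by the angular speed, so smoothness is asserted on the open set
  -- where that speed is nonzero.
  have hV' : IsOpen (V ∩ {p | angularSpeed J K₁ K₂ p.1 p.2.1 p.2.2 ≠ 0}) :=
    hωV.continuousOn.isOpen_inter_preimage hVo isOpen_ne
  set V' := V ∩ {p : ℝ × ℝ × ℝ | angularSpeed J K₁ K₂ p.1 p.2.1 p.2.2 ≠ 0} with hV'def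
  have hgV : ContDiffOn ℝ 1 (fun p : ℝ × ℝ × ℝ => radialSlope J K₁ K₂ p.1 p.2.1 p.2.2) V' :=
    (((hsin.mul hK₁V).add (hcos.mul hK₂V)).mono inter_subset_left).div
      (hωV.mono inter_subset_left) fun p hp => hp.2
  set G : ℝ × ℝ × ℝ → ℝ := fun p => radialSlope J K₁ K₂ p.1 p.2.1 p.2.2 with hG
  set g' : ℝ → ℝ → ℝ → ℝ := fun φ ε x => deriv (radialSlope J K₁ K₂ φ ε) x with hg'
  have hline : ∀ φ ε x : ℝ, HasDerivAt (fun y : ℝ => ((φ, ε, y) : ℝ × ℝ × ℝ)) (0, 0, 1) x :=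
    fun φ ε x => (hasDerivAt_const x φ).prodMk ((hasDerivAt_const x ε).prodMk (hasDerivAt_id x))
  have hgd : ∀ φ ε x, (φ, ε, x) ∈ V' →
      HasDerivAt (radialSlope J K₁ K₂ φ ε) (fderiv ℝ G (φ, ε, x) (0, 0, 1)) x := by
    intro φ ε x hp
    have h1 : HasFDerivAt G (fderiv ℝ G (φ, ε, x)) (φ, ε, x) :=
      ((hgV.contDiffAt (hV'.mem_nhds hp)).differentiableAt one_ne_zero).hasFDerivAt
    exact h1.comp_hasDerivAt (f := fun y : ℝ => ((φ, ε, y) : ℝ × ℝ × ℝ)) x (hline φ ε x)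
  have hgc' : ContinuousOn (fun p : ℝ × ℝ × ℝ => g' p.1 p.2.1 p.2.2) V' := by
    have h1 := (hgV.continuousOn_fderiv_of_isOpen hV' le_rfl).clm_apply
      (continuousOn_const (c := ((0, 0, 1) : ℝ × ℝ × ℝ)))
    refine h1.congr fun p hp => ?_
    exact (hgd p.1 p.2.1 p.2.2 hp).deriv
  have h2π : (0 : ℝ) < 2 * Real.pi := by positivity
  -- lower bound for the angular speed
  obtain ⟨m, hm, e₀, he₀, hωm⟩ : ∃ m > 0, ∃ e₀ > 0, ∀ φ, ∀ ε ∈ Icc 0 e₀, ∀ x ∈ I,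
      m ≤ angularSpeed J K₁ K₂ φ ε x := by
    have hsubV : univ ×ˢ Icc (0 : ℝ) 1 ×ˢ I ⊆ V := fun p hp => ⟨hI0 _ hp.2.2, hIR _ hp.2.2⟩
    have hcomp : IsCompact (Icc (0 : ℝ) (2 * Real.pi) ×ˢ I) := isCompact_Icc.prod isCompact_Icc
    have hne : (Icc (0 : ℝ) (2 * Real.pi) ×ˢ I).Nonempty :=
      ⟨(0, ρ₀), ⟨le_rfl, h2π.le⟩, by linarith, by linarith⟩
    have hc0 : ContinuousOn (fun p : ℝ × ℝ => angularSpeed J K₁ K₂ p.1 0 p.2)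
        (Icc (0 : ℝ) (2 * Real.pi) ×ˢ I) :=
      hωV.continuousOn.comp (f := fun p : ℝ × ℝ => ((p.1, 0, p.2) : ℝ × ℝ × ℝ)) (by fun_prop)
        fun p hp => hsubV ⟨mem_univ _, ⟨le_rfl, zero_le_one⟩, hp.2⟩
    obtain ⟨p₀, hp₀, hmin⟩ := hcomp.exists_isMinOn hne hc0
    have hpos : 0 < angularSpeed J K₁ K₂ p₀.1 0 p₀.2 := by
      simp only [angularSpeed, zero_div, zero_mul, add_zero]
      exact hJ0 _ (hpB _ _ (hI0 _ hp₀.2) (hIR _ hp₀.2))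
    set m₀ := angularSpeed J K₁ K₂ p₀.1 0 p₀.2
    obtain ⟨δ, hδ, hcl⟩ := (angularSpeed_periodic J K₁ K₂).exists_uniform_close h2π zero_le_one
      (hωV.continuousOn.mono hsubV) (half_pos hpos)
    refine ⟨m₀ / 2, half_pos hpos, min δ 1, by positivity, fun φ ε hε x hx => ?_⟩
    have h1 := hcl ε ⟨hε.1, hε.2.trans (min_le_right _ _)⟩ (hε.2.trans (min_le_left _ _)) φ x hx
      x hx (by simp [hδ.le])
    have h2 : m₀ ≤ angularSpeed J K₁ K₂ φ 0 x := by
      obtain ⟨φ', hφ', h⟩ := (angularSpeed_periodic J K₁ K₂).exists_mem_Ico₀ h2π φ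
      rw [h]
      exact hmin (show (φ', x) ∈ _ from ⟨Ico_subset_Icc_self hφ', hx⟩)
    linarith [(abs_lt.1 h1).1]
  have hsub : univ ×ˢ Icc 0 e₀ ×ˢ I ⊆ V' := fun p hp =>
    ⟨⟨hI0 _ hp.2.2, hIR _ hp.2.2⟩, (hm.trans_le (hωm p.1 p.2.1 hp.2.1 p.2.2 hp.2.2)).ne'⟩
  have hgd' : ∀ φ, ∀ ε ∈ Icc 0 e₀, ∀ x ∈ I,
      HasDerivAt (radialSlope J K₁ K₂ φ ε) (g' φ ε x) x := fun φ ε hε x hx =>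
    (hgd φ ε x (hsub ⟨mem_univ _, hε, hx⟩)).differentiableAt.hasDerivAt
  have h0e : (0 : ℝ) ∈ Icc 0 e₀ := ⟨le_rfl, he₀.le⟩
  have hDi : ∫ φ in (0 : ℝ)..2 * Real.pi, g' φ 0 ρ₀ = D := by
    refine HasDerivAt.unique (hasDerivAt_intervalIntegral_param
      (F := fun φ x => radialSlope J K₁ K₂ φ 0 x) (F' := fun φ x => g' φ 0 x) hr₀
      (fun x hx => ?_) ?_ fun φ x hx => hgd' φ 0 h0e x hx) hD
    · exact continuousOn_univ.1 <| hgV.continuousOn.comp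
        (f := fun t : ℝ => ((t, 0, x) : ℝ × ℝ × ℝ)) (by fun_prop)
        fun t _ => hsub ⟨mem_univ _, h0e, hx⟩
    · exact hgc'.comp (f := fun p : ℝ × ℝ => ((p.1, 0, p.2) : ℝ × ℝ × ℝ)) (by fun_prop)
        fun p hp => hsub ⟨mem_univ _, h0e, hp.2⟩
  have hper' : Function.Periodic g' (2 * Real.pi) := fun φ => by
    simp only [hg', radialSlope_periodic J K₁ K₂ φ]
  obtain ⟨r', hr', hev⟩ := exists_unique_periodic_solution h2π (radialSlope_periodic J K₁ K₂)
    hper' he₀ hr₀ (hgV.continuousOn.mono hsub) (hgc'.mono hsub) hgd' hz hD hDi hD0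
  have hsmall : ∀ᶠ ε in 𝓝[>] (0 : ℝ), ε ∈ Ioo 0 e₀ := Ioo_mem_nhdsGT he₀
  filter_upwards [hev, hsmall] with ε ⟨β, hβp, hβm, hβd, huniq⟩ hε
  have hε' : ε ∈ Icc 0 e₀ := Ioo_subset_Icc_self hε
  have hsubI : Ioo (ρ₀ - r') (ρ₀ + r') ⊆ I := fun x hx =>
    ⟨by linarith [hx.1, hr'.2], by linarith [hx.2, hr'.2]⟩
  have hβI : ∀ φ, β φ ∈ I := fun φ => hsubI (hβm φ)
  have hβ0 : ∀ φ, 0 < β φ := fun φ => hI0 _ (hβI φ)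
  have hβc : Continuous β := continuous_iff_continuousAt.2 fun φ => (hβd φ).continuousAt
  have hnorm : ∀ {x : ℝ} (φ : ℝ), 0 < x →
      √((polarPoint x φ).1 ^ 2 + (polarPoint x φ).2 ^ 2) = x := fun φ hx => by
    rw [polarPoint_sq, Real.sqrt_sq hx.le]
  have horb := isPeriodicOrbit_of_radial (J := J) (K₁ := K₁) (K₂ := K₂) hβp hβ0 hβd
    (fun φ => hm.trans_le (hωm φ ε hε' _ (hβI φ)))
    (continuousOn_univ.1 <| hωV.continuousOn.comp
      (f := fun t : ℝ => ((t, ε, β t) : ℝ × ℝ × ℝ)) (by fun_prop)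
        fun t _ => ⟨hI0 _ (hβI t), hIR _ (hβI t)⟩)
  -- The isolating neighbourhood is the annulus of uniqueness: a periodic orbit inside it solves the
  -- orbit equation and so coincides with `β`.
  set U : Set (ℝ × ℝ) := {z | √(z.1 ^ 2 + z.2 ^ 2) ∈ Ioo (ρ₀ - r') (ρ₀ + r')} with hU
  have hU0 : ∀ z ∈ U, 0 < z.1 ^ 2 + z.2 ^ 2 := fun z hz =>
    Real.sqrt_pos.1 (hI0 _ (hsubI hz))
  have hUB : U ⊆ B := by
    intro z hz
    obtain ⟨φ, hφ⟩ := exists_polarPoint_eq z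
    rw [hφ]
    exact hpB _ _ (hI0 _ (hsubI hz)) (hIR _ (hsubI hz))
  refine ⟨_, ⟨horb, U, isOpen_Ioo.preimage (by fun_prop), ?_, fun C' hC' hC'U => ?_⟩, ?_⟩
  · rintro _ ⟨φ, rfl⟩
    simp only [hU, mem_ofPred_eq, hnorm φ (hβ0 φ)]
    exact hβm φ
  · obtain ⟨k, α, hk, hαp, hαd, hα0, rfl⟩ := exists_radial_of_isPeriodicOrbit
      (hJ.continuousOn.mono hUB) (hK₁.continuousOn.mono hUB) (hK₂.continuousOn.mono hUB)
      hC' hC'U hU0 hm (fun φ ρ hρ hmem => hωm φ ε hε' ρ (hsubI (by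
        have h := hmem
        simp only [hU, mem_ofPred_eq, hnorm φ hρ] at h
        exact h)))
    have := huniq k hk α hαp (fun φ => by
      have h := hC'U ⟨φ, rfl⟩
      simp only [hU, mem_ofPred_eq, hnorm φ (hα0 φ)] at h
      exact h) hαd
    rw [this]
  · rintro _ ⟨φ, rfl⟩
    rw [hnorm φ (hβ0 φ)]
    exact ⟨by linarith [(hβm φ).1, hr'.2], by linarith [(hβm φ).2, hr'.2]⟩

end RotationField

/-! ### Change of coordinates -/

/-- Periodic orbits are carried along by maps intertwining two fields. -/
lemma IsPeriodicOrbit.image {X Z : ℝ × ℝ → ℝ × ℝ} {Θ Ψ : ℝ × ℝ → ℝ × ℝ} {C : Set (ℝ × ℝ)}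
    (hΘ : ∀ z ∈ C, ∃ L : ℝ × ℝ →L[ℝ] ℝ × ℝ, HasFDerivAt Θ L z ∧ L (Z z) = X (Θ z))
    (hinv : ∀ z ∈ C, Ψ (Θ z) = z) (hC : IsPeriodicOrbit Z C) : IsPeriodicOrbit X (Θ '' C) := by
  obtain ⟨γ, T, hT, hγ, hper, ⟨t, ht⟩, rfl⟩ := hC
  refine ⟨Θ ∘ γ, T, hT, fun t => ?_, fun t => by simp [hper t], ⟨t, fun h => ht ?_⟩,
    (range_comp Θ γ).symm⟩
  · obtain ⟨L, hL, hX⟩ := hΘ (γ t) ⟨t, rfl⟩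
    have := hL.comp_hasDerivAt t (hγ t)
    rwa [hX] at this
  · rw [← hinv (γ t) ⟨t, rfl⟩, ← hinv (γ 0) ⟨0, rfl⟩]
    exact congrArg Ψ h

/-- Limit cycles are carried along by a diffeomorphism intertwining two fields. -/
lemma IsLimitCycle.image {X Z : ℝ × ℝ → ℝ × ℝ} {Θ Ψ : ℝ × ℝ → ℝ × ℝ} {D O C : Set (ℝ × ℝ)}
    (hO : IsOpen O) (hΘ : ∀ z ∈ D, Θ z ∈ O ∧ Ψ (Θ z) = z) (hΨ : ∀ x ∈ O, Ψ x ∈ D ∧ Θ (Ψ x) = x)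
    (hΘd : ∀ z ∈ D, DifferentiableAt ℝ Θ z)
    (hΨd : ∀ x ∈ O, ∃ L : ℝ × ℝ →L[ℝ] ℝ × ℝ, HasFDerivAt Ψ L x ∧ L (X x) = Z (Ψ x))
    (hCD : C ⊆ D) (hC : IsLimitCycle Z C) : IsLimitCycle X (Θ '' C) := by
  have hΘL : ∀ z ∈ D, ∃ L : ℝ × ℝ →L[ℝ] ℝ × ℝ, HasFDerivAt Θ L z ∧ L (Z z) = X (Θ z) := by
    intro z hz
    obtain ⟨L, hL, hX⟩ := hΨd (Θ z) (hΘ z hz).1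
    have hd := (hΘd z hz).hasFDerivAt
    refine ⟨_, hd, ?_⟩
    rw [(hΘ z hz).2] at hX
    have hd' : HasFDerivAt Θ (fderiv ℝ Θ z) (Ψ (Θ z)) := by rwa [(hΘ z hz).2]
    -- Only `Ψ` is assumed to intertwine the fields. The derivative of `Θ` inverts that of `Ψ`,
    -- because `Θ ∘ Ψ` is the identity near `Θ z`.
    have hcomp := hd'.comp (Θ z) hL
    have hid : HasFDerivAt (Θ ∘ Ψ) (ContinuousLinearMap.id ℝ (ℝ × ℝ)) (Θ z) := by
      refine (hasFDerivAt_id (Θ z)).congr_of_eventuallyEq ?_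
      filter_upwards [hO.mem_nhds (hΘ z hz).1] with x hx using (hΨ x hx).2
    have := congrArg (fun M : ℝ × ℝ →L[ℝ] ℝ × ℝ => M (X (Θ z))) (hcomp.unique hid)
    simpa [hX] using this
  obtain ⟨horb, U, hU, hCU, huniq⟩ := hC
  have hΨc : ContinuousOn Ψ O := fun x hx => by
    obtain ⟨L, hL, -⟩ := hΨd x hx
    exact hL.continuousAt.continuousWithinAt
  refine ⟨horb.image (fun z hz => hΘL z (hCD hz)) (fun z hz => (hΘ z (hCD hz)).2),
    O ∩ Ψ ⁻¹' U, hΨc.isOpen_inter_preimage hO hU, ?_, fun C' hC' hC'U => ?_⟩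
  · rintro _ ⟨z, hz, rfl⟩
    refine ⟨(hΘ z (hCD hz)).1, ?_⟩
    rw [mem_preimage, (hΘ z (hCD hz)).2]
    exact hCU hz
  · have h1 : IsPeriodicOrbit Z (Ψ '' C') :=
      hC'.image (Ψ := Θ) (fun x hx => hΨd x (hC'U hx).1) (fun x hx => (hΨ x (hC'U hx).1).2)
    have h2 := huniq _ h1 (by
      rintro _ ⟨x, hx, rfl⟩
      exact (hC'U hx).2)
    rw [← h2, image_image]
    ext x
    constructor
    · exact fun hx => ⟨x, hx, (hΨ x (hC'U hx).1).2⟩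
    · rintro ⟨y, hy, rfl⟩
      simpa only [(hΨ y (hC'U hy).1).2] using hy

/-! ### The Hamiltonian in the coordinates `t = x / y`, `W = y²`

With `u = 1 - l t²`, `C = 1 + 2 h t - n t²` and `b = u² + 4 t² C` the Hamiltonian satisfies
`8 H + 1 = b W² - 2 u W + 1 = S(t)² + V²`, `S = 2 t √C / √b`, `V = (b W - u) / √b`. -/

def axisPoly (l t : ℝ) : ℝ := 1 - l * t ^ 2

def crossPoly (h n t : ℝ) : ℝ := 1 + 2 * h * t - n * t ^ 2

def leadPoly (h l n t : ℝ) : ℝ := axisPoly l t ^ 2 + 4 * t ^ 2 * crossPoly h n t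

/-- This is (2C + tC')u - 2tCu', where the quartic terms cancel. It is the numerator of the
derivative of t√C/u; its positivity, with that of C and u, makes S increasing. -/
def slopePoly (h l n t : ℝ) : ℝ :=
  2 * (1 + 3 * h * t + (l - 2 * n) * t ^ 2 + l * h * t ^ 3)

noncomputable def sCoord (h l n t : ℝ) : ℝ := 2 * t * √(crossPoly h n t) / √(leadPoly h l n t)

/-- The derivative of `sCoord`. -/
noncomputable def sCoordDeriv (h l n t : ℝ) : ℝ :=
  slopePoly h l n t * axisPoly l t /
    (√(crossPoly h n t) * leadPoly h l n t * √(leadPoly h l n t))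

noncomputable def vCoord (h l n t W : ℝ) : ℝ :=
  (leadPoly h l n t * W - axisPoly l t) / √(leadPoly h l n t)

noncomputable def wOfV (h l n t V : ℝ) : ℝ :=
  (V * √(leadPoly h l n t) + axisPoly l t) / leadPoly h l n t

/-- `∂b/∂t`. -/
def leadPolyDeriv (h l n t : ℝ) : ℝ :=
  2 * axisPoly l t * (-(2 * l * t)) + 8 * t * crossPoly h n t + 4 * t ^ 2 * (2 * h - 2 * n * t)

/-- `∂V/∂t` at fixed `W`. -/
noncomputable def vCoordDeriv (h l n t W : ℝ) : ℝ :=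
  (leadPolyDeriv h l n t * W + 2 * l * t) / √(leadPoly h l n t) -
    (leadPoly h l n t * W - axisPoly l t) * leadPolyDeriv h l n t /
      (2 * leadPoly h l n t * √(leadPoly h l n t))

lemma leadPoly_pos {h l n t : ℝ} (hC : 0 < crossPoly h n t) (hu : 0 < axisPoly l t) :
    0 < leadPoly h l n t := by
  unfold leadPoly
  positivity

lemma hasDerivAt_crossPoly (h n t : ℝ) : HasDerivAt (crossPoly h n) (2 * h - 2 * n * t) t := by
  unfold crossPoly
  refine ((((hasDerivAt_id t).const_mul (2 * h)).const_add 1).sub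
    (((hasDerivAt_id t).pow 2).const_mul n)).congr_deriv ?_
  simp
  ring

lemma hasDerivAt_axisPoly (l t : ℝ) : HasDerivAt (axisPoly l) (-(2 * l * t)) t := by
  unfold axisPoly
  refine ((((hasDerivAt_id t).pow 2).const_mul l).const_sub 1).congr_deriv ?_
  simp
  ring

lemma hasDerivAt_leadPoly (h l n t : ℝ) :
    HasDerivAt (leadPoly h l n) (leadPolyDeriv h l n t) t := by
  unfold leadPoly leadPolyDeriv
  refine (((hasDerivAt_axisPoly l t).pow 2).add
    ((((hasDerivAt_id t).pow 2).const_mul 4).mul (hasDerivAt_crossPoly h n t))).congr_deriv ?_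
  simp
  ring

/-- Because b = u² + 4t²C, the terms without u in (2C + tC')b - tCb' cancel. The numerator is
therefore divisible by u, with quotient `slopePoly`. -/
lemma hasDerivAt_sCoord {h l n t : ℝ} (hC : 0 < crossPoly h n t) (hu : 0 < axisPoly l t) :
    HasDerivAt (sCoord h l n) (sCoordDeriv h l n t) t := by
  have hb := leadPoly_pos (h := h) hC hu
  have h1 := (((hasDerivAt_id t).const_mul 2).mul ((hasDerivAt_crossPoly h n t).sqrt hC.ne')).div
    ((hasDerivAt_leadPoly h l n t).sqrt hb.ne') (Real.sqrt_pos.2 hb).ne'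
  refine h1.congr_deriv ?_
  have e1 := Real.sq_sqrt hC.le
  have e2 := Real.sq_sqrt hb.le
  have p1 := Real.sqrt_pos.2 hC
  have p2 := Real.sqrt_pos.2 hb
  simp only [sCoordDeriv, Pi.mul_apply, id]
  set c := √(crossPoly h n t)
  set d := √(leadPoly h l n t)
  rw [← e2]
  field_simp
  have e2' : d ^ 2 = axisPoly l t ^ 2 + 4 * t ^ 2 * crossPoly h n t := e2
  have e3 : leadPolyDeriv h l n t = 2 * axisPoly l t * (-(2 * l * t)) +
    8 * t * crossPoly h n t + 4 * t ^ 2 * (2 * h - 2 * n * t) := rfl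
  rw [e3, e1, e2']
  simp only [slopePoly, axisPoly, crossPoly]
  ring

lemma hasDerivAt_vCoord_left {h l n t W : ℝ} (hb : 0 < leadPoly h l n t) :
    HasDerivAt (fun t => vCoord h l n t W) (vCoordDeriv h l n t W) t := by
  have h1 := (((hasDerivAt_leadPoly h l n t).mul_const W).sub (hasDerivAt_axisPoly l t)).div
    ((hasDerivAt_leadPoly h l n t).sqrt hb.ne') (Real.sqrt_pos.2 hb).ne'
  refine h1.congr_deriv ?_
  have e2 := Real.sq_sqrt hb.le
  have p2 := Real.sqrt_pos.2 hb
  simp only [vCoordDeriv, Pi.sub_apply]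
  set d := √(leadPoly h l n t)
  rw [← e2]
  field_simp
  ring

lemma vCoord_eq {h l n t W : ℝ} (hb : 0 < leadPoly h l n t) :
    vCoord h l n t W = √(leadPoly h l n t) * W - axisPoly l t / √(leadPoly h l n t) := by
  have e2 := Real.sq_sqrt hb.le
  have p2 := Real.sqrt_pos.2 hb
  simp only [vCoord]
  set d := √(leadPoly h l n t)
  rw [← e2]
  field_simp

lemma vCoord_wOfV {h l n t V : ℝ} (hb : 0 < leadPoly h l n t) :
    vCoord h l n t (wOfV h l n t V) = V := by
  have p2 := Real.sqrt_pos.2 hb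
  simp only [vCoord, wOfV]
  field_simp
  ring

lemma wOfV_vCoord {h l n t W : ℝ} (hb : 0 < leadPoly h l n t) :
    wOfV h l n t (vCoord h l n t W) = W := by
  have p2 := Real.sqrt_pos.2 hb
  simp only [vCoord, wOfV]
  field_simp
  ring

/-- This is b - 4t²C = u². It later yields W > 0 on the chart and expresses t√C/u through s alone.
-/
lemma one_sub_sCoord_sq {h l n t : ℝ} (hC : 0 < crossPoly h n t) (hu : 0 < axisPoly l t) :
    1 - sCoord h l n t ^ 2 = axisPoly l t ^ 2 / leadPoly h l n t := by
  have hb := leadPoly_pos (h := h) hC hu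
  rw [sCoord, div_pow, mul_pow, Real.sq_sqrt hC.le, Real.sq_sqrt hb.le]
  field_simp
  simp only [leadPoly]
  ring

/-- Inverse of `sCoord` on a neighbourhood of `0`. -/
structure IsChart (h l n : ℝ) (T : ℝ → ℝ) (τ R : ℝ) : Prop where
  pos : ∀ t, |t| < τ → 0 < crossPoly h n t ∧ 0 < axisPoly l t ∧ 0 < slopePoly h l n t
  lt_one : R < 1
  mem : ∀ s, |s| < R → |T s| < τ
  right_inv : ∀ s, |s| < R → sCoord h l n (T s) = s
  left_inv : ∀ t, |t| < τ → |sCoord h l n t| < R → T (sCoord h l n t) = t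
  contDiffAt : ∀ s, |s| < R → ContDiffAt ℝ 1 T s

namespace IsChart

variable {h l n τ R : ℝ} {T : ℝ → ℝ}

lemma lead_pos (H : IsChart h l n T τ R) {t : ℝ} (ht : |t| < τ) : 0 < leadPoly h l n t :=
  leadPoly_pos (H.pos t ht).1 (H.pos t ht).2.1

lemma deriv_pos (H : IsChart h l n T τ R) {t : ℝ} (ht : |t| < τ) : 0 < sCoordDeriv h l n t := by
  obtain ⟨h1, h2, h3⟩ := H.pos t ht
  have h4 := H.lead_pos ht
  unfold sCoordDeriv
  positivity

lemma hasDerivAt (H : IsChart h l n T τ R) {s : ℝ} (hs : |s| < R) :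
    HasDerivAt T (sCoordDeriv h l n (T s))⁻¹ s := by
  have ht := H.mem s hs
  refine HasDerivAt.of_local_left_inverse (H.contDiffAt s hs).continuousAt
    (hasDerivAt_sCoord (H.pos _ ht).1 (H.pos _ ht).2.1) (H.deriv_pos ht).ne' ?_
  have : {s : ℝ | |s| < R} ∈ 𝓝 s := (isOpen_lt continuous_abs continuous_const).mem_nhds hs
  filter_upwards [this] with s' hs' using H.right_inv s' hs'

end IsChart

lemma hasFDerivAt_of_partial {F : ℝ × ℝ → ℝ} {x y a b : ℝ} (hF : DifferentiableAt ℝ F (x, y))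
    (ha : HasDerivAt (fun x => F (x, y)) a x) (hb : HasDerivAt (fun y => F (x, y)) b y) :
    HasFDerivAt F (a • ContinuousLinearMap.fst ℝ ℝ ℝ + b • ContinuousLinearMap.snd ℝ ℝ ℝ)
      (x, y) := by
  have h := hF.hasFDerivAt
  have h1 := h.comp_hasDerivAt (f := fun x' : ℝ => (x', y)) x
    ((hasDerivAt_id x).prodMk (hasDerivAt_const x y))
  have h2 := h.comp_hasDerivAt (f := fun y' : ℝ => (x, y')) y
    ((hasDerivAt_const y x).prodMk (hasDerivAt_id y))
  have e1 := h1.unique ha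
  have e2 := h2.unique hb
  convert h using 1
  ext
  · simp [← e1]
  · simp [← e2]

lemma contDiff_crossPoly (h n : ℝ) : ContDiff ℝ 1 (crossPoly h n) := by
  unfold crossPoly; fun_prop

lemma contDiff_axisPoly (l : ℝ) : ContDiff ℝ 1 (axisPoly l) := by
  unfold axisPoly; fun_prop

lemma contDiff_leadPoly (h l n : ℝ) : ContDiff ℝ 1 (leadPoly h l n) := by
  unfold leadPoly axisPoly crossPoly; fun_prop

lemma contDiff_leadPolyDeriv (h l n : ℝ) : ContDiff ℝ 1 (leadPolyDeriv h l n) := by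
  unfold leadPolyDeriv axisPoly crossPoly; fun_prop

lemma contDiff_slopePoly (h l n : ℝ) : ContDiff ℝ 1 (slopePoly h l n) := by
  unfold slopePoly; fun_prop

/-! ### The system as a perturbed rotation -/

/-- The perturbed system in the coordinates `(t, W)`: the perturbation is
`(A₁ + W A₃, 2 (W Q₁ + W² Q₃))`. -/
noncomputable def twField (h l n : ℝ) (A₁ A₃ Q₁ Q₃ : ℝ → ℝ) (ε : ℝ) (z : ℝ × ℝ) : ℝ × ℝ :=
  ((leadPoly h l n z.1 * z.2 - axisPoly l z.1) / 2 + ε * (A₁ z.1 + z.2 * A₃ z.1),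
    -(leadPolyDeriv h l n z.1 * z.2 ^ 2 + 4 * l * z.1 * z.2) / 4 +
      ε * (2 * (z.2 * Q₁ z.1 + z.2 ^ 2 * Q₃ z.1)))

/-- The rotation speed of the unperturbed system in the coordinates `(S, V)`. -/
noncomputable def chartJ (h l n : ℝ) (T : ℝ → ℝ) (z : ℝ × ℝ) : ℝ :=
  sCoordDeriv h l n (T z.1) * √(leadPoly h l n (T z.1)) / 2

/-- `chartK₁` and `chartK₂` are the components of the perturbation under the differential of (S, V),
with t and W recovered through `T` and `wOfV`. The factor √b in `chartK₂` is ∂V/∂W. -/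
noncomputable def chartK₁ (h l n : ℝ) (T A₁ A₃ : ℝ → ℝ) (z : ℝ × ℝ) : ℝ :=
  sCoordDeriv h l n (T z.1) * (A₁ (T z.1) + wOfV h l n (T z.1) z.2 * A₃ (T z.1))

noncomputable def chartK₂ (h l n : ℝ) (T A₁ A₃ Q₁ Q₃ : ℝ → ℝ) (z : ℝ × ℝ) : ℝ :=
  2 * √(leadPoly h l n (T z.1)) *
      (wOfV h l n (T z.1) z.2 * Q₁ (T z.1) + wOfV h l n (T z.1) z.2 ^ 2 * Q₃ (T z.1)) +
    vCoordDeriv h l n (T z.1) (wOfV h l n (T z.1) z.2) *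
      (A₁ (T z.1) + wOfV h l n (T z.1) z.2 * A₃ (T z.1))

lemma hasFDerivAt_svCoord {h l n t W : ℝ} (hC : 0 < crossPoly h n t) (hu : 0 < axisPoly l t) :
    HasFDerivAt (fun z : ℝ × ℝ => (sCoord h l n z.1, vCoord h l n z.1 z.2))
      ((sCoordDeriv h l n t • ContinuousLinearMap.fst ℝ ℝ ℝ).prod
        (vCoordDeriv h l n t W • ContinuousLinearMap.fst ℝ ℝ ℝ +
          √(leadPoly h l n t) • ContinuousLinearMap.snd ℝ ℝ ℝ)) (t, W) := by
  have hb := leadPoly_pos (h := h) hC hu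
  have hd := Real.sqrt_pos.2 hb
  refine HasFDerivAt.prodMk ?_ (hasFDerivAt_of_partial ?_ (hasDerivAt_vCoord_left hb) ?_)
  · exact (hasDerivAt_sCoord (h := h) (n := n) hC hu).comp_hasFDerivAt (t, W)
      (hasFDerivAt_fst (𝕜 := ℝ) (E := ℝ) (F := ℝ))
  · have hlead : DifferentiableAt ℝ (fun z : ℝ × ℝ => leadPoly h l n z.1) (t, W) := by
      unfold leadPoly axisPoly crossPoly; fun_prop
    have haxis : DifferentiableAt ℝ (fun z : ℝ × ℝ => axisPoly l z.1) (t, W) := by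
      unfold axisPoly; fun_prop
    have hd2 : DifferentiableAt ℝ (fun z : ℝ × ℝ => √(leadPoly h l n z.1)) (t, W) :=
      hlead.sqrt hb.ne'
    have hnum : DifferentiableAt ℝ
        (fun z : ℝ × ℝ => leadPoly h l n z.1 * z.2 - axisPoly l z.1) (t, W) :=
      (hlead.mul differentiableAt_snd).sub haxis
    change DifferentiableAt ℝ (fun z : ℝ × ℝ =>
      (leadPoly h l n z.1 * z.2 - axisPoly l z.1) / √(leadPoly h l n z.1)) (t, W)
    simp only [div_eq_mul_inv]
    exact hnum.mul (hd2.inv hd.ne')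
  · simp only [vCoord_eq hb]
    simpa using ((hasDerivAt_id W).const_mul (√(leadPoly h l n t))).sub_const
      (axisPoly l t / √(leadPoly h l n t))

/-- In the coordinates `(S, V)` the system is a perturbed rotation. -/
lemma svCoord_twField {h l n t W ε : ℝ} {A₁ A₃ Q₁ Q₃ T : ℝ → ℝ} (hC : 0 < crossPoly h n t)
    (hu : 0 < axisPoly l t) (hT : T (sCoord h l n t) = t) :
    ((sCoordDeriv h l n t • ContinuousLinearMap.fst ℝ ℝ ℝ).prod
        (vCoordDeriv h l n t W • ContinuousLinearMap.fst ℝ ℝ ℝ +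
          √(leadPoly h l n t) • ContinuousLinearMap.snd ℝ ℝ ℝ))
        (twField h l n A₁ A₃ Q₁ Q₃ ε (t, W)) =
      rotationField (chartJ h l n T) (chartK₁ h l n T A₁ A₃) (chartK₂ h l n T A₁ A₃ Q₁ Q₃) ε
        (sCoord h l n t, vCoord h l n t W) := by
  have hb := leadPoly_pos (h := h) hC hu
  have hd := Real.sqrt_pos.2 hb
  have hc := Real.sqrt_pos.2 hC
  have e1 := Real.sq_sqrt hC.le
  have e2 := Real.sq_sqrt hb.le
  simp only [rotationField, chartJ, chartK₁, chartK₂, hT, wOfV_vCoord hb, twField]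
  simp only [ContinuousLinearMap.prod_apply, add_apply,
    smul_apply, ContinuousLinearMap.coe_fst', ContinuousLinearMap.coe_snd',
    smul_eq_mul, Prod.mk.injEq]
  constructor
  · simp only [vCoord]
    field_simp
  -- The polynomial identity behind the conservation of S² + V²: it turns the unperturbed velocity
  -- of V into -J S.
  · have key2 : 4 * l * t * leadPoly h l n t + axisPoly l t * leadPolyDeriv h l n t =
        4 * t * slopePoly h l n t := by
      simp only [leadPolyDeriv, leadPoly, slopePoly, axisPoly, crossPoly]
      ring
    have key : vCoordDeriv h l n t W * ((leadPoly h l n t * W - axisPoly l t) / 2) +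
        √(leadPoly h l n t) *
          (-(leadPolyDeriv h l n t * W ^ 2 + 4 * l * t * W) / 4) =
        -(sCoordDeriv h l n t * √(leadPoly h l n t) / 2 * sCoord h l n t) := by
      simp only [vCoordDeriv, sCoordDeriv, sCoord]
      set d := √(leadPoly h l n t)
      set c := √(crossPoly h n t)
      rw [← e2] at key2 ⊢
      field_simp
      linear_combination (-4 * axisPoly l t) * key2
    linear_combination key

/-- The field in the coordinates `(S, V)` is smooth. -/
lemma contDiffAt_chart {h l n τ R : ℝ} {A₁ A₃ Q₁ Q₃ T : ℝ → ℝ} (H : IsChart h l n T τ R)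
    (hA₁ : ContDiff ℝ 1 A₁) (hA₃ : ContDiff ℝ 1 A₃) (hQ₁ : ContDiff ℝ 1 Q₁)
    (hQ₃ : ContDiff ℝ 1 Q₃) {z : ℝ × ℝ} (hz : |z.1| < R) :
    ContDiffAt ℝ 1 (chartJ h l n T) z ∧ ContDiffAt ℝ 1 (chartK₁ h l n T A₁ A₃) z ∧
      ContDiffAt ℝ 1 (chartK₂ h l n T A₁ A₃ Q₁ Q₃) z := by
  have hT : ContDiffAt ℝ 1 (fun z : ℝ × ℝ => T z.1) z :=
    (H.contDiffAt z.1 hz).comp z contDiffAt_fst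
  have ht := H.mem _ hz
  obtain ⟨hC, hu, hK⟩ := H.pos _ ht
  have hb := H.lead_pos ht
  have hd := Real.sqrt_pos.2 hb
  have hc := Real.sqrt_pos.2 hC
  have hv : ContDiffAt ℝ 1 (fun z : ℝ × ℝ => z.2) z := contDiffAt_snd
  have cC : ContDiffAt ℝ 1 (fun z : ℝ × ℝ => crossPoly h n (T z.1)) z := by
    exact (contDiff_crossPoly ..).contDiffAt.comp z hT
  have cu : ContDiffAt ℝ 1 (fun z : ℝ × ℝ => axisPoly l (T z.1)) z := by
    exact (contDiff_axisPoly ..).contDiffAt.comp z hT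
  have cb : ContDiffAt ℝ 1 (fun z : ℝ × ℝ => leadPoly h l n (T z.1)) z := by
    exact (contDiff_leadPoly ..).contDiffAt.comp z hT
  have cb' : ContDiffAt ℝ 1 (fun z : ℝ × ℝ => leadPolyDeriv h l n (T z.1)) z := by
    exact (contDiff_leadPolyDeriv ..).contDiffAt.comp z hT
  have cK : ContDiffAt ℝ 1 (fun z : ℝ × ℝ => slopePoly h l n (T z.1)) z := by
    exact (contDiff_slopePoly ..).contDiffAt.comp z hT
  have cd := cb.sqrt hb.ne'
  have cc := cC.sqrt hC.ne'
  have cS : ContDiffAt ℝ 1 (fun z : ℝ × ℝ => sCoordDeriv h l n (T z.1)) z :=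
    (cK.mul cu).div ((cc.mul cb).mul cd) (by positivity)
  have cW : ContDiffAt ℝ 1 (fun z : ℝ × ℝ => wOfV h l n (T z.1) z.2) z :=
    ((hv.mul cd).add cu).div cb hb.ne'
  have cV : ContDiffAt ℝ 1
      (fun z : ℝ × ℝ => vCoordDeriv h l n (T z.1) (wOfV h l n (T z.1) z.2)) z :=
    (((cb'.mul cW).add (contDiffAt_const.mul hT)).div cd hd.ne').sub
      ((((cb.mul cW).sub cu).mul cb').div ((contDiffAt_const.mul cb).mul cd) (by positivity))
  have c1 : ContDiffAt ℝ 1 (fun z : ℝ × ℝ => A₁ (T z.1)) z := hA₁.contDiffAt.comp z hT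
  have c3 : ContDiffAt ℝ 1 (fun z : ℝ × ℝ => A₃ (T z.1)) z := hA₃.contDiffAt.comp z hT
  have q1 : ContDiffAt ℝ 1 (fun z : ℝ × ℝ => Q₁ (T z.1)) z := hQ₁.contDiffAt.comp z hT
  have q3 : ContDiffAt ℝ 1 (fun z : ℝ × ℝ => Q₃ (T z.1)) z := hQ₃.contDiffAt.comp z hT
  refine ⟨(cS.mul cd).div_const 2, cS.mul (c1.add (cW.mul c3)), ?_⟩
  exact ((contDiffAt_const.mul cd).mul ((cW.mul q1).add ((cW.pow 2).mul q3))).add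
    (cV.mul (c1.add (cW.mul c3)))

/-! ### The averaged function -/

/-- The reflection φ ↦ π - φ fixes sin φ and changes the sign of cos φ, so terms odd in cos φ with
coefficients depending on sin φ average to zero. -/
lemma integral_eq_zero_of_antisymm {f : ℝ → ℝ} (hp : Function.Periodic f (2 * Real.pi))
    (h : ∀ φ, f (Real.pi - φ) = -f φ) : ∫ φ in (0 : ℝ)..2 * Real.pi, f φ = 0 := by
  have h1 := intervalIntegral.integral_comp_sub_left (a := 0) (b := 2 * Real.pi) f Real.pi
  simp only [h, intervalIntegral.integral_neg, sub_zero] at h1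
  have h2 := hp.intervalIntegral_add_eq (Real.pi - 2 * Real.pi) 0
  rw [zero_add, show Real.pi - 2 * Real.pi + 2 * Real.pi = Real.pi by ring] at h2
  linarith

/-- The divergence in the coordinate `t`, divided by `W`. -/
def divPoly (c02 c11 c20 t : ℝ) : ℝ := c02 + c11 * t + c20 * t ^ 2

/-- The kernel of the averaged function, as a function of `t`. -/
noncomputable def meanKernel (h l n c00 c02 c11 c20 t : ℝ) : ℝ :=
  √(crossPoly h n t) * (c00 * leadPoly h l n t + divPoly c02 c11 c20 t * axisPoly l t) /
    (slopePoly h l n t * axisPoly l t)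

noncomputable def meanFun (h l n c00 c02 c11 c20 : ℝ) (T : ℝ → ℝ) (ρ : ℝ) : ℝ :=
  ∫ φ in (0 : ℝ)..2 * Real.pi,
    Real.cos φ ^ 2 * meanKernel h l n c00 c02 c11 c20 (T (ρ * Real.sin φ))

/-- Green's theorem in (t, W): the perturbation has divergence c₀₀ + W · `divPoly`. The slope is 4/ρ
times an exact derivative `F'` plus `E`, half the primitive in W of the divergence times dt/dφ. The
exact part integrates to zero over a turn. With W = (V√b + u)/b and V = ρ cos φ, the part of `E` odd
in cos φ also vanishes, and the rest is ρ²/2 · cos²φ times the kernel. -/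
theorem radialAverage_eq_meanFun {h l n c00 c02 c11 c20 τ R ρ : ℝ} {A₁ A₃ Q₁ Q₃ T : ℝ → ℝ}
    (H : IsChart h l n T τ R) (hρ : 0 < ρ) (hρR : ρ < R)
    (hQ₁ : Continuous Q₁) (hQ₃ : Continuous Q₃)
    (hA₁ : ∀ t, HasDerivAt A₁ (c00 - 2 * Q₁ t) t)
    (hA₃ : ∀ t, HasDerivAt A₃ (divPoly c02 c11 c20 t - 4 * Q₃ t) t) :
    radialAverage (chartJ h l n T) (chartK₁ h l n T A₁ A₃) (chartK₂ h l n T A₁ A₃ Q₁ Q₃) ρ =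
      2 * ρ * meanFun h l n c00 c02 c11 c20 T ρ := by
  have hs : ∀ φ, |ρ * Real.sin φ| < R := fun φ => by
    rw [abs_mul, abs_of_pos hρ]
    have := Real.abs_sin_le_one φ
    nlinarith
  set t : ℝ → ℝ := fun φ => T (ρ * Real.sin φ) with ht
  set b : ℝ → ℝ := fun φ => leadPoly h l n (t φ) with hb
  set u : ℝ → ℝ := fun φ => axisPoly l (t φ) with hu
  set d : ℝ → ℝ := fun φ => √(b φ) with hd
  set Sd : ℝ → ℝ := fun φ => sCoordDeriv h l n (t φ) with hSd
  set e : ℝ → ℝ := fun φ => divPoly c02 c11 c20 (t φ) with he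
  set W : ℝ → ℝ := fun φ => wOfV h l n (t φ) (ρ * Real.cos φ) with hW
  have htτ : ∀ φ, |t φ| < τ := fun φ => H.mem _ (hs φ)
  have hC0 : ∀ φ, 0 < crossPoly h n (t φ) := fun φ => (H.pos _ (htτ φ)).1
  have hu0 : ∀ φ, 0 < u φ := fun φ => (H.pos _ (htτ φ)).2.1
  have hK0 : ∀ φ, 0 < slopePoly h l n (t φ) := fun φ => (H.pos _ (htτ φ)).2.2
  have hb0 : ∀ φ, 0 < b φ := fun φ => H.lead_pos (htτ φ)
  have hd0 : ∀ φ, 0 < d φ := fun φ => Real.sqrt_pos.2 (hb0 φ)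
  have hd2 : ∀ φ, d φ ^ 2 = b φ := fun φ => Real.sq_sqrt (hb0 φ).le
  have hSd0 : ∀ φ, 0 < Sd φ := fun φ => H.deriv_pos (htτ φ)
  have htd : ∀ φ, HasDerivAt t (ρ * Real.cos φ / Sd φ) φ := by
    intro φ
    have := (H.hasDerivAt (hs φ)).scomp φ ((Real.hasDerivAt_sin φ).const_mul ρ)
    exact this.congr_deriv (by simp [hSd, ht, div_eq_mul_inv])
  have hbd : ∀ φ, HasDerivAt b (leadPolyDeriv h l n (t φ) * (ρ * Real.cos φ / Sd φ)) φ := fun φ =>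
    (hasDerivAt_leadPoly h l n (t φ)).comp φ (htd φ)
  have hud : ∀ φ, HasDerivAt u (-(2 * l * t φ) * (ρ * Real.cos φ / Sd φ)) φ := fun φ =>
    (hasDerivAt_axisPoly l (t φ)).comp φ (htd φ)
  have hWd : ∀ φ, HasDerivAt W (-(ρ * Real.sin φ + vCoordDeriv h l n (t φ) (W φ) *
      (ρ * Real.cos φ / Sd φ)) / d φ) φ := by
    intro φ
    have hcos := (Real.hasDerivAt_cos φ).const_mul ρ
    have := ((hcos.mul ((hbd φ).sqrt (hb0 φ).ne')).add (hud φ)).div (hbd φ) (hb0 φ).ne'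
    refine this.congr_deriv ?_
    have e0 : √(b φ) = d φ := rfl
    have e1 : axisPoly l (t φ) = u φ := rfl
    have e2 : leadPoly h l n (t φ) = b φ := rfl
    simp only [vCoordDeriv, hW, wOfV, Pi.add_apply, Pi.mul_apply, e0, e1, e2]
    have h1 := (hd0 φ).ne'
    have h2 := (hSd0 φ).ne'
    rw [← hd2 φ]
    field_simp
    ring
  have htc : Continuous t := continuous_iff_continuousAt.2 fun φ => (htd φ).continuousAt
  have hWc : Continuous W := continuous_iff_continuousAt.2 fun φ => (hWd φ).continuousAt
  have hbc : Continuous b := continuous_iff_continuousAt.2 fun φ => (hbd φ).continuousAt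
  have huc : Continuous u := continuous_iff_continuousAt.2 fun φ => (hud φ).continuousAt
  have hdc : Continuous d := hbc.sqrt
  have hCc : Continuous fun φ => crossPoly h n (t φ) :=
    (contDiff_crossPoly h n).continuous.comp htc
  have hKc : Continuous fun φ => slopePoly h l n (t φ) :=
    (contDiff_slopePoly h l n).continuous.comp htc
  have hSdc : Continuous Sd := (hKc.mul huc).div ((hCc.sqrt.mul hbc).mul hdc) fun φ => by
    have := Real.sqrt_pos.2 (hC0 φ)
    have := hb0 φ
    have := hd0 φ
    positivity
  have hec : Continuous e := by
    simp only [he, divPoly]; fun_prop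
  have hcosc : Continuous fun φ => ρ * Real.cos φ / Sd φ :=
    (by fun_prop : Continuous fun φ => ρ * Real.cos φ).div hSdc fun φ => (hSd0 φ).ne'
  -- The weights 1/2 and 1/4 let `F'` absorb every term containing `A₁` or `A₃`; the remaining terms
  -- depend only on the divergence.
  set F : ℝ → ℝ := fun φ => -(1 / 2) * (A₁ (t φ) * W φ) - 1 / 4 * (A₃ (t φ) * W φ ^ 2) with hF
  set E : ℝ → ℝ := fun φ => (c00 / 2 * W φ + e φ / 4 * W φ ^ 2) * (ρ * Real.cos φ / Sd φ) with hE
  set Eo : ℝ → ℝ := fun φ => (c00 * u φ / (2 * b φ) + e φ / 4 *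
    ((ρ * Real.cos φ) ^ 2 / b φ + u φ ^ 2 / b φ ^ 2)) * (ρ * Real.cos φ / Sd φ) with hEo
  have hEeq : ∀ φ, E φ = ρ ^ 2 / 2 * (Real.cos φ ^ 2 * meanKernel h l n c00 c02 c11 c20 (t φ)) +
      Eo φ := by
    intro φ
    have e0 : √(b φ) = d φ := rfl
    have e1 : axisPoly l (t φ) = u φ := rfl
    have e2 : leadPoly h l n (t φ) = b φ := rfl
    have e3 : divPoly c02 c11 c20 (t φ) = e φ := rfl
    have hc := Real.sqrt_pos.2 (hC0 φ)
    simp only [hE, hEo, hW, wOfV, hSd, sCoordDeriv, meanKernel, e0, e1, e2, e3]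
    have h1 := (hd0 φ).ne'
    have h2 := (hK0 φ).ne'
    have h3 := (hu0 φ).ne'
    rw [← hd2 φ]
    field_simp
    ring
  set t' : ℝ → ℝ := fun φ => ρ * Real.cos φ / Sd φ with ht'
  set W' : ℝ → ℝ := fun φ => -(ρ * Real.sin φ + vCoordDeriv h l n (t φ) (W φ) * t' φ) / d φ
    with hW'
  set F' : ℝ → ℝ := fun φ => -(1 / 2) * ((c00 - 2 * Q₁ (t φ)) * t' φ * W φ + A₁ (t φ) * W' φ) -
    1 / 4 * ((e φ - 4 * Q₃ (t φ)) * t' φ * W φ ^ 2 + A₃ (t φ) * (2 * W φ * W' φ)) with hF'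
  have hFd : ∀ φ, HasDerivAt F (F' φ) φ := by
    intro φ
    have h1 := (hA₁ (t φ)).comp φ (htd φ)
    have h3 := (hA₃ (t φ)).comp φ (htd φ)
    refine (((h1.mul (hWd φ)).const_mul (-(1 / 2))).sub
      ((h3.mul ((hWd φ).pow 2)).const_mul (1 / 4))).congr_deriv ?_
    simp only [hF', hW', ht', he, Function.comp, Pi.pow_apply]
    push_cast
    ring
  have hslope : ∀ φ, radialSlope (chartJ h l n T) (chartK₁ h l n T A₁ A₃)
      (chartK₂ h l n T A₁ A₃ Q₁ Q₃) φ 0 ρ = 4 / ρ * (F' φ + E φ) := by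
    intro φ
    have e1 : T (polarPoint ρ φ).1 = t φ := rfl
    have e2 : wOfV h l n (t φ) (polarPoint ρ φ).2 = W φ := rfl
    have e3 : sCoordDeriv h l n (t φ) = Sd φ := rfl
    have e4 : √(leadPoly h l n (t φ)) = d φ := rfl
    simp only [radialSlope, angularSpeed, chartJ, chartK₁, chartK₂, e1, e2, e3, e4, zero_div,
      zero_mul, add_zero, hF', hE, hW', ht']
    have h1 := (hd0 φ).ne'
    have h2 := (hSd0 φ).ne'
    field_simp
    ring
  have hb'c : Continuous fun φ => leadPolyDeriv h l n (t φ) :=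
    (contDiff_leadPolyDeriv h l n).continuous.comp htc
  have hVc : Continuous fun φ => vCoordDeriv h l n (t φ) (W φ) :=
    (((hb'c.mul hWc).add (continuous_const.mul htc)).div hdc fun φ => (hd0 φ).ne').sub
      ((((hbc.mul hWc).sub huc).mul hb'c).div ((continuous_const.mul hbc).mul hdc) fun φ => by
        have := hb0 φ
        have := hd0 φ
        positivity)
  have hW'c : Continuous W' :=
    (((by fun_prop : Continuous fun φ => ρ * Real.sin φ).add (hVc.mul hcosc)).neg).div hdc
      fun φ => (hd0 φ).ne'
  have hA₁c : Continuous A₁ := continuous_iff_continuousAt.2 fun x => (hA₁ x).continuousAt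
  have hA₃c : Continuous A₃ := continuous_iff_continuousAt.2 fun x => (hA₃ x).continuousAt
  have ht'c : Continuous t' := hcosc
  have hF'c : Continuous F' := by
    simp only [hF']
    fun_prop
  have hEoc : Continuous Eo := by
    refine (((continuous_const.mul huc).div (continuous_const.mul hbc) fun φ => ?_).add
      ((hec.div_const 4).mul (((by fun_prop : Continuous fun φ => (ρ * Real.cos φ) ^ 2).div hbc
        fun φ => (hb0 φ).ne').add ((huc.pow 2).div (hbc.pow 2) fun φ => ?_)))).mul hcosc
    · exact (mul_pos two_pos (hb0 φ)).ne'
    · exact (pow_pos (hb0 φ) 2).ne'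
  have hEc : Continuous E :=
    ((continuous_const.mul hWc).add ((hec.div_const 4).mul (hWc.pow 2))).mul hcosc
  have hmc : Continuous fun φ =>
      Real.cos φ ^ 2 * meanKernel h l n c00 c02 c11 c20 (t φ) := by
    refine (Real.continuous_cos.pow 2).mul (Continuous.div (hCc.sqrt.mul
      ((continuous_const.mul hbc).add (hec.mul huc))) (hKc.mul huc) fun φ => ?_)
    exact (mul_pos (hK0 φ) (hu0 φ)).ne'
  have htper : ∀ φ, t (φ + 2 * Real.pi) = t φ := fun φ => by simp [ht]
  have htsym : ∀ φ, t (Real.pi - φ) = t φ := fun φ => by simp [ht]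
  have hEo0 : ∫ φ in (0 : ℝ)..2 * Real.pi, Eo φ = 0 := by
    refine integral_eq_zero_of_antisymm (fun φ => ?_) fun φ => ?_
    · simp only [hEo, hb, hu, he, hSd, htper, Real.cos_add_two_pi]
    · simp only [hEo, hb, hu, he, hSd, htsym, Real.cos_pi_sub]
      ring
  have hF0 : ∫ φ in (0 : ℝ)..2 * Real.pi, F' φ = 0 := by
    rw [intervalIntegral.integral_eq_sub_of_hasDerivAt (fun φ _ => hFd φ)
      (hF'c.intervalIntegrable _ _)]
    simp [hF, hW, ht]
  have hE0 : ∫ φ in (0 : ℝ)..2 * Real.pi, E φ =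
      ρ ^ 2 / 2 * meanFun h l n c00 c02 c11 c20 T ρ := by
    simp only [hEeq]
    rw [intervalIntegral.integral_add ((hmc.const_mul _).intervalIntegrable _ _)
      (hEoc.intervalIntegrable _ _), hEo0, add_zero, intervalIntegral.integral_const_mul]
    rfl
  simp only [radialAverage, hslope]
  rw [intervalIntegral.integral_const_mul, intervalIntegral.integral_add
    (hF'c.intervalIntegrable _ _) (hEc.intervalIntegrable _ _), hF0, hE0]
  field_simp
  ring

/-- A simple zero of the averaged function gives a limit cycle of the system in `(t, W)`. -/
theorem eventually_exists_isLimitCycle_twField {h l n c00 c02 c11 c20 τ R ρ₀ D r : ℝ}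
    {A₁ A₃ Q₁ Q₃ T : ℝ → ℝ} (H : IsChart h l n T τ R) (hρ₀ : 0 < ρ₀) (hρR : ρ₀ < R) (hr : 0 < r)
    (hQ₁ : ContDiff ℝ 1 Q₁) (hQ₃ : ContDiff ℝ 1 Q₃)
    (cA₁ : ContDiff ℝ 1 A₁) (cA₃ : ContDiff ℝ 1 A₃)
    (hA₁ : ∀ t, HasDerivAt A₁ (c00 - 2 * Q₁ t) t)
    (hA₃ : ∀ t, HasDerivAt A₃ (divPoly c02 c11 c20 t - 4 * Q₃ t) t)
    (hz : meanFun h l n c00 c02 c11 c20 T ρ₀ = 0)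
    (hD : HasDerivAt (meanFun h l n c00 c02 c11 c20 T) D ρ₀) (hD0 : D ≠ 0) :
    ∀ᶠ ε in 𝓝[>] (0 : ℝ), ∃ C, IsLimitCycle (twField h l n A₁ A₃ Q₁ Q₃ ε) C ∧
      ∀ z ∈ C, |z.1| < τ ∧ |vCoord h l n z.1 z.2| < R ∧ 0 < z.2 ∧
        √(sCoord h l n z.1 ^ 2 + vCoord h l n z.1 z.2 ^ 2) ∈ Ioo (ρ₀ - r) (ρ₀ + r) := by
  have hR0 : 0 < R := hρ₀.trans hρR
  set B : Set (ℝ × ℝ) := {z | z.1 ^ 2 + z.2 ^ 2 < R ^ 2} with hB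
  have hz1 : ∀ z ∈ B, |z.1| < R ∧ |z.2| < R := fun z hz => by
    have hz' : z.1 ^ 2 + z.2 ^ 2 < R ^ 2 := hz
    exact ⟨abs_lt_of_sq_lt_sq (by nlinarith [sq_nonneg z.2]) hR0.le,
      abs_lt_of_sq_lt_sq (by nlinarith [sq_nonneg z.1]) hR0.le⟩
  have hsm := fun z (hz : z ∈ B) => contDiffAt_chart H cA₁ cA₃ hQ₁ hQ₃ (hz1 z hz).1
  -- Since `meanFun` vanishes at `ρ₀`, the factor `2 * ρ` does not affect the simplicity of the
  -- zero.
  have hav : HasDerivAt (radialAverage (chartJ h l n T) (chartK₁ h l n T A₁ A₃)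
      (chartK₂ h l n T A₁ A₃ Q₁ Q₃)) (2 * ρ₀ * D) ρ₀ := by
    have h1 : HasDerivAt (fun ρ => 2 * ρ * meanFun h l n c00 c02 c11 c20 T ρ)
        (2 * ρ₀ * D) ρ₀ := by
      refine (((hasDerivAt_id ρ₀).const_mul 2).mul hD).congr_deriv ?_
      rw [hz]
      simp
    refine h1.congr_of_eventuallyEq ?_
    filter_upwards [Ioo_mem_nhds hρ₀ hρR] with ρ hρ
    exact radialAverage_eq_meanFun H hρ.1 hρ.2 hQ₁.continuous hQ₃.continuous hA₁ hA₃
  obtain ⟨r', hr', hr'r, hr'R⟩ : ∃ r' > 0, r' ≤ r ∧ ρ₀ + r' < R :=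
    ⟨min r ((R - ρ₀) / 2), by have : 0 < R - ρ₀ := by linarith
                              positivity, min_le_left _ _, by
      have := min_le_right r ((R - ρ₀) / 2)
      linarith⟩
  have hev := eventually_exists_isLimitCycle (R := R) (r := r')
    (fun z hz => (hsm z hz).1.contDiffWithinAt) (fun z hz => (hsm z hz).2.1.contDiffWithinAt)
    (fun z hz => (hsm z hz).2.2.contDiffWithinAt)
    (fun z hz => by
      have ht := H.mem _ (hz1 z hz).1
      have := H.deriv_pos ht
      have := Real.sqrt_pos.2 (H.lead_pos ht)
      unfold chartJ
      positivity) hρ₀ hρR hr'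
    (by rw [radialAverage_eq_meanFun H hρ₀ hρR hQ₁.continuous hQ₃.continuous hA₁ hA₃, hz, mul_zero])
    hav (by positivity)
  set Θ : ℝ × ℝ → ℝ × ℝ := fun z => (T z.1, wOfV h l n (T z.1) z.2) with hΘ
  set Ψ : ℝ × ℝ → ℝ × ℝ := fun z => (sCoord h l n z.1, vCoord h l n z.1 z.2) with hΨ
  set O : Set (ℝ × ℝ) := {z | |z.1| < τ} ∩ Ψ ⁻¹' B with hO
  have hBo : IsOpen B := isOpen_lt (by fun_prop) (by fun_prop)
  have hOo : IsOpen O := by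
    refine ContinuousOn.isOpen_inter_preimage ?_ (isOpen_lt (by fun_prop) (by fun_prop)) hBo
    exact fun z hz => (hasFDerivAt_svCoord (H.pos _ hz).1
      (H.pos _ hz).2.1).continuousAt.continuousWithinAt
  have hΨΘ : ∀ z ∈ B, Ψ (Θ z) = z := fun z hz => by
    have ht := H.mem _ (hz1 z hz).1
    simp only [hΨ, hΘ, H.right_inv _ (hz1 z hz).1, vCoord_wOfV (H.lead_pos ht)]
  have hΘO : ∀ z ∈ B, Θ z ∈ O := fun z hz => ⟨H.mem _ (hz1 z hz).1, by
    rw [mem_preimage, hΨΘ z hz]; exact hz⟩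
  filter_upwards [hev] with ε ⟨C, hC, hCr⟩
  have hCB : C ⊆ B := fun z hz => by
    have h1 := (hCr z hz).2.trans hr'R
    rw [Real.sqrt_lt' hR0] at h1
    exact h1
  refine ⟨Θ '' C, hC.image (Ψ := Ψ) (D := B) hOo (fun z hz => ⟨hΘO z hz, hΨΘ z hz⟩)
    (fun z hz => ⟨hz.2, ?_⟩) (fun z hz => ?_) (fun z hz => ?_) hCB, ?_⟩
  · have h1 := H.left_inv z.1 hz.1 (hz1 _ hz.2).1
    simp only [hΘ, hΨ, h1, wOfV_vCoord (H.lead_pos hz.1)]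
  · have ht := H.mem _ (hz1 z hz).1
    have hb := H.lead_pos ht
    have hT : DifferentiableAt ℝ (fun z : ℝ × ℝ => T z.1) z :=
      (((H.contDiffAt z.1 (hz1 z hz).1).comp z contDiffAt_fst).differentiableAt one_ne_zero)
    have hl : DifferentiableAt ℝ (fun z : ℝ × ℝ => leadPoly h l n (T z.1)) z :=
      (((contDiff_leadPoly h l n).differentiable one_ne_zero).differentiableAt).comp z hT
    have hx : DifferentiableAt ℝ (fun z : ℝ × ℝ => axisPoly l (T z.1)) z :=
      (((contDiff_axisPoly l).differentiable one_ne_zero).differentiableAt).comp z hT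
    have hs : DifferentiableAt ℝ (fun z : ℝ × ℝ => √(leadPoly h l n (T z.1))) z :=
      hl.sqrt hb.ne'
    refine hT.prodMk ?_
    change DifferentiableAt ℝ (fun z : ℝ × ℝ =>
      (z.2 * √(leadPoly h l n (T z.1)) + axisPoly l (T z.1)) / leadPoly h l n (T z.1)) z
    simp only [div_eq_mul_inv]
    exact ((differentiableAt_snd.mul hs).add hx).mul (hl.inv hb.ne')
  · exact ⟨_, hasFDerivAt_svCoord (H.pos _ hz.1).1 (H.pos _ hz.1).2.1,
      svCoord_twField (H.pos _ hz.1).1 (H.pos _ hz.1).2.1 (H.left_inv _ hz.1 (hz1 _ hz.2).1)⟩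
  · rintro _ ⟨z, hz, rfl⟩
    have hzB := hCB hz
    have ht := H.mem _ (hz1 z hzB).1
    have hb := H.lead_pos ht
    have e := hΨΘ z hzB
    have e1 : sCoord h l n (Θ z).1 = z.1 := congrArg Prod.fst e
    have e2 : vCoord h l n (Θ z).1 (Θ z).2 = z.2 := congrArg Prod.snd e
    refine ⟨ht, by rw [e2]; exact (hz1 z hzB).2, ?_, ?_⟩
    · have hd := Real.sqrt_pos.2 hb
      have hu := (H.pos _ ht).2.1
      have h1 := one_sub_sCoord_sq (H.pos _ ht).1 hu
      rw [H.right_inv _ (hz1 z hzB).1] at h1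
      -- Here R < 1 enters: V² < 1 - S² = u²/b gives |V√b| < u, whence W = (V√b + u)/b > 0.
      have h2 : z.2 ^ 2 < 1 - z.1 ^ 2 := by
        have h3 : z.1 ^ 2 + z.2 ^ 2 < R ^ 2 := hzB
        nlinarith [H.lt_one]
      have h4 : (z.2 * √(leadPoly h l n (T z.1))) ^ 2 < axisPoly l (T z.1) ^ 2 := by
        rw [mul_pow, Real.sq_sqrt hb.le]
        rw [h1] at h2
        rwa [lt_div_iff₀ hb] at h2
      have h5 := (abs_lt.1 (abs_lt_of_sq_lt_sq h4 hu.le)).1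
      exact div_pos (by linarith) hb
    · rw [e1, e2]
      exact ⟨by linarith [(hCr z hz).1], by linarith [(hCr z hz).2]⟩

/-! ### The symmetric system -/

lemma hasDerivAt_quartic (a₀ a₁ a₂ a₃ a₄ x : ℝ) :
    HasDerivAt (fun x => a₀ + a₁ * x + a₂ * x ^ 2 + a₃ * x ^ 3 + a₄ * x ^ 4)
      (a₁ + 2 * a₂ * x + 3 * a₃ * x ^ 2 + 4 * a₄ * x ^ 3) x := by
  refine ((((((hasDerivAt_id x).const_mul a₁).const_add a₀).add
    (((hasDerivAt_id x).pow 2).const_mul a₂)).add (((hasDerivAt_id x).pow 3).const_mul a₃)).add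
    (((hasDerivAt_id x).pow 4).const_mul a₄)).congr_deriv ?_
  simp
  ring

lemma deriv_quartic {f : ℝ → ℝ} (a₀ a₁ a₂ a₃ a₄ x : ℝ)
    (hf : ∀ x, f x = a₀ + a₁ * x + a₂ * x ^ 2 + a₃ * x ^ 3 + a₄ * x ^ 4) :
    deriv f x = a₁ + 2 * a₂ * x + 3 * a₃ * x ^ 2 + 4 * a₄ * x ^ 3 := by
  rw [funext hf]
  exact (hasDerivAt_quartic a₀ a₁ a₂ a₃ a₄ x).deriv

lemma symField_apply (h31 h22 h40 : ℝ) (p q : ℝ → ℝ → ℝ) (ε x y : ℝ) :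
    symField h31 h22 h40 p q ε (x, y) =
      (-(1 / 2) * y + h31 * x ^ 3 + 2 * h22 * x ^ 2 * y + 1 / 2 * y ^ 3 + ε * p x y,
        -((1 - 2 * h22) * x + 4 * h40 * x ^ 3 + 3 * h31 * x ^ 2 * y + 2 * h22 * x * y ^ 2) +
          ε * q x y) := by
  simp only [symField, nearHamiltonianField]
  rw [deriv_quartic (f := fun y => centerHamiltonian h31 h22 h40 x y)
      ((1 / 2 - h22) * x ^ 2 + h40 * x ^ 4) (h31 * x ^ 3) (-1 / 4 + h22 * x ^ 2) 0 (1 / 8) y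
      (fun y => by simp only [centerHamiltonian, symHamiltonian]; ring),
    deriv_quartic (f := fun x => centerHamiltonian h31 h22 h40 x y)
      (-1 / 4 * y ^ 2 + 1 / 8 * y ^ 4) 0 (1 / 2 - h22 + h22 * y ^ 2) (h31 * y) h40 x
      (fun x => by simp only [centerHamiltonian, symHamiltonian]; ring)]
  ext <;> simp <;> ring

lemma normalField_apply (h31 h22 h40 : ℝ) (p q : ℝ → ℝ → ℝ) (ε x y : ℝ) :
    normalField h31 h22 h40 p q ε (1 - y, x) =
      (-(symField h31 h22 h40 p q ε (x, y)).2, (symField h31 h22 h40 p q ε (x, y)).1) := by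
  rw [symField_apply]
  simp only [normalField, nearHamiltonianField]
  rw [deriv_quartic (f := fun v => normalHamiltonian h31 h22 h40 (1 - y) v)
      (1 / 2 * (1 - y) ^ 2 - 1 / 2 * (1 - y) ^ 3 + 1 / 8 * (1 - y) ^ 4) 0
      (1 / 2 - 2 * h22 * (1 - y) + h22 * (1 - y) ^ 2) (h31 - h31 * (1 - y)) h40 x
      (fun v => by simp only [normalHamiltonian]; ring),
    deriv_quartic (f := fun u => normalHamiltonian h31 h22 h40 u x)
      (1 / 2 * x ^ 2 + h31 * x ^ 3 + h40 * x ^ 4) (-2 * h22 * x ^ 2 - h31 * x ^ 3)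
      (1 / 2 + h22 * x ^ 2) (-1 / 2) (1 / 8) (1 - y)
      (fun u => by simp only [normalHamiltonian]; ring)]
  simp only [sub_sub_cancel]
  ext <;> simp <;> ring

/-- Limit cycles of the normal form correspond to those of the symmetric system. -/
lemma IsLimitCycle.normalField {h31 h22 h40 ε : ℝ} {p q : ℝ → ℝ → ℝ} {C : Set (ℝ × ℝ)}
    (hC : IsLimitCycle (symField h31 h22 h40 p q ε) C) :
    IsLimitCycle (normalField h31 h22 h40 p q ε) ((fun z : ℝ × ℝ => (1 - z.2, z.1)) '' C) := by
  refine hC.image (Ψ := fun z => (z.2, 1 - z.1)) (D := univ) (O := univ) isOpen_univ (fun z _ => ?_)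
    (fun z _ => ?_) (fun z _ => by fun_prop) (fun z _ => ?_) (subset_univ _)
  · simp
  · simp
  · refine ⟨(ContinuousLinearMap.snd ℝ ℝ ℝ).prod (-ContinuousLinearMap.fst ℝ ℝ ℝ), ?_, ?_⟩
    · exact hasFDerivAt_snd.prodMk (hasFDerivAt_fst.const_sub 1)
    · have := normalField_apply h31 h22 h40 p q ε z.2 (1 - z.1)
      simp only [sub_sub_cancel] at this
      rw [show z = (z.1, z.2) from rfl, this]
      simp

/-- The point reflection carries limit cycles of the symmetric system to limit cycles. -/
lemma IsLimitCycle.neg_symField {h31 h22 h40 ε : ℝ} {p q : ℝ → ℝ → ℝ} {C : Set (ℝ × ℝ)}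
    (hp : IsOddCubic p) (hq : IsOddCubic q)
    (hC : IsLimitCycle (symField h31 h22 h40 p q ε) C) :
    IsLimitCycle (symField h31 h22 h40 p q ε) ((fun z : ℝ × ℝ => -z) '' C) := by
  refine hC.image (Ψ := fun z => -z) (D := univ) (O := univ) isOpen_univ (fun z _ => by simp)
    (fun z _ => by simp) (fun z _ => by fun_prop) (fun z _ => ?_) (subset_univ _)
  refine ⟨-ContinuousLinearMap.id ℝ (ℝ × ℝ), (hasFDerivAt_id z).neg, ?_⟩
  obtain ⟨a10, a01, a30, a21, a12, a03, hp⟩ := hp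
  obtain ⟨b10, b01, b30, b21, b12, b03, hq⟩ := hq
  obtain ⟨x, y⟩ := z
  simp only [Prod.neg_mk, symField_apply, hp, hq]
  ext <;> simp <;> ring

/-- The coordinates `t = x / y`, `W = y²` on the upper half plane. -/
lemma IsLimitCycle.symField_of_twField {h31 h22 h40 ε a10 a01 a30 a21 a12 a03 b10 b01 b30 b21 b12
    b03 : ℝ} {p q : ℝ → ℝ → ℝ}
    (hp : ∀ x y, p x y =
      a10 * x + a01 * y + a30 * x ^ 3 + a21 * (x ^ 2 * y) + a12 * (x * y ^ 2) + a03 * y ^ 3)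
    (hq : ∀ x y, q x y =
      b10 * x + b01 * y + b30 * x ^ 3 + b21 * (x ^ 2 * y) + b12 * (x * y ^ 2) + b03 * y ^ 3)
    {C : Set (ℝ × ℝ)} (hC0 : ∀ z ∈ C, 0 < z.2)
    (hC : IsLimitCycle (twField h31 (2 - 4 * h22) ((1 - 2 * h22) ^ 2 - 2 * h40)
      (fun t => a01 + (a10 - b01) * t - b10 * t ^ 2)
      (fun t => a03 + (a12 - b03) * t + (a21 - b12) * t ^ 2 + (a30 - b21) * t ^ 3 - b30 * t ^ 4)
      (fun t => b01 + b10 * t) (fun t => b03 + b12 * t + b21 * t ^ 2 + b30 * t ^ 3) ε) C) :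
    IsLimitCycle (symField h31 h22 h40 p q ε) ((fun z : ℝ × ℝ => (z.1 * √z.2, √z.2)) '' C) := by
  refine hC.image (Ψ := fun z => (z.1 / z.2, z.2 ^ 2)) (D := {z | 0 < z.2}) (O := {z | 0 < z.2})
    (isOpen_lt (by fun_prop) (by fun_prop)) (fun z hz => ?_) (fun z hz => ?_) (fun z hz => ?_)
    (fun z hz => ?_) hC0
  · have h1 : 0 < √z.2 := Real.sqrt_pos.2 hz
    refine ⟨h1, ?_⟩
    ext
    · simp [h1.ne']
    · simp [Real.sq_sqrt (le_of_lt hz)]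
  · have hz' : 0 < z.2 := hz
    refine ⟨pow_pos hz' 2, ?_⟩
    ext
    · simp [Real.sqrt_sq hz'.le, hz'.ne']
    · simp [Real.sqrt_sq hz'.le]
  · have h1 : DifferentiableAt ℝ (fun z : ℝ × ℝ => √z.2) z :=
      differentiableAt_snd.sqrt (ne_of_gt hz)
    exact (differentiableAt_fst.mul h1).prodMk h1
  · obtain ⟨x, y⟩ := z
    have hy : 0 < y := hz
    have hd1 : DifferentiableAt ℝ (fun z : ℝ × ℝ => z.1 / z.2) (x, y) := by
      simp only [div_eq_mul_inv]
      exact differentiableAt_fst.mul (differentiableAt_snd.inv hy.ne')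
    have h1 := hasFDerivAt_of_partial hd1 (a := 1 / y) (b := -x / y ^ 2)
      (by simpa using (hasDerivAt_id x).div_const y)
      (by
        refine ((hasDerivAt_const y x).div (hasDerivAt_id y) hy.ne').congr_deriv ?_
        simp)
    have h2 := hasFDerivAt_of_partial (F := fun z : ℝ × ℝ => z.2 ^ 2) (x := x) (y := y)
      (by fun_prop) (a := 0) (b := 2 * y) (hasDerivAt_const x (y ^ 2))
      (((hasDerivAt_id y).pow 2).congr_deriv (by simp))
    refine ⟨_, h1.prodMk h2, ?_⟩
    simp only [symField_apply, twField, leadPoly, leadPolyDeriv, axisPoly, crossPoly,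
      hp, hq, ContinuousLinearMap.prod_apply, add_apply, smul_apply, ContinuousLinearMap.coe_fst',
      ContinuousLinearMap.coe_snd', smul_eq_mul, Prod.mk.injEq]
    constructor
    · field_simp
      ring
    · field_simp
      ring

/-! ### Existence of charts depending smoothly on parameters -/

lemma contDiff_crossPoly_param (h : ℝ) :
    ContDiff ℝ 1 fun p : ℝ × ℝ × ℝ => crossPoly h p.2.2 p.1 := by
  unfold crossPoly; fun_prop

lemma contDiff_axisPoly_param : ContDiff ℝ 1 fun p : ℝ × ℝ × ℝ => axisPoly p.2.1 p.1 := by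
  unfold axisPoly; fun_prop

lemma contDiff_leadPoly_param (h : ℝ) :
    ContDiff ℝ 1 fun p : ℝ × ℝ × ℝ => leadPoly h p.2.1 p.2.2 p.1 := by
  unfold leadPoly axisPoly crossPoly; fun_prop

lemma contDiff_slopePoly_param (h : ℝ) :
    ContDiff ℝ 1 fun p : ℝ × ℝ × ℝ => slopePoly h p.2.1 p.2.2 p.1 := by
  unfold slopePoly; fun_prop

@[simp] lemma crossPoly_zero (h n : ℝ) : crossPoly h n 0 = 1 := by simp [crossPoly]

@[simp] lemma axisPoly_zero (l : ℝ) : axisPoly l 0 = 1 := by simp [axisPoly]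

@[simp] lemma leadPoly_zero (h l n : ℝ) : leadPoly h l n 0 = 1 := by simp [leadPoly]

@[simp] lemma slopePoly_zero (h l n : ℝ) : slopePoly h l n 0 = 2 := by simp [slopePoly]

@[simp] lemma sCoord_zero (h l n : ℝ) : sCoord h l n 0 = 0 := by simp [sCoord]

/-- Near any parameter values there is a family of charts on a common domain, whose images lie
close to the centre. -/
lemma exists_chart (h l₀ n₀ : ℝ) {η : ℝ} (hη : 0 < η) :
    ∃ (T : ℝ × ℝ × ℝ → ℝ) (τ R ω : ℝ), 0 < R ∧ 0 < ω ∧ ∀ l n, |l - l₀| < ω → |n - n₀| < ω →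
      IsChart h l n (fun s => T (s, l, n)) τ R ∧
      (∀ s, |s| < R → ContinuousAt T (s, l, n)) ∧
      ∀ t V, |t| < τ → |V| < R →
        |t * √(wOfV h l n t V)| < η ∧ |√(wOfV h l n t V) - 1| < η := by
  set p₀ : ℝ × ℝ × ℝ := (0, l₀, n₀) with hp₀
  -- `A` is S/t, extended smoothly across t = 0.
  set A : ℝ × ℝ × ℝ → ℝ := fun p =>
    2 * √(crossPoly h p.2.2 p.1) / √(leadPoly h p.2.1 p.2.2 p.1) with hA
  have hA0 : A p₀ = 2 := by simp [hA, hp₀]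
  have hAc : ContDiffAt ℝ 1 A p₀ := by
    refine (contDiffAt_const.mul ((contDiff_crossPoly_param h).contDiffAt.sqrt ?_)).div
      ((contDiff_leadPoly_param h).contDiffAt.sqrt ?_) ?_ <;> simp [hp₀]
  set Φ : ℝ × ℝ × ℝ → ℝ × ℝ × ℝ := fun p => (p.1 * A p, p.2) with hΦ
  have hΦs : ∀ p, Φ p = (sCoord h p.2.1 p.2.2 p.1, p.2) := fun p => by
    simp only [hΦ, hA, sCoord]
    congr 1
    ring
  have hΦc : ContDiffAt ℝ 1 Φ p₀ := (contDiffAt_fst.mul hAc).prodMk contDiffAt_snd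
  set f' : (ℝ × ℝ × ℝ) ≃L[ℝ] ℝ × ℝ × ℝ :=
    (ContinuousLinearEquiv.unitsEquivAut ℝ (Units.mk0 2 two_ne_zero)).prodCongr
      (ContinuousLinearEquiv.refl ℝ (ℝ × ℝ)) with hf'
  have hΦd : HasFDerivAt Φ (f' : (ℝ × ℝ × ℝ) →L[ℝ] ℝ × ℝ × ℝ) p₀ := by
    have h1 := ((hasFDerivAt_fst (𝕜 := ℝ) (E := ℝ) (F := ℝ × ℝ) (p := p₀)).mul
      (hAc.differentiableAt one_ne_zero).hasFDerivAt).prodMk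
      (hasFDerivAt_snd (𝕜 := ℝ) (E := ℝ) (F := ℝ × ℝ) (p := p₀))
    refine h1.congr_fderiv ?_
    have h0 : p₀.1 = 0 := rfl
    rw [hA0, h0]
    ext <;> simp [hf']
  -- The inverse function theorem is applied to (t, l, n) ↦ (S, l, n). Carrying the parameters as
  -- coordinates gives one domain for all nearby (l, n) and continuity of T in them.
  set e := hΦc.toOpenPartialHomeomorph Φ hΦd one_ne_zero with he
  have hp₀s : p₀ ∈ e.source := hΦc.mem_toOpenPartialHomeomorph_source hΦd one_ne_zero
  have hΦ0 : Φ p₀ = p₀ := by simp [hΦ, hp₀]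
  have hp₀t : p₀ ∈ e.target := by
    have := hΦc.image_mem_toOpenPartialHomeomorph_target hΦd one_ne_zero
    rwa [hΦ0] at this
  have hsymm : ContDiffAt ℝ 1 e.symm p₀ := by
    have := hΦc.to_localInverse hΦd one_ne_zero
    rwa [hΦ0] at this
  have hsymm0 : e.symm p₀ = p₀ := by
    have := e.left_inv hp₀s
    rwa [show e p₀ = p₀ from hΦ0] at this
  have hev1 : ∀ᶠ p in 𝓝 p₀, p ∈ e.source ∧ 0 < crossPoly h p.2.2 p.1 ∧ 0 < axisPoly p.2.1 p.1 ∧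
      0 < slopePoly h p.2.1 p.2.2 p.1 := by
    have hsrc : ∀ᶠ p in 𝓝 p₀, p ∈ e.source := e.open_source.mem_nhds hp₀s
    refine hsrc.and (.and ?_ (.and ?_ ?_))
    · exact (contDiff_crossPoly_param h).continuous.continuousAt.eventually
        (lt_mem_nhds (by simp [hp₀]))
    · exact contDiff_axisPoly_param.continuous.continuousAt.eventually
        (lt_mem_nhds (by simp [hp₀]))
    · exact (contDiff_slopePoly_param h).continuous.continuousAt.eventually
        (lt_mem_nhds (by simp [hp₀]))
  -- At t = V = 0 the value of W is 1 for all parameters, which is the centre (0, 1) in the original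
  -- coordinates.
  have hev2 : ∀ᶠ x : ℝ × ℝ × ℝ × ℝ in 𝓝 (0, 0, l₀, n₀),
      |x.1 * √(wOfV h x.2.2.1 x.2.2.2 x.1 x.2.1)| < η ∧
        |√(wOfV h x.2.2.1 x.2.2.2 x.1 x.2.1) - 1| < η := by
    have hw : ContinuousAt (fun x : ℝ × ℝ × ℝ × ℝ => √(wOfV h x.2.2.1 x.2.2.2 x.1 x.2.1))
        (0, 0, l₀, n₀) := by
      refine ContinuousAt.sqrt (ContinuousAt.div ?_ ?_ (by simp))
      · unfold leadPoly axisPoly crossPoly; fun_prop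
      · unfold leadPoly axisPoly crossPoly; fun_prop
    have h1 := (continuousAt_fst.mul hw).abs
    have h2 := (hw.sub (continuousAt_const (y := (1 : ℝ)))).abs
    refine (h1.eventually (gt_mem_nhds ?_)).and (h2.eventually (gt_mem_nhds ?_))
    · simpa using hη
    · simpa [wOfV] using hη
  obtain ⟨τ₁, hτ₁, hτ₁'⟩ := Metric.eventually_nhds_iff.1 hev1
  obtain ⟨τ₂, hτ₂, hτ₂'⟩ := Metric.eventually_nhds_iff.1 hev2
  set τ := min τ₁ τ₂ with hτ
  have hτ0 : 0 < τ := by positivity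
  have hev3 : ∀ᶠ q in 𝓝 p₀, q ∈ e.target ∧ ContDiffAt ℝ 1 e.symm q ∧ |(e.symm q).1| < τ := by
    have htgt : ∀ᶠ p in 𝓝 p₀, p ∈ e.target := e.open_target.mem_nhds hp₀t
    refine htgt.and (.and (hsymm.eventually (by simp)) ?_)
    have h1 := (continuousAt_fst.comp hsymm.continuousAt).abs
    refine h1.eventually (gt_mem_nhds ?_)
    have h0 : (e.symm p₀).1 = 0 := by rw [hsymm0]
    simpa [h0] using hτ0
  obtain ⟨R₀, hR₀, hR₀'⟩ := Metric.eventually_nhds_iff.1 hev3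
  have hb1 : τ ≤ τ₁ := min_le_left _ _
  have hb2 : τ ≤ τ₂ := min_le_right _ _
  refine ⟨fun q => (e.symm q).1, τ, min R₀ (min τ (1 / 2)), min R₀ τ, by positivity, by positivity,
    fun l n hl hn => ?_⟩
  set R := min R₀ (min τ (1 / 2)) with hR
  have hRR : R ≤ R₀ := min_le_left _ _
  have hRτ : R ≤ τ := (min_le_right _ _).trans (min_le_left _ _)
  have hR2 : R ≤ 1 / 2 := (min_le_right _ _).trans (min_le_right _ _)
  obtain ⟨hlR, hlτ⟩ := lt_min_iff.1 hl
  obtain ⟨hnR, hnτ⟩ := lt_min_iff.1 hn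
  have hbox1 : ∀ t, |t| < τ → (t, l, n) ∈ e.source ∧ 0 < crossPoly h n t ∧ 0 < axisPoly l t ∧
      0 < slopePoly h l n t := fun t ht => by
    refine @hτ₁' (t, l, n) ?_
    simp only [hp₀, Prod.dist_eq, Real.dist_eq, sub_zero, max_lt_iff]
    exact ⟨by linarith, by linarith, by linarith⟩
  have hbox3 : ∀ s, |s| < R → (s, l, n) ∈ e.target ∧ ContDiffAt ℝ 1 e.symm (s, l, n) ∧
      |(e.symm (s, l, n)).1| < τ := fun s hs => by
    refine @hR₀' (s, l, n) ?_
    simp only [hp₀, Prod.dist_eq, Real.dist_eq, sub_zero, max_lt_iff]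
    exact ⟨by linarith, by linarith, by linarith⟩
  refine ⟨⟨fun t ht => (hbox1 t ht).2, by linarith, fun s hs => (hbox3 s hs).2.2, fun s hs => ?_,
    fun t ht hst => ?_, fun s hs => ?_⟩, fun s hs => ?_, fun t V ht hV => ?_⟩
  · have h1 : Φ (e.symm (s, l, n)) = (s, l, n) := e.right_inv (hbox3 s hs).1
    rw [hΦs] at h1
    have h2 : (e.symm (s, l, n)).2 = (l, n) := congrArg Prod.snd h1
    have h3 := congrArg Prod.fst h1
    simp only [h2] at h3
    exact h3
  · have h1 : e (t, l, n) = (sCoord h l n t, l, n) := hΦs (t, l, n)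
    have h2 := e.left_inv (hbox1 t ht).1
    rw [h1] at h2
    simp only [h2]
  · exact contDiffAt_fst.comp s ((hbox3 s hs).2.1.comp s
      (contDiffAt_id.prodMk contDiffAt_const))
  · exact continuousAt_fst.comp (hbox3 s hs).2.1.continuousAt
  · refine @hτ₂' (t, V, l, n) ?_
    simp only [Prod.dist_eq, Real.dist_eq, sub_zero, max_lt_iff]
    exact ⟨by linarith, by linarith, by linarith, by linarith⟩

/-! ### The averaged function as an integral operator -/

/-- Compactness of the interval makes the joint continuity at the parameter uniform in the
integration variable. -/
lemma continuousAt_intervalIntegral_param {E : Type*} [TopologicalSpace E] {F : E → ℝ → ℝ} {θ : E}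
    {a b : ℝ} (hc : ∀ φ ∈ uIcc a b, ContinuousAt (fun p : E × ℝ => F p.1 p.2) (θ, φ))
    (hF : ∀ᶠ θ' in 𝓝 θ, Continuous (F θ')) :
    ContinuousAt (fun θ => ∫ φ in a..b, F θ φ) θ := by
  rw [Metric.continuousAt_iff']
  intro η hη
  have hη' : 0 < η / (|b - a| + 1) := by positivity
  have hev := isCompact_uIcc.eventually_forall_of_forall_eventually (x₀ := θ)
    (K := uIcc a b) (P := fun θ' φ => |F θ' φ - F θ φ| < η / (|b - a| + 1)) (fun φ hφ => by
      have h1 := hc φ hφ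
      have h2 : ContinuousAt (fun p : E × ℝ => F θ p.2) (θ, φ) := by
        have : ContinuousAt (fun p : E × ℝ => ((θ, p.2) : E × ℝ)) (θ, φ) := by fun_prop
        exact ContinuousAt.comp (f := fun p : E × ℝ => ((θ, p.2) : E × ℝ)) h1 this
      have h3 := (h1.sub h2).abs
      refine h3.eventually (gt_mem_nhds ?_)
      simpa using hη')
  filter_upwards [hev, hF] with θ' h1 h2
  have h0 : Continuous (F θ) := hF.self_of_nhds
  rw [dist_eq_norm, ← intervalIntegral.integral_sub (h2.intervalIntegrable _ _)
    (h0.intervalIntegrable _ _)]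
  have h3 := intervalIntegral.norm_integral_le_of_norm_le_const
    (f := fun φ => F θ' φ - F θ φ) (a := a) (b := b) (C := η / (|b - a| + 1))
    fun φ hφ => (h1 φ (uIoc_subset_uIcc hφ)).le
  refine h3.trans_lt ?_
  rw [div_mul_eq_mul_div, div_lt_iff₀ (by positivity)]
  nlinarith [abs_nonneg (b - a)]

lemma abs_mul_sin_lt {ρ R φ : ℝ} (hρ : 0 ≤ ρ) (hρR : ρ < R) : |ρ * Real.sin φ| < R := by
  rw [abs_mul, abs_of_nonneg hρ]
  have := Real.abs_sin_le_one φ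
  nlinarith

/-- Sign of the integral operator near `0`, from the even part of the kernel. -/
lemma eventually_integral_cos_sq_pos {G : ℝ → ℝ} {R c : ℝ} (hR : 0 < R)
    (hG : ∀ s, |s| < R → ContinuousAt G s) (hpos : ∀ᶠ s in 𝓝[>] (0 : ℝ), 0 < c * (G s + G (-s))) :
    ∀ᶠ ρ in 𝓝[>] (0 : ℝ),
      0 < c * ∫ φ in (0 : ℝ)..2 * Real.pi, Real.cos φ ^ 2 * G (ρ * Real.sin φ) := by
  obtain ⟨δ, hδ, h⟩ := mem_nhdsGT_iff_exists_Ioo_subset.1 hpos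
  have hδ0 : (0 : ℝ) < δ := hδ
  filter_upwards [Ioo_mem_nhdsGT (lt_min hδ0 hR)] with ρ hρ
  have hρδ : ρ < δ := hρ.2.trans_le (min_le_left _ _)
  have hρR : ρ < R := hρ.2.trans_le (min_le_right _ _)
  set f : ℝ → ℝ := fun φ => Real.cos φ ^ 2 * G (ρ * Real.sin φ) with hf
  have hfc : Continuous f := continuous_iff_continuousAt.2 fun φ => by
    have h1 : ContinuousAt (fun φ => ρ * Real.sin φ) φ := by fun_prop
    have h2 : ContinuousAt (fun φ => Real.cos φ ^ 2) φ := by fun_prop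
    exact h2.mul (ContinuousAt.comp (f := fun φ => ρ * Real.sin φ) (g := G)
      (hG _ (abs_mul_sin_lt hρ.1.le hρR)) h1)
  -- Half a turn changes s = ρ sin φ into -s, so folding the interval pairs G(s) with G(-s).
  have hsplit : ∫ φ in (0 : ℝ)..2 * Real.pi, f φ =
      ∫ φ in (0 : ℝ)..Real.pi, (f φ + f (φ + Real.pi)) := by
    have h1 := intervalIntegral.integral_comp_add_right (a := 0) (b := Real.pi) f Real.pi
    rw [zero_add, ← two_mul] at h1
    rw [intervalIntegral.integral_add (hfc.intervalIntegrable _ _)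
      ((by fun_prop : Continuous fun φ => f (φ + Real.pi)).intervalIntegrable _ _), h1,
      intervalIntegral.integral_add_adjacent_intervals (hfc.intervalIntegrable _ _)
      (hfc.intervalIntegrable _ _)]
  rw [hsplit, ← intervalIntegral.integral_const_mul]
  have hform : ∀ φ, c * (f φ + f (φ + Real.pi)) =
      Real.cos φ ^ 2 * (c * (G (ρ * Real.sin φ) + G (-(ρ * Real.sin φ)))) := fun φ => by
    simp only [hf, Real.cos_add_pi, Real.sin_add_pi, mul_neg]
    ring
  have hpos' : ∀ φ ∈ Ioo 0 Real.pi,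
      0 < c * (G (ρ * Real.sin φ) + G (-(ρ * Real.sin φ))) := fun φ hφ => by
    have hs := Real.sin_pos_of_pos_of_lt_pi hφ.1 hφ.2
    refine h ⟨by have := hρ.1; positivity, ?_⟩
    have := Real.sin_le_one φ
    nlinarith [hρ.1]
  refine intervalIntegral.integral_pos Real.pi_pos (by fun_prop) (fun φ hφ => ?_)
    ⟨Real.pi / 4, ⟨by positivity, by linarith [Real.pi_pos]⟩, ?_⟩
  · rw [hform]
    rcases hφ.2.eq_or_lt with h1 | h1
    · rw [h1]
      simp only [Real.sin_pi, mul_zero, neg_zero]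
      -- At φ = π the argument is s = 0, which the hypothesis does not cover; the weak inequality
      -- there is a limit.
      have hlim : Tendsto (fun s => c * (G s + G (-s))) (𝓝[>] 0) (𝓝 (c * (G 0 + G (-0)))) := by
        have hc0 : ContinuousAt G 0 := hG 0 (by simpa using hR)
        have hc1 : ContinuousAt (fun s => G (-s)) 0 := by
          refine ContinuousAt.comp (f := fun s : ℝ => -s) (g := G) ?_ (by fun_prop)
          simpa using hc0
        exact (continuousAt_const.mul (hc0.add hc1)).tendsto.mono_left nhdsWithin_le_nhds
      have := ge_of_tendsto hlim (hpos.mono fun s hs => hs.le)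
      simp only [neg_zero] at this
      positivity
    · exact mul_nonneg (sq_nonneg _) (hpos' φ ⟨hφ.1, h1⟩).le
  · rw [hform]
    have h1 : 0 < Real.cos (Real.pi / 4) := Real.cos_pos_of_mem_Ioo
      ⟨by linarith [Real.pi_pos], by linarith [Real.pi_pos]⟩
    have h2 := hpos' (Real.pi / 4) ⟨by positivity, by linarith [Real.pi_pos]⟩
    positivity

lemma hasDerivAt_integral_cos_sq {G : ℝ → ℝ} {R ρ : ℝ} (hρ : 0 < ρ) (hρR : ρ < R)
    (hG : ∀ s, |s| < R → ContDiffAt ℝ 1 G s) :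
    ∃ D, HasDerivAt (fun ρ => ∫ φ in (0 : ℝ)..2 * Real.pi,
      Real.cos φ ^ 2 * G (ρ * Real.sin φ)) D ρ := by
  obtain ⟨r, hr, hr0, hrR⟩ : ∃ r > 0, r < ρ ∧ ρ + r < R := by
    refine ⟨min ρ (R - ρ) / 2, ?_, ?_, ?_⟩
    · have : 0 < R - ρ := by linarith
      positivity
    · have := min_le_left ρ (R - ρ); linarith
    · have := min_le_right ρ (R - ρ); linarith
  have hmem : ∀ x ∈ Icc (ρ - r) (ρ + r), ∀ φ, |x * Real.sin φ| < R := fun x hx φ =>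
    abs_mul_sin_lt (by linarith [hx.1]) (by linarith [hx.2])
  have hd : ∀ s, |s| < R → HasDerivAt G (deriv G s) s := fun s hs =>
    ((hG s hs).differentiableAt one_ne_zero).hasDerivAt
  have hdc : ContinuousOn (deriv G) {s | |s| < R} := by
    have ho : IsOpen {s : ℝ | |s| < R} := isOpen_lt continuous_abs continuous_const
    have : ContDiffOn ℝ 1 G {s | |s| < R} := fun s hs => (hG s hs).contDiffWithinAt
    exact this.continuousOn_deriv_of_isOpen ho le_rfl
  refine ⟨_, hasDerivAt_intervalIntegral_param
    (F := fun φ ρ => Real.cos φ ^ 2 * G (ρ * Real.sin φ))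
    (F' := fun φ ρ => Real.cos φ ^ 2 * (deriv G (ρ * Real.sin φ) * Real.sin φ)) hr
    (fun x hx => ?_) ?_ fun φ x hx => ?_⟩
  · refine continuous_iff_continuousAt.2 fun φ => ?_
    have h1 : ContinuousAt (fun φ => x * Real.sin φ) φ := by fun_prop
    have h2 : ContinuousAt (fun φ => Real.cos φ ^ 2) φ := by fun_prop
    exact h2.mul (ContinuousAt.comp (f := fun φ => x * Real.sin φ) (g := G)
      (hG _ (hmem x hx φ)).continuousAt h1)
  · have h1 : ContinuousOn (fun p : ℝ × ℝ => deriv G (p.2 * Real.sin p.1))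
        (univ ×ˢ Icc (ρ - r) (ρ + r)) :=
      hdc.comp (by fun_prop) fun p hp => hmem p.2 hp.2 p.1
    have h2 : ContinuousOn (fun p : ℝ × ℝ => Real.cos p.1 ^ 2) (univ ×ˢ Icc (ρ - r) (ρ + r)) := by
      fun_prop
    have h3 : ContinuousOn (fun p : ℝ × ℝ => Real.sin p.1) (univ ×ˢ Icc (ρ - r) (ρ + r)) := by
      fun_prop
    exact h2.mul (h1.mul h3)
  · have := (hd _ (hmem x hx φ)).comp x ((hasDerivAt_id x).mul_const (Real.sin φ))
    exact (this.const_mul (Real.cos φ ^ 2)).congr_deriv (by simp)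

/-- For almost every `c`, all zeros of `c N₀ + N₁` are simple. -/
lemma exists_forall_zero_simple {N₀ N₁ N₀' N₁' : ℝ → ℝ} {R a b : ℝ} (hab : a < b)
    (h₀ : ∀ ρ ∈ Ioo 0 R, HasDerivAt N₀ (N₀' ρ) ρ) (h₁ : ∀ ρ ∈ Ioo 0 R, HasDerivAt N₁ (N₁' ρ) ρ)
    (hpos : ∀ ρ ∈ Ioo 0 R, N₀ ρ ≠ 0) :
    ∃ c ∈ Ioo a b, ∀ ρ ∈ Ioo 0 R, c * N₀ ρ + N₁ ρ = 0 → c * N₀' ρ + N₁' ρ ≠ 0 := by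
  -- A multiple zero of `c N₀ + N₁` is a critical point of `ψ` with value `c`, and critical values
  -- form a null set by one-dimensional Sard.
  set ψ : ℝ → ℝ := fun ρ => -N₁ ρ / N₀ ρ with hψ
  set ψ' : ℝ → ℝ := fun ρ => (-N₁' ρ * N₀ ρ - -N₁ ρ * N₀' ρ) / N₀ ρ ^ 2 with hψ'
  have hd : ∀ ρ ∈ Ioo 0 R, HasDerivAt ψ (ψ' ρ) ρ := fun ρ hρ =>
    (h₁ ρ hρ).neg.div (h₀ ρ hρ) (hpos ρ hρ)
  set S : Set ℝ := {ρ | ρ ∈ Ioo 0 R ∧ ψ' ρ = 0} with hS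
  have hnull : volume (ψ '' S) = 0 := by
    refine addHaar_image_eq_zero_of_det_fderivWithin_eq_zero volume
      (f' := fun ρ => ContinuousLinearMap.toSpanSingleton ℝ (ψ' ρ))
      (fun ρ hρ => (hd ρ hρ.1).hasFDerivAt.hasFDerivWithinAt) fun ρ hρ => ?_
    rw [hρ.2]
    simp [ContinuousLinearMap.det]
  have hne : (Ioo a b \ ψ '' S).Nonempty := by
    by_contra hcon
    rw [not_nonempty_iff_eq_empty, sdiff_eq_empty] at hcon
    have := measure_mono_null hcon hnull
    rw [Real.volume_Ioo, ENNReal.ofReal_eq_zero] at this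
    linarith
  obtain ⟨c, hc, hcS⟩ := hne
  refine ⟨c, hc, fun ρ hρ hz hz' => hcS ⟨ρ, ⟨hρ, ?_⟩, ?_⟩⟩
  · simp only [hψ']
    rw [div_eq_zero_iff]
    left
    linear_combination N₀' ρ * hz - N₀ ρ * hz'
  · have := hpos ρ hρ
    simp only [hψ]
    field_simp
    linarith

/-! ### Sign of the averaged function near the centre -/

namespace IsChart

variable {h l n τ R c00 c02 c11 c20 : ℝ} {T : ℝ → ℝ}

lemma contDiffAt_meanKernel (H : IsChart h l n T τ R) {s : ℝ} (hs : |s| < R) :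
    ContDiffAt ℝ 1 (fun s => meanKernel h l n c00 c02 c11 c20 (T s)) s := by
  obtain ⟨hC, hu, hK⟩ := H.pos _ (H.mem s hs)
  have h1 : ContDiffAt ℝ 1 (meanKernel h l n c00 c02 c11 c20) (T s) := by
    unfold meanKernel
    refine ContDiffAt.div (((contDiff_crossPoly h n).contDiffAt.sqrt hC.ne').mul
      ((contDiffAt_const.mul (contDiff_leadPoly h l n).contDiffAt).add
        (ContDiffAt.mul ?_ (contDiff_axisPoly l).contDiffAt)))
      ((contDiff_slopePoly h l n).contDiffAt.mul (contDiff_axisPoly l).contDiffAt)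
      (mul_pos hK hu).ne'
    unfold divPoly
    fun_prop
  exact ContDiffAt.comp s h1 (H.contDiffAt s hs)

lemma apply_zero (H : IsChart h l n T τ R) (hR : 0 < R) : T 0 = 0 := by
  have h0 : |(0 : ℝ)| < R := by simpa using hR
  have hτ : |(0 : ℝ)| < τ := by simpa using (abs_nonneg _).trans_lt (H.mem 0 h0)
  simpa using H.left_inv 0 hτ (by simpa using hR)

/-- `t √C / u` is an odd function of `s`. -/
lemma odd_coord (H : IsChart h l n T τ R) {s : ℝ} (hs : |s| < R) :
    T s * √(crossPoly h n (T s)) / axisPoly l (T s) = s / (2 * √(1 - s ^ 2)) := by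
  have ht := H.mem s hs
  obtain ⟨hC, hu, hK⟩ := H.pos _ ht
  have hb := Real.sqrt_pos.2 (H.lead_pos ht)
  have h1 := one_sub_sCoord_sq (h := h) (n := n) hC hu
  have h2 := H.right_inv s hs
  rw [h2] at h1
  rw [h1, Real.sqrt_div (sq_nonneg _), Real.sqrt_sq hu.le]
  rw [sCoord, div_eq_iff hb.ne'] at h2
  field_simp
  linear_combination h2

lemma crossPoly_div (H : IsChart h l n T τ R) {s : ℝ} (hs : |s| < R) :
    T s ^ 2 * crossPoly h n (T s) / axisPoly l (T s) ^ 2 = (s / (2 * √(1 - s ^ 2))) ^ 2 := by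
  rw [← H.odd_coord hs, div_pow, mul_pow, Real.sq_sqrt (H.pos _ (H.mem s hs)).1.le]

lemma pos_of_pos (H : IsChart h l n T τ R) {s : ℝ} (hs : |s| < R) (h0 : 0 < s) : 0 < T s := by
  have h2 := H.right_inv s hs
  by_contra! hcon
  have : sCoord h l n (T s) ≤ 0 :=
    div_nonpos_of_nonpos_of_nonneg
      (mul_nonpos_of_nonpos_of_nonneg (by linarith) (Real.sqrt_nonneg _)) (Real.sqrt_nonneg _)
  linarith

lemma neg_of_neg (H : IsChart h l n T τ R) {s : ℝ} (hs : |s| < R) (h0 : s < 0) : T s < 0 := by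
  have h2 := H.right_inv s hs
  by_contra! hcon
  have : 0 ≤ sCoord h l n (T s) :=
    div_nonneg (mul_nonneg (by linarith) (Real.sqrt_nonneg _)) (Real.sqrt_nonneg _)
  linarith

/-- If the kernel, divided by the odd function `t √C / u` of `s`, is a function of `t² C / u²` up
to a term `t ^ (2 k + 1) q`, then `q 0` determines the sign of the averaged function near `0`. -/
lemma eventually_meanFun_pos (H : IsChart h l n T τ R) (hR : 0 < R) {f q : ℝ → ℝ} {k : ℕ} {c : ℝ}
    (hq : ContinuousAt q 0) (hc : 0 < c * q 0)
    (hk : ∀ t, |t| < τ → c00 * leadPoly h l n t + divPoly c02 c11 c20 t * axisPoly l t =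
      t * slopePoly h l n t *
        (f (t ^ 2 * crossPoly h n t / axisPoly l t ^ 2) + t ^ (2 * k + 1) * q t)) :
    ∀ᶠ ρ in 𝓝[>] (0 : ℝ), 0 < c * meanFun h l n c00 c02 c11 c20 T ρ := by
  refine eventually_integral_cos_sq_pos
    (G := fun s => meanKernel h l n c00 c02 c11 c20 (T s)) hR
    (fun s hs => (H.contDiffAt_meanKernel hs).continuousAt) ?_
  have h0 : |(0 : ℝ)| < R := by simpa using hR
  have hT : ContinuousAt T 0 := (H.contDiffAt 0 h0).continuousAt
  have hqT : ContinuousAt (fun s => c * q (T s)) 0 :=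
    continuousAt_const.mul (ContinuousAt.comp (f := T) (by rwa [H.apply_zero hR]) hT)
  have hqT' : ContinuousAt (fun s => c * q (T (-s))) 0 := by
    refine ContinuousAt.comp (f := fun s : ℝ => -s) (g := fun s => c * q (T s)) ?_ (by fun_prop)
    simpa using hqT
  have e1 := (hqT.eventually (lt_mem_nhds (by simpa [H.apply_zero hR] using hc))).filter_mono
    (nhdsWithin_le_nhds (s := Ioi 0))
  have e2 := (hqT'.eventually (lt_mem_nhds (by simpa [H.apply_zero hR] using hc))).filter_mono
    (nhdsWithin_le_nhds (s := Ioi 0))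
  -- The first factor is odd in s and the argument of `f` is even, so the `f` term cancels in G(s) +
  -- G(-s).
  have hker : ∀ s, |s| < R → meanKernel h l n c00 c02 c11 c20 (T s) =
      s / (2 * √(1 - s ^ 2)) *
        (f ((s / (2 * √(1 - s ^ 2))) ^ 2) + T s ^ (2 * k + 1) * q (T s)) := fun s hs => by
    obtain ⟨hC, hu, hK⟩ := H.pos _ (H.mem s hs)
    rw [meanKernel, hk _ (H.mem s hs), H.crossPoly_div hs, ← H.odd_coord hs]
    field_simp
  filter_upwards [e1, e2, Ioo_mem_nhdsGT hR] with s hs1 hs2 hs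
  have hsR : |s| < R := by rw [abs_of_pos hs.1]; exact hs.2
  have hsR' : |-s| < R := by rwa [abs_neg]
  rw [hker s hsR, hker (-s) hsR', neg_sq]
  have hpos : 0 < s / (2 * √(1 - s ^ 2)) := by
    have : 0 < 1 - s ^ 2 := by nlinarith [hs.1, hs.2, H.lt_one]
    have := Real.sqrt_pos.2 this
    have := hs.1
    positivity
  -- `T` need not be odd, but `T s` and `T (-s)` have opposite signs. Their odd powers compensate
  -- the sign of the odd factor, so the two remaining terms reinforce each other.
  have t1 : 0 < T s ^ (2 * k + 1) := pow_pos (H.pos_of_pos hsR hs.1) _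
  have t2 : T (-s) ^ (2 * k + 1) < 0 :=
    (odd_two_mul_add_one k).pow_neg (H.neg_of_neg hsR' (by linarith [hs.1]))
  have e : ∀ Y f₀ a b, c * (Y * (f₀ + T s ^ (2 * k + 1) * a) +
      -Y * (f₀ + T (-s) ^ (2 * k + 1) * b)) =
      Y * (T s ^ (2 * k + 1) * (c * a) + -T (-s) ^ (2 * k + 1) * (c * b)) := fun Y f₀ a b => by
    ring
  rw [neg_div, neg_sq (s / _), e]
  have := neg_pos.2 t2
  exact mul_pos hpos (add_pos (mul_pos t1 hs1) (mul_pos this hs2))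

/-- Order zero: the kernel at s = 0 is (c₀₀ + c₀₂)/2. -/
lemma eventually_meanFun_pos_of_add (H : IsChart h l n T τ R) (hR : 0 < R) {c : ℝ}
    (hc : 0 < c * (c00 + c02)) :
    ∀ᶠ ρ in 𝓝[>] (0 : ℝ), 0 < c * meanFun h l n c00 c02 c11 c20 T ρ := by
  have hG : ∀ s, |s| < R → ContinuousAt (fun s => meanKernel h l n c00 c02 c11 c20 (T s)) s :=
    fun s hs => (H.contDiffAt_meanKernel hs).continuousAt
  refine eventually_integral_cos_sq_pos
    (G := fun s => meanKernel h l n c00 c02 c11 c20 (T s)) hR hG ?_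
  have h0 := hG 0 (by simpa using hR)
  have h1 : ContinuousAt (fun s => meanKernel h l n c00 c02 c11 c20 (T (-s))) 0 := by
    refine ContinuousAt.comp (f := fun s : ℝ => -s)
      (g := fun s => meanKernel h l n c00 c02 c11 c20 (T s)) ?_ (by fun_prop)
    simpa using h0
  refine ((continuousAt_const.mul (h0.add h1)).eventually (lt_mem_nhds ?_)).filter_mono
    nhdsWithin_le_nhds
  simp only [Pi.mul_apply, Pi.add_apply, neg_zero, H.apply_zero hR, meanKernel, crossPoly_zero, leadPoly_zero,
    axisPoly_zero, slopePoly_zero, divPoly, Real.sqrt_one]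
  ring_nf
  ring_nf at hc
  exact hc

/-- Order two: with c₀₀ = -c₀₂ the numerator of the kernel is divisible by t. Its linear coefficient
c₁₁ is absorbed by the constant f = c₁₁/2, and `q 0` is half of the combination in `hc`. -/
lemma eventually_meanFun_pos_of_sub (H : IsChart h l n T τ R) (hR : 0 < R) {c : ℝ}
    (h00 : c00 = -c02) (hc : 0 < c * (c20 - (3 * h * c11 + (4 - l) * c02))) :
    ∀ᶠ ρ in 𝓝[>] (0 : ℝ), 0 < c * meanFun h l n c00 c02 c11 c20 T ρ := by
  refine H.eventually_meanFun_pos hR (f := fun _ => c11 / 2) (k := 0)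
    (q := fun t => ((c20 + c02 * (l - 4) - 3 * h * c11) +
      (-8 * h * c02 - l * c11 - c11 * (l - 2 * n)) * t +
      (-c02 * (l ^ 2 - 4 * n) - l * c20 - c11 * l * h) * t ^ 2) / slopePoly h l n t) ?_ ?_ ?_
  · exact ContinuousAt.div (by fun_prop) (contDiff_slopePoly h l n).continuous.continuousAt (by simp)
  · simp only [slopePoly_zero]
    ring_nf
    ring_nf at hc
    linarith
  · intro t ht
    have hK := (H.pos t ht).2.2.ne'
    subst h00
    field_simp
    simp only [leadPoly, divPoly, axisPoly, crossPoly, slopePoly]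
    ring

end IsChart

/-! ### Even coefficients of the kernel of orders four to ten -/

/-- The coefficients of the kernel once its two lowest even terms vanish. -/
def kernelCoeff (h l n c02 c11 : ℝ) : ℝ := -8 * h * c02 - 2 * l * c11 + 2 * n * c11

def kernelCoeff' (h l n c02 c11 : ℝ) : ℝ := 4 * n * c02 - 4 * l * c02 - 4 * h * l * c11

/-- At the critical value of c₂₀, removing the odd contribution c₁₁/2 leaves t² times a linear
polynomial. All higher orders thus depend on c₀₂ and c₁₁ only through its two coefficients. -/
lemma kernel_eq (h l n c02 c11 t : ℝ) :
    -c02 * leadPoly h l n t + divPoly c02 c11 (3 * h * c11 + (4 - l) * c02) t * axisPoly l t =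
      t * (slopePoly h l n t * (c11 / 2) +
        t ^ 2 * (kernelCoeff h l n c02 c11 + kernelCoeff' h l n c02 c11 * t)) := by
  simp only [leadPoly, divPoly, axisPoly, crossPoly, slopePoly, kernelCoeff, kernelCoeff']
  ring

/-- With denominators cleared, this expands t²(1 + 5ht)/K in powers of Y = t²C/u², where K is
`slopePoly`. The factor 5h matches the first-order term, matching t² forces the coefficient of Y²,
and `r 0` is the first obstruction. -/
lemma exists_axisPoly_pow_sub_eq (h l n : ℝ) :
    ∃ r : ℝ → ℝ, Continuous r ∧ r 0 = h * (8 * l - 14 * n + 42 * h ^ 2) ∧ ∀ t,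
      2 * (1 + 5 * h * t) * axisPoly l t ^ 4 - crossPoly h n t * slopePoly h l n t *
        (axisPoly l t ^ 2 + (-3 * l + 3 * n - 6 * h ^ 2) * (t ^ 2 * crossPoly h n t)) = 2 * t ^ 3 * r t := by
  refine ⟨fun t =>
    (8 * h * l - 14 * h * n + 42 * h ^ 3) + (-20 * l * n + 10 * l ^ 2 + 10 * n ^ 2 + 64 * h ^ 2 *
    l - 72 * h ^ 2 * n + 96 * h ^ 4) * t + (-82 * h * l * n + 46 * h * l ^ 2 + 54 * h * n ^ 2 +
    66 * h ^ 3 * l - 144 * h ^ 3 * n + 72 * h ^ 5) * t ^ 2 + (25 * l * n ^ 2 - 5 * l ^ 2 * n - 5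
    * l ^ 3 - 15 * n ^ 3 - 96 * h ^ 2 * l * n + 22 * h ^ 2 * l ^ 2 + 90 * h ^ 2 * n ^ 2 + 48 * h
    ^ 4 * l - 120 * h ^ 4 * n) * t ^ 3 + (51 * h * l * n ^ 2 - 13 * h * l ^ 2 * n - 23 * h * l ^
    3 - 33 * h * n ^ 3 - 48 * h ^ 3 * l * n + 12 * h ^ 3 * l ^ 2 + 66 * h ^ 3 * n ^ 2 + 24 * h ^
    5 * l) * t ^ 4 + (-9 * l * n ^ 3 + l ^ 2 * n ^ 2 + l ^ 3 * n + l ^ 4 + 6 * n ^ 4 + 18 * h ^ 2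
    * l * n ^ 2 - 12 * h ^ 2 * l ^ 2 * n - 2 * h ^ 2 * l ^ 3 - 12 * h ^ 2 * n ^ 3 - 24 * h ^ 4 *
    l * n) * t ^ 5 + (-3 * h * l * n ^ 3 + 3 * h * l ^ 2 * n ^ 2 + h * l ^ 3 * n + 5 * h * l ^ 4
    + 6 * h ^ 3 * l * n ^ 2) * t ^ 6,
    by fun_prop, by ring, fun t => ?_⟩
  simp only [axisPoly, crossPoly, slopePoly]
  ring

/-- The relation l = 7m, n = 3h² + 4m makes the previous obstruction 8l - 14n + 42h² vanish. A Y³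
term can then be matched, and the next obstruction appears at t⁵. -/
lemma exists_axisPoly_pow_sub_eq_of_cubic (h m : ℝ) :
    ∃ r : ℝ → ℝ, Continuous r ∧ r 0 = 12 * h * (m ^ 2 - 30 * h ^ 2 * m + 33 * h ^ 4) ∧ ∀ t,
      2 * (1 + 5 * h * t) * axisPoly (7 * m) t ^ 6 -
        crossPoly h (3 * h ^ 2 + 4 * m) t * slopePoly h (7 * m) (3 * h ^ 2 + 4 * m) t *
        (axisPoly (7 * m) t ^ 4 +
          (3 * h ^ 2 - 9 * m) * (t ^ 2 * crossPoly h (3 * h ^ 2 + 4 * m) t) *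
            axisPoly (7 * m) t ^ 2 +
          (90 * m ^ 2 - 20 * h ^ 2 * m - 30 * h ^ 4) *
            (t ^ 2 * crossPoly h (3 * h ^ 2 + 4 * m) t) ^ 2) = 2 * t ^ 5 * r t := by
  refine ⟨fun t =>
    (12 * h * m ^ 2 - 360 * h ^ 3 * m + 396 * h ^ 5) + (-945 * m ^ 3 - 195 * h ^ 2 * m ^ 2 + 285
    * h ^ 4 * m + 495 * h ^ 6) * t + (-10875 * h * m ^ 3 + 13055 * h ^ 3 * m ^ 2 - 4961 * h ^ 5 *
    m - 1947 * h ^ 7) * t ^ 2 + (13041 * m ^ 4 - 18909 * h ^ 2 * m ^ 3 + 8451 * h ^ 4 * m ^ 2 -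
    2895 * h ^ 6 * m - 3168 * h ^ 8) * t ^ 3 + (132021 * h * m ^ 4 - 100815 * h ^ 3 * m ^ 3 + 365
    * h ^ 5 * m ^ 2 + 24459 * h ^ 7 * m + 5850 * h ^ 9) * t ^ 4 + (-60669 * m ^ 5 + 155421 * h ^
    2 * m ^ 4 + 17451 * h ^ 4 * m ^ 3 - 33215 * h ^ 6 * m ^ 2 + 1302 * h ^ 8 * m + 5670 * h ^ 10)
    * t ^ 5 + (-540723 * h * m ^ 5 + 166695 * h ^ 3 * m ^ 4 + 117585 * h ^ 5 * m ^ 3 - 31077 * h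
    ^ 7 * m ^ 2 - 47250 * h ^ 9 * m - 12150 * h ^ 11) * t ^ 6 + (95229 * m ^ 6 - 305121 * h ^ 2 *
    m ^ 5 - 265911 * h ^ 4 * m ^ 4 - 8145 * h ^ 6 * m ^ 3 + 73818 * h ^ 8 * m ^ 2 + 34830 * h ^
    10 * m + 4860 * h ^ 12) * t ^ 7 + (745185 * h * m ^ 6 + 189805 * h ^ 3 * m ^ 5 + 37527 * h ^
    5 * m ^ 4 - 37611 * h ^ 7 * m ^ 3 - 26460 * h ^ 9 * m ^ 2 - 5670 * h ^ 11 * m) * t ^ 8,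
    by fun_prop, by ring, fun t => ?_⟩
  simp only [axisPoly, crossPoly, slopePoly]
  ring

/-- The t⁵ obstruction vanishes at l = (105 + 56w)h², w = ±√3; here h is scaled to 1. Matching Y⁴
pushes the obstruction to t⁷, and its value is not zero. -/
lemma exists_axisPoly_pow_sub_eq_of_quartic {w : ℝ} (hw : w ^ 2 = 3) :
    ∃ r : ℝ → ℝ, Continuous r ∧ r 0 = 442368 + 253952 * w ∧ ∀ t,
      2 * (1 + 5 * t) * axisPoly (105 + 56 * w) t ^ 8 -
        crossPoly 1 (63 + 32 * w) t * slopePoly 1 (105 + 56 * w) (63 + 32 * w) t *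
        (axisPoly (105 + 56 * w) t ^ 6 +
          (-132 - 72 * w) * (t ^ 2 * crossPoly 1 (63 + 32 * w) t) *
            axisPoly (105 + 56 * w) t ^ 4 +
          (37200 + 21440 * w) * (t ^ 2 * crossPoly 1 (63 + 32 * w) t) ^ 2 *
            axisPoly (105 + 56 * w) t ^ 2 +
          (-11430720 - 6599040 * w) * (t ^ 2 * crossPoly 1 (63 + 32 * w) t) ^ 3) =
      2 * t ^ 7 * r t := by
  refine ⟨fun t =>
    (442368 + 253952 * w) + (3650865408 + 2107815936 * w) * t + (46755378432 + 26994210816 * w) *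
    t ^ 2 + (-1757053197312 - 1014435028992 * w) * t ^ 3 + (-21887509404672 - 12636758827008 * w)
    * t ^ 4 + (324608719670784 + 187412932497408 * w) * t ^ 5 + (3877068194366976 +
    2238426360188928 * w) * t ^ 6 + (-27319846621326336 - 15773120814882816 * w) * t ^ 7 +
    (-308505472704285696 - 178115717683298304 * w) * t ^ 8 + (884336790468079872 +
    510572084082407424 * w) * t ^ 9 + (9309564618288770304 + 5374879638320166912 * w) * t ^ 10,
    by fun_prop, by ring, fun t => ?_⟩
  simp only [axisPoly, crossPoly, slopePoly]
  grind

namespace IsChart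

variable {h l n τ R c00 c02 c11 c20 : ℝ} {T : ℝ → ℝ}

/-- The criterion for the reduced kernel: the constant c₁₁/2 is absorbed into `f`. -/
lemma eventually_meanFun_pos_of_kernelCoeff (H : IsChart h l n T τ R) (hR : 0 < R)
    (h00 : c00 = -c02) (h20 : c20 = 3 * h * c11 + (4 - l) * c02)
    {f q : ℝ → ℝ} {k : ℕ} {c : ℝ} (hq : ContinuousAt q 0) (hc : 0 < c * q 0)
    (hk : ∀ t, 0 < slopePoly h l n t → 0 < axisPoly l t →
      t ^ 2 * (kernelCoeff h l n c02 c11 + kernelCoeff' h l n c02 c11 * t) =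
      slopePoly h l n t *
        (f (t ^ 2 * crossPoly h n t / axisPoly l t ^ 2) + t ^ (2 * k + 1) * q t)) :
    ∀ᶠ ρ in 𝓝[>] (0 : ℝ), 0 < c * meanFun h l n c00 c02 c11 c20 T ρ := by
  refine H.eventually_meanFun_pos hR (f := fun Y => c11 / 2 + f Y) (k := k) hq hc fun t ht => ?_
  obtain ⟨-, hu, hK⟩ := H.pos t ht
  subst h00 h20
  rw [kernel_eq, hk t hK hu]
  ring

/-- Order four: f(Y) = PY/2 removes the t² term, and `q 0` is (Q - 5hP)/2, affine in c₀₂. -/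
lemma eventually_meanFun_pos_of_cubic (H : IsChart h l n T τ R) (hR : 0 < R) {c : ℝ}
    (h00 : c00 = -c02) (h20 : c20 = 3 * h * c11 + (4 - l) * c02)
    (hc : 0 < c * (4 * c02 * (n - l + 10 * h ^ 2) + h * c11 * (6 * l - 10 * n))) :
    ∀ᶠ ρ in 𝓝[>] (0 : ℝ), 0 < c * meanFun h l n c00 c02 c11 c20 T ρ := by
  set P := kernelCoeff h l n c02 c11 with hP
  set Q := kernelCoeff' h l n c02 c11 with hQ
  refine H.eventually_meanFun_pos_of_kernelCoeff hR h00 h20 (f := fun Y => P / 2 * Y) (k := 1)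
    (q := fun t => ((Q - 5 * h * P) + P * (-3 * l + 3 * n - 6 * h ^ 2) * t +
      (-2 * Q * l - 3 * P * h * l + 7 * P * h * n) * t ^ 2 +
      P * (l * n + l ^ 2 - 2 * n ^ 2 - 2 * h ^ 2 * l) * t ^ 3 +
      (Q * l ^ 2 + P * h * l * n) * t ^ 4) / (slopePoly h l n t * axisPoly l t ^ 2)) ?_ ?_ ?_
  · exact ContinuousAt.div (by fun_prop) ((contDiff_slopePoly h l n).continuous.continuousAt.mul
      ((contDiff_axisPoly l).continuous.continuousAt.pow 2)) (by simp)
  · have : Q - 5 * h * P = 4 * c02 * (n - l + 10 * h ^ 2) + h * c11 * (6 * l - 10 * n) := by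
      simp only [hP, hQ, kernelCoeff, kernelCoeff']
      ring
    simp only [this, slopePoly_zero, axisPoly_zero]
    ring_nf
    ring_nf at hc
    linarith
  · intro t hK hu
    rw [← hP, ← hQ]
    clear_value P Q
    field_simp
    simp only [axisPoly, crossPoly, slopePoly]
    ring

/-- Order six: the vanishing of the previous coefficient reads Q = 5hP, so P factors out and the
expansion of t²(1 + 5ht)/K takes over. -/
lemma eventually_meanFun_pos_of_quartic (H : IsChart h l n T τ R) (hR : 0 < R) {c : ℝ}
    (h00 : c00 = -c02) (h20 : c20 = 3 * h * c11 + (4 - l) * c02)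
    (h02 : 4 * c02 * (n - l + 10 * h ^ 2) + h * c11 * (6 * l - 10 * n) = 0)
    (hc : 0 < c * (kernelCoeff h l n c02 c11 * (h * (8 * l - 14 * n + 42 * h ^ 2)))) :
    ∀ᶠ ρ in 𝓝[>] (0 : ℝ), 0 < c * meanFun h l n c00 c02 c11 c20 T ρ := by
  have hQ : kernelCoeff' h l n c02 c11 = 5 * h * kernelCoeff h l n c02 c11 := by
    simp only [kernelCoeff, kernelCoeff']
    linear_combination h02
  set P := kernelCoeff h l n c02 c11 with hP
  obtain ⟨r, hr, hr0, hrt⟩ := exists_axisPoly_pow_sub_eq h l n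
  refine H.eventually_meanFun_pos_of_kernelCoeff hR h00 h20
    (f := fun Y => P / 2 * (Y + (-3 * l + 3 * n - 6 * h ^ 2) * Y ^ 2)) (k := 2)
    (q := fun t => P * r t / (slopePoly h l n t * axisPoly l t ^ 4)) ?_ ?_ ?_
  · exact ContinuousAt.div (by fun_prop) ((contDiff_slopePoly h l n).continuous.continuousAt.mul
      ((contDiff_axisPoly l).continuous.continuousAt.pow 4)) (by simp)
  · simp only [hr0, slopePoly_zero, axisPoly_zero]
    linarith
  · intro t hK hu
    rw [hQ, ← hP]
    clear_value P
    field_simp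
    linear_combination P * t ^ 2 * hrt t

lemma eventually_meanFun_pos_of_quintic (H : IsChart h l n T τ R) (hR : 0 < R) {c : ℝ}
    (h00 : c00 = -c02) (h20 : c20 = 3 * h * c11 + (4 - l) * c02)
    (h02 : 4 * c02 * (n - l + 10 * h ^ 2) + h * c11 * (6 * l - 10 * n) = 0)
    (hn : n = 3 * h ^ 2 + 4 * l / 7)
    (hc : 0 < c * (kernelCoeff h l n c02 c11 *
      (h * (l ^ 2 - 210 * h ^ 2 * l + 1617 * h ^ 4)))) :
    ∀ᶠ ρ in 𝓝[>] (0 : ℝ), 0 < c * meanFun h l n c00 c02 c11 c20 T ρ := by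
  obtain ⟨m, rfl⟩ : ∃ m, l = 7 * m := ⟨l / 7, by ring⟩
  obtain rfl : n = 3 * h ^ 2 + 4 * m := by rw [hn]; ring
  have hQ : kernelCoeff' h (7 * m) (3 * h ^ 2 + 4 * m) c02 c11 =
      5 * h * kernelCoeff h (7 * m) (3 * h ^ 2 + 4 * m) c02 c11 := by
    simp only [kernelCoeff, kernelCoeff']
    linear_combination h02
  set P := kernelCoeff h (7 * m) (3 * h ^ 2 + 4 * m) c02 c11 with hP
  obtain ⟨r, hr, hr0, hrt⟩ := exists_axisPoly_pow_sub_eq_of_cubic h m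
  refine H.eventually_meanFun_pos_of_kernelCoeff hR h00 h20
    (f := fun Y => P / 2 * (Y + (3 * h ^ 2 - 9 * m) * Y ^ 2 +
      (90 * m ^ 2 - 20 * h ^ 2 * m - 30 * h ^ 4) * Y ^ 3)) (k := 3)
    (q := fun t => P * r t / (slopePoly h (7 * m) (3 * h ^ 2 + 4 * m) t * axisPoly (7 * m) t ^ 6))
    ?_ ?_ ?_
  · exact ContinuousAt.div (by fun_prop) ((contDiff_slopePoly _ _ _).continuous.continuousAt.mul
      ((contDiff_axisPoly _).continuous.continuousAt.pow 6)) (by simp)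
  · simp only [hr0, slopePoly_zero, axisPoly_zero]
    have : c * (P * (h * ((7 * m) ^ 2 - 210 * h ^ 2 * (7 * m) + 1617 * h ^ 4))) =
      49 * (c * (P * (h * (m ^ 2 - 30 * h ^ 2 * m + 33 * h ^ 4)))) := by ring
    linarith
  · intro t hK hu
    have h1 := hrt t
    rw [hQ, ← hP]
    generalize axisPoly (7 * m) t = u at *
    generalize slopePoly h (7 * m) (3 * h ^ 2 + 4 * m) t = K at *
    generalize crossPoly h (3 * h ^ 2 + 4 * m) t = C at *
    clear_value P
    field_simp
    linear_combination P * t ^ 2 * h1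

lemma eventually_meanFun_pos_of_sextic {w : ℝ} (hw : w ^ 2 = 3)
    (H : IsChart h ((105 + 56 * w) * h ^ 2) ((63 + 32 * w) * h ^ 2) T τ R) (hR : 0 < R) {c : ℝ}
    (h00 : c00 = -c02) (h20 : c20 = 3 * h * c11 + (4 - (105 + 56 * w) * h ^ 2) * c02)
    (h02 : 4 * c02 * ((63 + 32 * w) * h ^ 2 - (105 + 56 * w) * h ^ 2 + 10 * h ^ 2) +
      h * c11 * (6 * ((105 + 56 * w) * h ^ 2) - 10 * ((63 + 32 * w) * h ^ 2)) = 0)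
    (hc : 0 < c * (kernelCoeff h ((105 + 56 * w) * h ^ 2) ((63 + 32 * w) * h ^ 2) c02 c11 *
      (h ^ 7 * (442368 + 253952 * w)))) :
    ∀ᶠ ρ in 𝓝[>] (0 : ℝ), 0 < c * meanFun h ((105 + 56 * w) * h ^ 2) ((63 + 32 * w) * h ^ 2)
      c00 c02 c11 c20 T ρ := by
  set l := (105 + 56 * w) * h ^ 2 with hl
  set n := (63 + 32 * w) * h ^ 2 with hn
  have hQ : kernelCoeff' h l n c02 c11 = 5 * h * kernelCoeff h l n c02 c11 := by
    simp only [kernelCoeff, kernelCoeff']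
    linear_combination h02
  set P := kernelCoeff h l n c02 c11 with hP
  obtain ⟨r, hr, hr0, hrt⟩ := exists_axisPoly_pow_sub_eq_of_quartic hw
  -- As l and n are multiples of h², the substitution t ↦ ht reduces to h = 1; this is the origin of
  -- the factor h⁷.
  have eu : ∀ t, axisPoly (105 + 56 * w) (h * t) = axisPoly l t := fun t => by
    simp only [axisPoly, hl]; ring
  have eC : ∀ t, crossPoly 1 (63 + 32 * w) (h * t) = crossPoly h n t := fun t => by
    simp only [crossPoly, hn]; ring
  have eK : ∀ t, slopePoly 1 (105 + 56 * w) (63 + 32 * w) (h * t) = slopePoly h l n t := fun t => by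
    simp only [slopePoly, hl, hn]; ring
  refine H.eventually_meanFun_pos_of_kernelCoeff hR h00 h20
    (f := fun Y => P / 2 * (Y + (-132 - 72 * w) * h ^ 2 * Y ^ 2 +
      (37200 + 21440 * w) * h ^ 4 * Y ^ 3 + (-11430720 - 6599040 * w) * h ^ 6 * Y ^ 4)) (k := 4)
    (q := fun t => P * (h ^ 7 * r (h * t)) / (slopePoly h l n t * axisPoly l t ^ 8)) ?_ ?_ ?_
  · exact ContinuousAt.div (by fun_prop) ((contDiff_slopePoly _ _ _).continuous.continuousAt.mul
      ((contDiff_axisPoly _).continuous.continuousAt.pow 8)) (by simp)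
  · simp only [mul_zero, hr0, slopePoly_zero, axisPoly_zero]
    linarith
  · intro t hK hu
    have h1 := hrt (h * t)
    rw [eu, eC, eK] at h1
    rw [hQ, ← hP]
    generalize r (h * t) = r₀ at *
    clear_value P l n
    field_simp
    linear_combination P * t ^ 2 * h1

end IsChart

/-! ### Sign changes created by successive perturbations -/

/-- `f` takes values of alternating sign at `m + 1` decreasing points of `(0, R)`. -/
def Alternates (f : ℝ → ℝ) (R σ : ℝ) (m : ℕ) : Prop :=
  ∃ x : ℕ → ℝ, (∀ i ≤ m, x i ∈ Ioo 0 R ∧ 0 < σ * (-1) ^ i * f (x i)) ∧ ∀ i < m, x (i + 1) < x i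

/-- Strict signs at finitely many fixed points survive a small change of θ, while the new sign near
0 supplies one more point below the last one. -/
lemma Alternates.frequently_succ {E : Type*} [TopologicalSpace E] {N : E → ℝ → ℝ} {R σ : ℝ} {m : ℕ}
    {θ : E} (hR : 0 < R) (hN : ∀ ρ ∈ Ioo 0 R, ContinuousAt (fun θ => N θ ρ) θ)
    (ha : Alternates (N θ) R σ m) {P : E → Prop}
    (h : ∃ᶠ θ' in 𝓝 θ, P θ' ∧ ∀ᶠ ρ in 𝓝[>] (0 : ℝ), 0 < σ * (-1) ^ (m + 1) * N θ' ρ) :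
    ∃ᶠ θ' in 𝓝 θ, P θ' ∧ Alternates (N θ') R σ (m + 1) := by
  obtain ⟨x, hx, hlt⟩ := ha
  have hev : ∀ᶠ θ' in 𝓝 θ, ∀ i ∈ Finset.range (m + 1), 0 < σ * (-1) ^ i * N θ' (x i) := by
    rw [Filter.eventually_all_finset]
    intro i hi
    have hi' := hx i (by simpa [Nat.lt_succ_iff] using hi)
    exact (continuousAt_const.mul (hN _ hi'.1)).eventually (lt_mem_nhds hi'.2)
  refine (h.and_eventually hev).mono ?_
  rintro θ' ⟨⟨hP, hsmall⟩, hsign⟩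
  refine ⟨hP, ?_⟩
  have hxm : 0 < x m := (hx m le_rfl).1.1
  obtain ⟨y, hy, hyI⟩ := (hsmall.and (Ioo_mem_nhdsGT (lt_min hxm hR))).exists
  refine ⟨fun i => if i ≤ m then x i else y, fun i hi => ?_, fun i hi => ?_⟩
  · rcases Nat.lt_or_ge m i with h1 | h1
    · obtain rfl : i = m + 1 := by omega
      simp only [if_neg (not_le.2 h1)]
      exact ⟨⟨hyI.1, hyI.2.trans_le (min_le_right _ _)⟩, hy⟩
    · simp only [if_pos h1]
      exact ⟨(hx i h1).1, hsign i (by simpa [Nat.lt_succ_iff] using h1)⟩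
  · rcases Nat.lt_or_ge i m with h1 | h1
    · simpa only [if_pos h1.le, if_pos (Nat.succ_le_of_lt h1)] using hlt i h1
    · obtain rfl : i = m := by omega
      simpa using hyI.2.trans_le (min_le_left _ _)

/-- A quantity with a simple zero at `x₀` takes either sign arbitrarily close to it; moving to the
appropriate side gives the sign of κ. -/
lemma frequently_mul_sub_pos {k : ℝ → ℝ} {x₀ κ : ℝ} (hk : ContinuousAt k x₀) (hk0 : k x₀ ≠ 0)
    (hκ : κ ≠ 0) : ∃ᶠ x in 𝓝 x₀, 0 < κ * ((x - x₀) * k x) := by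
  have hc : ContinuousAt (fun x => κ * k x₀ * (κ * k x)) x₀ :=
    continuousAt_const.mul (continuousAt_const.mul hk)
  have hne : κ * k x₀ ≠ 0 := mul_ne_zero hκ hk0
  have hev : ∀ᶠ x in 𝓝 x₀, 0 < κ * k x₀ * (κ * k x) :=
    hc.eventually (lt_mem_nhds (mul_self_pos.2 hne))
  have hlim : Tendsto (fun t => x₀ + t * (κ * k x₀)) (𝓝[>] 0) (𝓝 x₀) := by
    have : ContinuousAt (fun t => x₀ + t * (κ * k x₀)) 0 := by fun_prop
    simpa using this.tendsto.mono_left nhdsWithin_le_nhds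
  refine hlim.frequently (((hlim.eventually hev).and self_mem_nhdsWithin).frequently.mono ?_)
  rintro t ⟨h1, h2⟩
  have h2' : 0 < t := h2
  have : κ * ((x₀ + t * (κ * k x₀) - x₀) * k (x₀ + t * (κ * k x₀))) =
    t * (κ * k x₀ * (κ * k (x₀ + t * (κ * k x₀)))) := by ring
  rw [this]
  exact mul_pos h2' h1

/-- The averaged function with parameters `θ = (l, n, c₀₂, c₂₀, c₀₀)`. -/
noncomputable def meanParam (h c11 : ℝ) (T : ℝ × ℝ × ℝ → ℝ) (θ : ℝ × ℝ × ℝ × ℝ × ℝ) (ρ : ℝ) : ℝ :=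
  meanFun h θ.1 θ.2.1 θ.2.2.2.2 θ.2.2.1 c11 θ.2.2.2.1 (fun s => T (s, θ.1, θ.2.1)) ρ

lemma continuousAt_meanKernel (h c11 : ℝ) {θ : ℝ × ℝ × ℝ × ℝ × ℝ} {t : ℝ}
    (hne : slopePoly h θ.1 θ.2.1 t * axisPoly θ.1 t ≠ 0) :
    ContinuousAt (fun p : (ℝ × ℝ × ℝ × ℝ × ℝ) × ℝ =>
      meanKernel h p.1.1 p.1.2.1 p.1.2.2.2.2 p.1.2.2.1 c11 p.1.2.2.2.1 p.2) (θ, t) := by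
  unfold meanKernel
  refine ContinuousAt.div ?_ ?_ hne
  · unfold crossPoly leadPoly divPoly axisPoly crossPoly
    fun_prop
  · unfold slopePoly axisPoly
    fun_prop

/-- A family of charts on a common domain, for parameters near `(l₀, n₀)`. -/
def IsChartFamily (h l₀ n₀ : ℝ) (T : ℝ × ℝ × ℝ → ℝ) (τ R ω : ℝ) : Prop :=
  ∀ l n, |l - l₀| < ω → |n - n₀| < ω →
    IsChart h l n (fun s => T (s, l, n)) τ R ∧ ∀ s, |s| < R → ContinuousAt T (s, l, n)

lemma IsChartFamily.continuousAt_meanParam {h l₀ n₀ τ R ω : ℝ} {T : ℝ × ℝ × ℝ → ℝ}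
    (H : IsChartFamily h l₀ n₀ T τ R ω) (c11 : ℝ) {θ : ℝ × ℝ × ℝ × ℝ × ℝ} (h1 : |θ.1 - l₀| < ω)
    (h2 : |θ.2.1 - n₀| < ω) {ρ : ℝ} (hρ : ρ ∈ Ioo 0 R) :
    ContinuousAt (fun θ => meanParam h c11 T θ ρ) θ := by
  have hjoint : ∀ θ : ℝ × ℝ × ℝ × ℝ × ℝ, |θ.1 - l₀| < ω → |θ.2.1 - n₀| < ω → ∀ φ : ℝ,
      ContinuousAt (fun p : (ℝ × ℝ × ℝ × ℝ × ℝ) × ℝ => Real.cos p.2 ^ 2 *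
        meanKernel h p.1.1 p.1.2.1 p.1.2.2.2.2 p.1.2.2.1 c11 p.1.2.2.2.1
          (T (ρ * Real.sin p.2, p.1.1, p.1.2.1))) (θ, φ) := fun θ h1 h2 φ => by
    obtain ⟨hch, hT⟩ := H _ _ h1 h2
    have hs : |ρ * Real.sin φ| < R := abs_mul_sin_lt hρ.1.le hρ.2
    obtain ⟨-, hu, hK⟩ := hch.pos _ (hch.mem _ hs)
    have c1 : ContinuousAt (fun p : (ℝ × ℝ × ℝ × ℝ × ℝ) × ℝ =>
        T (ρ * Real.sin p.2, p.1.1, p.1.2.1)) (θ, φ) :=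
      ContinuousAt.comp (f := fun p : (ℝ × ℝ × ℝ × ℝ × ℝ) × ℝ =>
        (ρ * Real.sin p.2, p.1.1, p.1.2.1)) (g := T) (hT _ hs) (by fun_prop)
    have c2 := ContinuousAt.comp (f := fun p : (ℝ × ℝ × ℝ × ℝ × ℝ) × ℝ =>
        (p.1, T (ρ * Real.sin p.2, p.1.1, p.1.2.1))) (x := (θ, φ))
      (continuousAt_meanKernel h c11 (mul_pos hK hu).ne') (continuousAt_fst.prodMk c1)
    have c3 : ContinuousAt (fun p : (ℝ × ℝ × ℝ × ℝ × ℝ) × ℝ => Real.cos p.2 ^ 2) (θ, φ) := by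
      fun_prop
    exact c3.mul c2
  have hev : ∀ᶠ θ' : ℝ × ℝ × ℝ × ℝ × ℝ in 𝓝 θ, |θ'.1 - l₀| < ω ∧ |θ'.2.1 - n₀| < ω :=
    ((by fun_prop : ContinuousAt (fun θ' : ℝ × ℝ × ℝ × ℝ × ℝ => |θ'.1 - l₀|) θ).eventually
      (gt_mem_nhds h1)).and
    ((by fun_prop : ContinuousAt (fun θ' : ℝ × ℝ × ℝ × ℝ × ℝ => |θ'.2.1 - n₀|) θ).eventually
      (gt_mem_nhds h2))
  refine continuousAt_intervalIntegral_param (F := fun (θ : ℝ × ℝ × ℝ × ℝ × ℝ) φ =>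
    Real.cos φ ^ 2 * meanKernel h θ.1 θ.2.1 θ.2.2.2.2 θ.2.2.1 c11 θ.2.2.2.1
      (T (ρ * Real.sin φ, θ.1, θ.2.1))) (fun φ _ => hjoint θ h1 h2 φ) ?_
  filter_upwards [hev] with θ' hθ'
  exact continuous_iff_continuousAt.2 fun φ =>
    ContinuousAt.comp (f := fun φ : ℝ => (θ', φ)) (hjoint θ' hθ'.1 hθ'.2 φ) (by fun_prop)

/-- Solution of `4 c₀₂ (n - l + 10 h²) + h c₁₁ (6 l - 10 n) = 0` for `c₀₂`. -/
noncomputable def solveC02 (h c11 l n : ℝ) : ℝ :=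
  h * c11 * (10 * n - 6 * l) / (4 * (n - l + 10 * h ^ 2))

lemma solveC02_eq {h c11 l n c02 : ℝ} (hD : n - l + 10 * h ^ 2 ≠ 0) :
    4 * c02 * (n - l + 10 * h ^ 2) + h * c11 * (6 * l - 10 * n) = 0 ↔ c02 = solveC02 h c11 l n := by
  rw [solveC02, eq_div_iff (by simpa using hD)]
  constructor <;> intro h1 <;> linear_combination h1

/-- The norm (a + bw)(a - bw) = a² - 3b² handles w = √3 and w = -√3 together. -/
lemma add_mul_ne_zero_of_sq_eq_three {w : ℝ} (hw : w ^ 2 = 3) {a b : ℝ} (hab : a ^ 2 ≠ 3 * b ^ 2) :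
    a + b * w ≠ 0 := fun h0 => hab (by linear_combination (a - b * w) * h0 + b ^ 2 * hw)

/-- From the point where only order ten survives, l moves first along n = 3h² + 4l/7, then n, then
c₀₂, c₂₀ and c₀₀. At each move the dependent parameters follow, so that all lower orders remain zero
and exactly the next one acquires a chosen sign. -/
lemma frequently_alternates {h c11 w c02 τ R ω : ℝ} {T : ℝ × ℝ × ℝ → ℝ} (hw : w ^ 2 = 3)
    (hh : h ≠ 0) (hc11 : c11 ≠ 0) (hR : 0 < R) (hω : 0 < ω)
    (H : IsChartFamily h ((105 + 56 * w) * h ^ 2) ((63 + 32 * w) * h ^ 2) T τ R ω)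
    (hc02 : c02 = solveC02 h c11 ((105 + 56 * w) * h ^ 2) ((63 + 32 * w) * h ^ 2)) :
    ∃ σ : ℝ, ∃ᶠ θ in 𝓝 ((105 + 56 * w) * h ^ 2, (63 + 32 * w) * h ^ 2, c02,
      3 * h * c11 + (4 - (105 + 56 * w) * h ^ 2) * c02, -c02),
      (|θ.1 - (105 + 56 * w) * h ^ 2| < ω ∧ |θ.2.1 - (63 + 32 * w) * h ^ 2| < ω) ∧
        Alternates (meanParam h c11 T θ) R σ 5 := by
  set l₀ := (105 + 56 * w) * h ^ 2 with hl₀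
  set n₀ := (63 + 32 * w) * h ^ 2 with hn₀
  set θ₀ : ℝ × ℝ × ℝ × ℝ × ℝ := (l₀, n₀, c02, 3 * h * c11 + (4 - l₀) * c02, -c02) with hθ₀
  have hD₀ : n₀ - l₀ + 10 * h ^ 2 ≠ 0 := by
    have : n₀ - l₀ + 10 * h ^ 2 = (-32 + -24 * w) * h ^ 2 := by rw [hl₀, hn₀]; ring
    rw [this]
    exact mul_ne_zero (add_mul_ne_zero_of_sq_eq_three hw (by norm_num)) (pow_ne_zero 2 hh)
  have hc02' := (solveC02_eq hD₀).2 hc02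
  -- If P vanished, eliminating c₀₂ would give (768 + 448w)h³c₁₁ = 0.
  have hP₀ : kernelCoeff h l₀ n₀ c02 c11 ≠ 0 := fun h0 => by
    have h1 : (768 + 448 * w) * (h ^ 3 * c11) = 0 := by
      simp only [kernelCoeff, hl₀, hn₀] at h0 hc02'
      linear_combination (-(4 + 3 * w) * h) * h0 + (1 / 4) * hc02' +
        (-(144 * h ^ 3 * c11)) * hw
    exact mul_ne_zero (add_mul_ne_zero_of_sq_eq_three hw (by norm_num))
      (mul_ne_zero (pow_ne_zero 3 hh) hc11) h1
  set q₀ := kernelCoeff h l₀ n₀ c02 c11 * (h ^ 7 * (442368 + 253952 * w)) with hq₀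
  have hq₀' : q₀ ≠ 0 := mul_ne_zero hP₀ (mul_ne_zero (pow_ne_zero 7 hh)
    (add_mul_ne_zero_of_sq_eq_three hw (by norm_num)))
  set U : Set (ℝ × ℝ × ℝ × ℝ × ℝ) := {θ | |θ.1 - l₀| < ω ∧ |θ.2.1 - n₀| < ω} with hU
  have hUo : IsOpen U := by
    rw [hU, ofPred_and]
    exact (isOpen_lt (by fun_prop) (by fun_prop)).inter (isOpen_lt (by fun_prop) (by fun_prop))
  have hθ₀U : θ₀ ∈ U := by simp [hU, hθ₀, hω]
  have hstart : Alternates (meanParam h c11 T θ₀) R q₀ 0 := by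
    have h1 := (H l₀ n₀ (by simpa using hω) (by simpa using hω)).1
    have h2 := h1.eventually_meanFun_pos_of_sextic (c := q₀) (c00 := -c02) (c02 := c02) (c11 := c11)
      (c20 := 3 * h * c11 + (4 - l₀) * c02) hw hR rfl rfl hc02' (mul_self_pos.2 hq₀')
    obtain ⟨y, hy, hyI⟩ := (h2.and (Ioo_mem_nhdsGT hR)).exists
    refine ⟨fun _ => y, fun i hi => ⟨hyI, ?_⟩, by simp⟩
    rw [Nat.le_zero.1 hi, pow_zero, mul_one]
    exact hy
  -- Successive perturbations compose because points frequent near points frequent near `θ₀` are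
  -- frequent near `θ₀`; no sizes need to be tracked.
  have step : ∀ (m : ℕ) (P P' : ℝ × ℝ × ℝ × ℝ × ℝ → Prop), (∀ θ, P θ → θ ∈ U) →
      (∃ᶠ θ in 𝓝 θ₀, P θ ∧ Alternates (meanParam h c11 T θ) R q₀ m) →
      (∀ θ, P θ → ∀ κ : ℝ, κ ≠ 0 → ∃ᶠ θ' in 𝓝 θ, P' θ' ∧
        ∀ᶠ ρ in 𝓝[>] (0 : ℝ), 0 < κ * meanParam h c11 T θ' ρ) →
      ∃ᶠ θ in 𝓝 θ₀, P' θ ∧ Alternates (meanParam h c11 T θ) R q₀ (m + 1) := by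
    intro m P P' hPU hm hP'
    refine frequently_frequently_nhds.1 (hm.mono ?_)
    rintro θ ⟨hθ, ha⟩
    have hθU := hPU θ hθ
    refine ha.frequently_succ hR (fun ρ hρ => H.continuousAt_meanParam c11 hθU.1 hθU.2 hρ) ?_
    exact hP' θ hθ _ (mul_ne_zero hq₀' (by simp))
  have hchart : ∀ θ ∈ U, IsChart h θ.1 θ.2.1 (fun s => T (s, θ.1, θ.2.1)) τ R := fun θ hθ =>
    (H _ _ hθ.1 hθ.2).1
  -- The predicates record the equations still imposed, together with the inequalities that keep
  -- later coefficients movable; each step drops one equation.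
  have hA1 := step 0 (fun θ => θ = θ₀)
    (fun θ => θ ∈ U ∧ θ.2.1 - θ.1 + 10 * h ^ 2 ≠ 0 ∧ kernelCoeff h θ.1 θ.2.1 θ.2.2.1 c11 ≠ 0 ∧
      θ.2.1 = 3 * h ^ 2 + 4 * θ.1 / 7 ∧ θ.2.2.1 = solveC02 h c11 θ.1 θ.2.1 ∧
      θ.2.2.2.1 = 3 * h * c11 + (4 - θ.1) * θ.2.2.1 ∧ θ.2.2.2.2 = -θ.2.2.1)
    (fun θ hθ => hθ ▸ hθ₀U) (fun hcon => hcon.self_of_nhds ⟨rfl, hstart⟩) ?_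
  have hA2 := step 1 _
    (fun θ => θ ∈ U ∧ θ.2.1 - θ.1 + 10 * h ^ 2 ≠ 0 ∧ θ.2.2.1 = solveC02 h c11 θ.1 θ.2.1 ∧
      θ.2.2.2.1 = 3 * h * c11 + (4 - θ.1) * θ.2.2.1 ∧ θ.2.2.2.2 = -θ.2.2.1)
    (fun θ hθ => hθ.1) hA1 ?_
  have hA3 := step 2 _
    (fun θ => θ ∈ U ∧ θ.2.2.2.1 = 3 * h * c11 + (4 - θ.1) * θ.2.2.1 ∧ θ.2.2.2.2 = -θ.2.2.1)
    (fun θ hθ => hθ.1) hA2 ?_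
  have hA4 := step 3 _ (fun θ => θ ∈ U ∧ θ.2.2.2.2 = -θ.2.2.1) (fun θ hθ => hθ.1) hA3 ?_
  have hA5 := step 4 _ (fun θ => θ ∈ U) (fun θ hθ => hθ.1) hA4 ?_
  · exact ⟨q₀, hA5⟩
  · rintro ⟨l, n, c02, c20, c00⟩ ⟨hθU, h00⟩ κ hκ
    have h00 : c00 = -c02 := h00
    have hγ : ContinuousAt (fun x : ℝ => (l, n, c02, c20, x)) c00 := by fun_prop
    refine hγ.tendsto.frequently (((frequently_mul_sub_pos (k := fun _ => 1) (x₀ := c00)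
      continuousAt_const one_ne_zero hκ).and_eventually
      (hγ.eventually (hUo.mem_nhds hθU))).mono ?_)
    rintro x ⟨hx, hxU⟩
    refine ⟨hxU, (hchart _ hxU).eventually_meanFun_pos_of_add hR ?_⟩
    simpa [h00] using hx
  · rintro ⟨l, n, c02, c20, c00⟩ ⟨hθU, h20, h00⟩ κ hκ
    have h20 : c20 = 3 * h * c11 + (4 - l) * c02 := h20
    have hγ : ContinuousAt (fun x : ℝ => (l, n, c02, x, c00)) c20 := by fun_prop
    refine hγ.tendsto.frequently (((frequently_mul_sub_pos (k := fun _ => 1) (x₀ := c20)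
      continuousAt_const one_ne_zero hκ).and_eventually
      (hγ.eventually (hUo.mem_nhds hθU))).mono ?_)
    rintro x ⟨hx, hxU⟩
    refine ⟨⟨hxU, h00⟩, (hchart _ hxU).eventually_meanFun_pos_of_sub hR h00 ?_⟩
    simpa [h20] using hx
  · rintro ⟨l, n, c02, c20, c00⟩ ⟨hθU, hD, h02, h20, h00⟩ κ hκ
    have h02 := (solveC02_eq hD).2 h02
    obtain rfl : c20 = 3 * h * c11 + (4 - l) * c02 := h20
    obtain rfl : c00 = -c02 := h00
    have hγ : ContinuousAt (fun x : ℝ => (l, n, x, 3 * h * c11 + (4 - l) * x, -x)) c02 := by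
      fun_prop
    refine hγ.tendsto.frequently (((frequently_mul_sub_pos
      (k := fun _ => 4 * (n - l + 10 * h ^ 2)) (x₀ := c02)
      continuousAt_const (mul_ne_zero four_ne_zero hD) hκ).and_eventually
      (hγ.eventually (hUo.mem_nhds hθU))).mono ?_)
    rintro x ⟨hx, hxU⟩
    refine ⟨⟨hxU, rfl, rfl⟩, (hchart _ hxU).eventually_meanFun_pos_of_cubic hR rfl rfl ?_⟩
    convert hx using 2
    linear_combination h02
  · rintro ⟨l, n, c02, c20, c00⟩ ⟨hθU, hD, hP, hn, h02, h20, h00⟩ κ hκ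
    have hD : n - l + 10 * h ^ 2 ≠ 0 := hD
    have hn : n = 3 * h ^ 2 + 4 * l / 7 := hn
    obtain rfl : c02 = solveC02 h c11 l n := h02
    obtain rfl : c20 = 3 * h * c11 + (4 - l) * solveC02 h c11 l n := h20
    obtain rfl : c00 = -solveC02 h c11 l n := h00
    have hs : ContinuousAt (fun x => solveC02 h c11 l x) n := by
      unfold solveC02
      exact ContinuousAt.div (by fun_prop) (by fun_prop) (by simpa using hD)
    have hγ : ContinuousAt (fun x : ℝ => (l, x, solveC02 h c11 l x,
      3 * h * c11 + (4 - l) * solveC02 h c11 l x, -solveC02 h c11 l x)) n := by fun_prop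
    -- Since n = 3h² + 4l/7, the order-six factor 8l - 14x + 42h² equals -14(x - n).
    have hk : ContinuousAt (fun x => kernelCoeff h l x (solveC02 h c11 l x) c11 * (h * -14)) n := by
      unfold kernelCoeff
      fun_prop
    have hDx : ∀ᶠ x in 𝓝 n, x - l + 10 * h ^ 2 ≠ 0 :=
      (by fun_prop : ContinuousAt (fun x => x - l + 10 * h ^ 2) n).eventually_ne hD
    refine hγ.tendsto.frequently (((frequently_mul_sub_pos hk
      (mul_ne_zero hP (mul_ne_zero hh (by norm_num))) hκ).and_eventually
      ((hγ.eventually (hUo.mem_nhds hθU)).and hDx)).mono ?_)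
    rintro x ⟨hx, hxU, hxD⟩
    refine ⟨⟨hxU, hxD, rfl, rfl, rfl⟩, (hchart _ hxU).eventually_meanFun_pos_of_quartic hR rfl rfl
      ((solveC02_eq hxD).2 rfl) ?_⟩
    convert hx using 2
    linear_combination (-14 * kernelCoeff h l x (solveC02 h c11 l x) c11 * h) * hn
  · rintro _ rfl κ hκ
    have hn₀' : n₀ = 3 * h ^ 2 + 4 * l₀ / 7 := by rw [hl₀, hn₀]; ring
    have hs : ContinuousAt (fun x => solveC02 h c11 x (3 * h ^ 2 + 4 * x / 7)) l₀ := by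
      unfold solveC02
      refine ContinuousAt.div (by fun_prop) (by fun_prop) ?_
      rw [← hn₀']
      simpa using hD₀
    have hγ : Tendsto (fun x : ℝ => (x, 3 * h ^ 2 + 4 * x / 7,
        solveC02 h c11 x (3 * h ^ 2 + 4 * x / 7),
        3 * h * c11 + (4 - x) * solveC02 h c11 x (3 * h ^ 2 + 4 * x / 7),
        -solveC02 h c11 x (3 * h ^ 2 + 4 * x / 7))) (𝓝 l₀) (𝓝 θ₀) := by
      have : ContinuousAt (fun x : ℝ => (x, 3 * h ^ 2 + 4 * x / 7,
        solveC02 h c11 x (3 * h ^ 2 + 4 * x / 7),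
        3 * h * c11 + (4 - x) * solveC02 h c11 x (3 * h ^ 2 + 4 * x / 7),
        -solveC02 h c11 x (3 * h ^ 2 + 4 * x / 7))) l₀ := by fun_prop
      rwa [ContinuousAt, ← hn₀', ← hc02] at this
    have hP : ContinuousAt (fun x => kernelCoeff h x (3 * h ^ 2 + 4 * x / 7)
        (solveC02 h c11 x (3 * h ^ 2 + 4 * x / 7)) c11) l₀ := by
      unfold kernelCoeff
      fun_prop
    have hP' : kernelCoeff h l₀ (3 * h ^ 2 + 4 * l₀ / 7)
        (solveC02 h c11 l₀ (3 * h ^ 2 + 4 * l₀ / 7)) c11 ≠ 0 := by rwa [← hn₀', ← hc02]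
    have hDx : ∀ᶠ x in 𝓝 l₀, 3 * h ^ 2 + 4 * x / 7 - x + 10 * h ^ 2 ≠ 0 :=
      (by fun_prop : ContinuousAt (fun x => 3 * h ^ 2 + 4 * x / 7 - x + 10 * h ^ 2) l₀).eventually_ne
        (by rwa [← hn₀'])
    -- x² - 210h²x + 1617h⁴ = (x - l₀)(x + l₀ - 210h²), and the cofactor at l₀ is 112wh² ≠ 0.
    have hk : ContinuousAt (fun x => kernelCoeff h x (3 * h ^ 2 + 4 * x / 7)
        (solveC02 h c11 x (3 * h ^ 2 + 4 * x / 7)) c11 * (h * (x + l₀ - 210 * h ^ 2))) l₀ :=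
      hP.mul (by fun_prop)
    have hw0 : l₀ + l₀ - 210 * h ^ 2 ≠ 0 := by
      have : l₀ + l₀ - 210 * h ^ 2 = (0 + 112 * w) * h ^ 2 := by rw [hl₀]; ring
      rw [this]
      exact mul_ne_zero (add_mul_ne_zero_of_sq_eq_three hw (by norm_num)) (pow_ne_zero 2 hh)
    refine hγ.frequently (((frequently_mul_sub_pos hk
      (mul_ne_zero hP' (mul_ne_zero hh hw0)) hκ).and_eventually
      ((hγ.eventually (hUo.mem_nhds hθ₀U)).and (hDx.and (hP.eventually_ne hP')))).mono ?_)
    rintro x ⟨hx, hxU, hxD, hxP⟩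
    refine ⟨⟨hxU, hxD, hxP, rfl, rfl, rfl, rfl⟩,
      (hchart _ hxU).eventually_meanFun_pos_of_quintic hR rfl rfl
      ((solveC02_eq hxD).2 rfl) rfl ?_⟩
    convert hx using 2
    have : l₀ ^ 2 - 210 * h ^ 2 * l₀ + 1617 * h ^ 4 = 0 := by
      rw [hl₀]
      linear_combination 3136 * h ^ 4 * hw
    linear_combination (kernelCoeff h x (3 * h ^ 2 + 4 * x / 7)
      (solveC02 h c11 x (3 * h ^ 2 + 4 * x / 7)) c11 * h) * this

/-! ### Simple zeros and limit cycles -/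

lemma IsChart.intervalIntegrable_meanKernel {h l n τ R : ℝ} {T : ℝ → ℝ}
    (H : IsChart h l n T τ R) (c00 c02 c11 c20 : ℝ) {ρ : ℝ} (hρ : ρ ∈ Ioo 0 R) :
    IntervalIntegrable (fun φ => Real.cos φ ^ 2 *
      meanKernel h l n c00 c02 c11 c20 (T (ρ * Real.sin φ))) volume 0 (2 * Real.pi) := by
  refine Continuous.intervalIntegrable (continuous_iff_continuousAt.2 fun φ => ?_) _ _
  have h1 := ContinuousAt.comp (f := fun φ => ρ * Real.sin φ) (x := φ)
    (H.contDiffAt_meanKernel (c00 := c00) (c02 := c02) (c11 := c11) (c20 := c20)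
      (abs_mul_sin_lt hρ.1.le hρ.2)).continuousAt (by fun_prop)
  have h2 : ContinuousAt (fun φ => Real.cos φ ^ 2) φ := by fun_prop
  exact h2.mul h1

/-- The averaged function is affine in c₀₀; its slope is positive by `IsChart.meanFun_pos`, so c₀₀
can serve as the parameter that makes zeros simple. -/
lemma IsChart.meanFun_eq_add {h l n τ R : ℝ} {T : ℝ → ℝ} (H : IsChart h l n T τ R)
    (c00 c02 c11 c20 : ℝ) {ρ : ℝ} (hρ : ρ ∈ Ioo 0 R) :
    meanFun h l n c00 c02 c11 c20 T ρ =
      c00 * meanFun h l n 1 0 0 0 T ρ + meanFun h l n 0 c02 c11 c20 T ρ := by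
  simp only [meanFun]
  rw [← intervalIntegral.integral_const_mul, ← intervalIntegral.integral_add
    ((H.intervalIntegrable_meanKernel _ _ _ _ hρ).const_mul _)
    (H.intervalIntegrable_meanKernel _ _ _ _ hρ)]
  congr 1
  ext φ
  simp only [meanKernel, divPoly]
  ring

lemma IsChart.meanFun_pos {h l n τ R : ℝ} {T : ℝ → ℝ} (H : IsChart h l n T τ R) {ρ : ℝ}
    (hρ : ρ ∈ Ioo 0 R) : 0 < meanFun h l n 1 0 0 0 T ρ := by
  have hpos : ∀ φ, 0 < meanKernel h l n 1 0 0 0 (T (ρ * Real.sin φ)) := fun φ => by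
    have ht := H.mem _ (abs_mul_sin_lt (φ := φ) hρ.1.le hρ.2)
    obtain ⟨hC, hu, hK⟩ := H.pos _ ht
    have hb := H.lead_pos ht
    have hC' := Real.sqrt_pos.2 hC
    simp only [meanKernel, divPoly]
    rw [show ∀ a b c : ℝ, 1 * a + (0 + 0 * b + 0 * b ^ 2) * c = a by intros; ring]
    positivity
  refine intervalIntegral.integral_pos (by positivity) ?_
    (fun φ _ => mul_nonneg (sq_nonneg _) (hpos φ).le) ⟨0, ⟨le_rfl, by positivity⟩, ?_⟩
  · refine fun φ _ => ContinuousAt.continuousWithinAt ?_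
    have h1 := ContinuousAt.comp (f := fun φ => ρ * Real.sin φ) (x := φ)
      (H.contDiffAt_meanKernel (c00 := 1) (c02 := 0) (c11 := 0) (c20 := 0)
        (abs_mul_sin_lt hρ.1.le hρ.2)).continuousAt (by fun_prop)
    have h2 : ContinuousAt (fun φ => Real.cos φ ^ 2) φ := by fun_prop
    exact h2.mul h1
  · simpa using hpos 0

/-- The intervals between consecutive points of sign change contain simple zeros, after a small
change of `c₀₀`. -/
lemma IsChart.exists_simple_zeros {h l n τ R : ℝ} {T : ℝ → ℝ} (H : IsChart h l n T τ R)
    {c00 c02 c11 c20 σ δ : ℝ} {m : ℕ} (ha : Alternates (meanFun h l n c00 c02 c11 c20 T) R σ m)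
    (hδ : 0 < δ) :
    ∃ c, |c - c00| < δ ∧ ∃ x : ℕ → ℝ, (∀ i < m, x (i + 1) < x i) ∧ ∀ i < m,
      ∃ ρ ∈ Ioo (x (i + 1)) (x i), ρ ∈ Ioo 0 R ∧ meanFun h l n c c02 c11 c20 T ρ = 0 ∧
        ∃ D, D ≠ 0 ∧ HasDerivAt (meanFun h l n c c02 c11 c20 T) D ρ := by
  obtain ⟨x, hx, hlt⟩ := ha
  have hd : ∀ c00 c02 c11 c20 : ℝ, ∀ ρ ∈ Ioo 0 R,
      ∃ D, HasDerivAt (meanFun h l n c00 c02 c11 c20 T) D ρ := fun _ _ _ _ ρ hρ =>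
    hasDerivAt_integral_cos_sq hρ.1 hρ.2 fun s hs => H.contDiffAt_meanKernel hs
  have hev : ∀ᶠ c in 𝓝 c00, ∀ i ∈ Finset.range (m + 1),
      0 < σ * (-1) ^ i * meanFun h l n c c02 c11 c20 T (x i) := by
    rw [Filter.eventually_all_finset]
    intro i hi
    obtain ⟨hxi, hsi⟩ := hx i (by simpa [Nat.lt_succ_iff] using hi)
    have : ContinuousAt (fun c => σ * (-1) ^ i * meanFun h l n c c02 c11 c20 T (x i)) c00 := by
      refine (show ContinuousAt (fun c => σ * (-1) ^ i * (c * meanFun h l n 1 0 0 0 T (x i) +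
        meanFun h l n 0 c02 c11 c20 T (x i))) c00 by fun_prop).congr
        (Eventually.of_forall fun c => ?_)
      beta_reduce
      rw [H.meanFun_eq_add c c02 c11 c20 hxi]
    exact this.eventually (lt_mem_nhds hsi)
  obtain ⟨δ', hδ', hδ''⟩ := Metric.eventually_nhds_iff.1 hev
  have hd0 := hd 1 0 0 0
  have hd1 := hd 0 c02 c11 c20
  choose! D₀ hD₀ using hd0
  choose! D₁ hD₁ using hd1
  obtain ⟨c, hc, hsimple⟩ := exists_forall_zero_simple (a := c00 - min δ δ') (b := c00 + min δ δ')
    (by have := lt_min hδ hδ'; linarith) hD₀ hD₁ fun ρ hρ => (H.meanFun_pos hρ).ne'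
  have hcabs : |c - c00| < min δ δ' := by
    rw [abs_lt]
    constructor <;> linarith [hc.1, hc.2]
  refine ⟨c, hcabs.trans_le (min_le_left _ _), x, hlt, fun i hi => ?_⟩
  have hsign := @hδ'' c (hcabs.trans_le (min_le_right _ _))
  have s1 := hsign i (by simp; omega)
  have s2 := hsign (i + 1) (by simp; omega)
  have hxi := (hx i hi.le).1
  have hxi' := (hx (i + 1) hi).1
  have hlti := hlt i hi
  have hsub : Icc (x (i + 1)) (x i) ⊆ Ioo 0 R := fun y hy =>
    ⟨hxi'.1.trans_le hy.1, hy.2.trans_lt hxi.2⟩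
  have hcont : ContinuousOn (fun ρ => σ * (-1) ^ i * meanFun h l n c c02 c11 c20 T ρ)
      (Icc (x (i + 1)) (x i)) := fun y hy => by
    obtain ⟨D, hD⟩ := hd c c02 c11 c20 y (hsub hy)
    exact (continuousAt_const.mul hD.continuousAt).continuousWithinAt
  have s2' : σ * (-1) ^ i * meanFun h l n c c02 c11 c20 T (x (i + 1)) < 0 := by
    rw [pow_succ] at s2
    linarith
  obtain ⟨ρ, hρ, hz⟩ := intermediate_value_Ioo hlti.le hcont ⟨s2', s1⟩
  have hρR := hsub (Ioo_subset_Icc_self hρ)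
  have hz' : meanFun h l n c c02 c11 c20 T ρ = 0 := by
    have : σ * (-1) ^ i ≠ 0 := fun h0 => by simp [h0] at s1
    exact (mul_eq_zero.1 hz).resolve_left this
  refine ⟨ρ, hρ, hρR, hz', _, hsimple ρ hρR (by rw [← H.meanFun_eq_add c c02 c11 c20 hρR, hz']), ?_⟩
  refine (((hD₀ ρ hρR).const_mul c).add (hD₁ ρ hρR)).congr_of_eventuallyEq ?_
  filter_upwards [isOpen_Ioo.mem_nhds hρR] with y hy using H.meanFun_eq_add c c02 c11 c20 hy

/-- Nonempty sets on which `f` takes values in disjoint intervals are distinct. -/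
lemma le_encard_of_separated {α : Type*} {S : Set (Set α)} {f : α → ℝ} {x : ℕ → ℝ} {m : ℕ}
    (hx : ∀ i < m, x (i + 1) < x i) {C : ℕ → Set α}
    (hC : ∀ i < m, C i ∈ S ∧ (C i).Nonempty ∧ ∀ z ∈ C i, f z ∈ Ioo (x (i + 1)) (x i)) :
    (m : ℕ∞) ≤ S.encard := by
  have hanti : ∀ i j, i ≤ j → j ≤ m → x j ≤ x i := fun i j hij => by
    induction j, hij using Nat.le_induction with
    | base => exact fun _ => le_rfl
    | succ j hij ih => exact fun hj => (hx j hj).le.trans (ih (by omega))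
  have hlt : ∀ i j, i < j → j < m → C i ≠ C j := fun i j hij hj heq => by
    obtain ⟨z, hz⟩ := (hC i (hij.trans hj)).2.1
    have h1 := ((hC i (hij.trans hj)).2.2 z hz).1
    have h2 := ((hC j hj).2.2 z (heq ▸ hz)).2
    linarith [hanti (i + 1) j hij hj.le]
  have hinj : InjOn C (Finset.range m : Set ℕ) := fun i hi j hj heq => by
    simp only [Finset.coe_range, mem_Iio] at hi hj
    rcases lt_trichotomy i j with h1 | h1 | h1
    · exact absurd heq (hlt i j h1 hj)
    · exact h1
    · exact absurd heq.symm (hlt j i h1 hi)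
  calc (m : ℕ∞) = (C '' (Finset.range m : Set ℕ)).encard := by
        rw [hinj.encard_image, Set.encard_coe_eq_coe_finsetCard, Finset.card_range]
    _ ≤ S.encard := encard_le_encard (by
        rintro _ ⟨i, hi, rfl⟩
        exact (hC i (by simpa using hi)).1)

lemma IsPeriodicOrbit.nonempty {X : ℝ × ℝ → ℝ × ℝ} {C : Set (ℝ × ℝ)} (hC : IsPeriodicOrbit X C) :
    C.Nonempty := by
  obtain ⟨γ, T, -, -, -, -, rfl⟩ := hC
  exact range_nonempty γ

lemma HasDivergence.coeff_eq {c00 c02 c11 c20 a10 a01 a30 a21 a12 a03 b10 b01 b30 b21 b12 b03 : ℝ}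
    {p q : ℝ → ℝ → ℝ}
    (hp : ∀ x y, p x y =
      a10 * x + a01 * y + a30 * x ^ 3 + a21 * (x ^ 2 * y) + a12 * (x * y ^ 2) + a03 * y ^ 3)
    (hq : ∀ x y, q x y =
      b10 * x + b01 * y + b30 * x ^ 3 + b21 * (x ^ 2 * y) + b12 * (x * y ^ 2) + b03 * y ^ 3)
    (hd : HasDivergence p q c00 c02 c11 c20) :
    c00 = a10 + b01 ∧ c02 = a12 + 3 * b03 ∧ c11 = 2 * a21 + 2 * b12 ∧ c20 = 3 * a30 + b21 := by
  have key : ∀ x y, a10 + 2 * (a21 * y) * x + 3 * a30 * x ^ 2 + a12 * y ^ 2 +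
      (b01 + b21 * x ^ 2 + 2 * (b12 * x) * y + 3 * b03 * y ^ 2) =
      c00 + c20 * x ^ 2 + c11 * (x * y) + c02 * y ^ 2 := fun x y => by
    have := hd x y
    rw [deriv_quartic (f := fun x' => p x' y) (a01 * y + a03 * y ^ 3) (a10 + a12 * y ^ 2) (a21 * y)
        a30 0 x (fun x => by rw [hp]; ring),
      deriv_quartic (f := fun y' => q x y') (b10 * x + b30 * x ^ 3) (b01 + b21 * x ^ 2) (b12 * x)
        b03 0 y (fun y => by rw [hq]; ring)] at this
    linear_combination this
  have h1 := key 0 0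
  have h2 := key 1 0
  have h3 := key 0 1
  have h4 := key 1 1
  norm_num at h1 h2 h3 h4
  refine ⟨?_, ?_, ?_, ?_⟩ <;> linarith

/-- Simple zeros of the averaged function give limit cycles of the symmetric system. -/
lemma IsChart.eventually_le_encard {h31 h22 h40 c00 c02 c11 c20 τ R r : ℝ} {T : ℝ → ℝ}
    (H : IsChart h31 (2 - 4 * h22) ((1 - 2 * h22) ^ 2 - 2 * h40) T τ R)
    (hnear : ∀ t V, |t| < τ → |V| < R →
      |t * √(wOfV h31 (2 - 4 * h22) ((1 - 2 * h22) ^ 2 - 2 * h40) t V)| < r ∧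
      |√(wOfV h31 (2 - 4 * h22) ((1 - 2 * h22) ^ 2 - 2 * h40) t V) - 1| < r)
    {x : ℕ → ℝ} {m : ℕ} (hx : ∀ i < m, x (i + 1) < x i)
    (hzero : ∀ i < m, ∃ ρ ∈ Ioo (x (i + 1)) (x i), ρ ∈ Ioo 0 R ∧
      meanFun h31 (2 - 4 * h22) ((1 - 2 * h22) ^ 2 - 2 * h40) c00 c02 c11 c20 T ρ = 0 ∧
      ∃ D, D ≠ 0 ∧ HasDerivAt
        (meanFun h31 (2 - 4 * h22) ((1 - 2 * h22) ^ 2 - 2 * h40) c00 c02 c11 c20 T) D ρ)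
    {p q : ℝ → ℝ → ℝ} (hp : IsOddCubic p) (hq : IsOddCubic q)
    (hd : HasDivergence p q c00 c02 c11 c20) :
    ∀ᶠ ε in 𝓝[>] (0 : ℝ), (m : ℕ∞) ≤
      (limitCyclesNear (symField h31 h22 h40 p q ε) (0, 1) r).encard := by
  obtain ⟨a10, a01, a30, a21, a12, a03, hp⟩ := hp
  obtain ⟨b10, b01, b30, b21, b12, b03, hq⟩ := hq
  obtain ⟨e00, e02, e11, e20⟩ := hd.coeff_eq hp hq
  set l := 2 - 4 * h22 with hl
  set n := (1 - 2 * h22) ^ 2 - 2 * h40 with hn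
  set A₁ : ℝ → ℝ := fun t => a01 + (a10 - b01) * t - b10 * t ^ 2 with hA₁
  set A₃ : ℝ → ℝ := fun t =>
    a03 + (a12 - b03) * t + (a21 - b12) * t ^ 2 + (a30 - b21) * t ^ 3 - b30 * t ^ 4 with hA₃
  set Q₁ : ℝ → ℝ := fun t => b01 + b10 * t with hQ₁
  set Q₃ : ℝ → ℝ := fun t => b03 + b12 * t + b21 * t ^ 2 + b30 * t ^ 3 with hQ₃
  have dA₁ : ∀ t, HasDerivAt A₁ (c00 - 2 * Q₁ t) t := fun t => by
    convert hasDerivAt_quartic a01 (a10 - b01) (-b10) 0 0 t using 1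
    · ext t; simp only [hA₁]; ring
    · simp only [hQ₁, e00]; ring
  have dA₃ : ∀ t, HasDerivAt A₃ (divPoly c02 c11 c20 t - 4 * Q₃ t) t := fun t => by
    convert hasDerivAt_quartic a03 (a12 - b03) (a21 - b12) (a30 - b21) (-b30) t using 1
    · ext t; simp only [hA₃]; ring
    · simp only [hQ₃, divPoly, e02, e11, e20]; ring
  have hev : ∀ᶠ ε in 𝓝[>] (0 : ℝ), ∀ i ∈ Finset.range m,
      ∃ C, IsLimitCycle (twField h31 l n A₁ A₃ Q₁ Q₃ ε) C ∧
        ∀ z ∈ C, |z.1| < τ ∧ |vCoord h31 l n z.1 z.2| < R ∧ 0 < z.2 ∧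
          √(sCoord h31 l n z.1 ^ 2 + vCoord h31 l n z.1 z.2 ^ 2) ∈ Ioo (x (i + 1)) (x i) := by
    rw [Filter.eventually_all_finset]
    intro i hi
    obtain ⟨ρ, hρ, hρR, hz, D, hD0, hD⟩ := hzero i (by simpa using hi)
    have hr : 0 < min (ρ - x (i + 1)) (x i - ρ) := lt_min (by linarith [hρ.1]) (by linarith [hρ.2])
    filter_upwards [eventually_exists_isLimitCycle_twField H hρR.1 hρR.2 hr
      (by fun_prop : ContDiff ℝ 1 Q₁) (by fun_prop : ContDiff ℝ 1 Q₃)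
      (by fun_prop : ContDiff ℝ 1 A₁) (by fun_prop : ContDiff ℝ 1 A₃) dA₁ dA₃ hz hD hD0]
      with ε ⟨C, hC, hCz⟩
    refine ⟨C, hC, fun z hz => ?_⟩
    obtain ⟨h1, h2, h3, h4⟩ := hCz z hz
    refine ⟨h1, h2, h3, ?_, ?_⟩
    · linarith [h4.1, min_le_left (ρ - x (i + 1)) (x i - ρ)]
    · linarith [h4.2, min_le_right (ρ - x (i + 1)) (x i - ρ)]
  filter_upwards [hev] with ε hε
  choose! C hC hCz using hε
  -- The cycles are told apart by their radius √(S² + V²), written in the original variables.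
  refine le_encard_of_separated (f := fun z : ℝ × ℝ => √(sCoord h31 l n (z.1 / z.2) ^ 2 +
    vCoord h31 l n (z.1 / z.2) (z.2 ^ 2) ^ 2)) hx
    (C := fun i => (fun z : ℝ × ℝ => (z.1 * √z.2, √z.2)) '' C i) fun i hi => ?_
  have hi' : i ∈ Finset.range m := by simpa using hi
  refine ⟨⟨(hC i hi').symField_of_twField hp hq fun z hz => (hCz i hi' z hz).2.2.1, ?_⟩,
    (hC i hi').1.nonempty.image _, ?_⟩
  · rintro _ ⟨z, hz, rfl⟩
    obtain ⟨h1, h2, h3, -⟩ := hCz i hi' z hz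
    have h4 := hnear z.1 _ h1 h2
    rw [wOfV_vCoord (H.lead_pos h1)] at h4
    simpa [Metric.mem_ball, Prod.dist_eq, Real.dist_eq] using h4
  · rintro _ ⟨z, hz, rfl⟩
    obtain ⟨-, -, h3, h4⟩ := hCz i hi' z hz
    simpa [Real.sq_sqrt h3.le, (Real.sqrt_pos.2 h3).ne'] using h4

/-! ### Symmetric copies -/

lemma limitCyclesNear_mono {X : ℝ × ℝ → ℝ × ℝ} {z₀ : ℝ × ℝ} {r r' : ℝ} (hr : r ≤ r') :
    limitCyclesNear X z₀ r ⊆ limitCyclesNear X z₀ r' := fun _ hC =>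
  ⟨hC.1, hC.2.trans (Metric.ball_subset_ball hr)⟩

lemma encard_limitCyclesNear_symField_le (h31 h22 h40 ε r : ℝ) (p q : ℝ → ℝ → ℝ) :
    (limitCyclesNear (symField h31 h22 h40 p q ε) (0, 1) r).encard ≤
      (limitCyclesNear (normalField h31 h22 h40 p q ε) (0, 0) r).encard := by
  have hinj : Function.Injective (fun z : ℝ × ℝ => (1 - z.2, z.1)) := fun a b hab => by
    simp only [Prod.mk.injEq] at hab
    exact Prod.ext hab.2 (by linarith [hab.1])
  rw [← (hinj.image_injective).encard_image]
  refine encard_le_encard ?_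
  rintro _ ⟨C, ⟨hC, hCb⟩, rfl⟩
  refine ⟨hC.normalField, ?_⟩
  rintro _ ⟨z, hz, rfl⟩
  have := hCb hz
  simp only [Metric.mem_ball, Prod.dist_eq, Real.dist_eq, max_lt_iff, sub_zero] at this ⊢
  exact ⟨by rw [abs_sub_comm]; exact this.2, this.1⟩

lemma encard_limitCyclesNear_le_neg (h31 h22 h40 ε r : ℝ) {p q : ℝ → ℝ → ℝ} (hp : IsOddCubic p)
    (hq : IsOddCubic q) :
    (limitCyclesNear (symField h31 h22 h40 p q ε) (0, 1) r).encard ≤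
      (limitCyclesNear (symField h31 h22 h40 p q ε) (0, -1) r).encard := by
  have hinj : Function.Injective (fun z : ℝ × ℝ => -z) := neg_injective
  rw [← (hinj.image_injective).encard_image]
  refine encard_le_encard ?_
  rintro _ ⟨C, ⟨hC, hCb⟩, rfl⟩
  refine ⟨hC.neg_symField hp hq, ?_⟩
  rintro _ ⟨z, hz, rfl⟩
  have := hCb hz
  simp only [Metric.mem_ball, Prod.dist_eq, Real.dist_eq, max_lt_iff, sub_zero, Prod.fst_neg,
    Prod.snd_neg, abs_neg] at this ⊢
  refine ⟨this.1, ?_⟩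
  rw [show -z.2 - -1 = -(z.2 - 1) by ring, abs_neg]
  exact this.2

/-- Balls of radius at most 1 about (0, 1) and (0, -1) do not meet. -/
lemma disjoint_limitCyclesNear (X : ℝ × ℝ → ℝ × ℝ) {r : ℝ} (hr : r ≤ 1) :
    Disjoint (limitCyclesNear X (0, 1) r) (limitCyclesNear X (0, -1) r) := by
  rw [Set.disjoint_left]
  rintro C ⟨hC, h1⟩ ⟨-, h2⟩
  obtain ⟨z, hz⟩ := hC.1.nonempty
  have h1 := h1 hz
  have h2 := h2 hz
  simp only [Metric.mem_ball, Prod.dist_eq, Real.dist_eq, max_lt_iff] at h1 h2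
  have h3 := (abs_lt.1 h1.2).1
  have h4 := (abs_lt.1 h2.2).2
  linarith

/-! ### Assembly of the theorem -/

theorem theorem9 (s c00' c02' c11' c20' h31' h22' h40' : ℝ)
    (hs : s = 1 ∨ s = -1)
    (hc00 : c00' = -c02')
    (hc20 : c20' = 3 * h31' * c11' + (2 + 4 * h22') * c02')
    (hc11 : c11' ≠ 0)
    (hc02 : c02' = h31' * (20 * h22' ^ 2 - 8 * h22' - 10 * h40' - 1) /
      (-2 + 20 * h31' ^ 2 + 8 * h22' ^ 2 - 4 * h40') * c11')
    (hh31 : h31' ≠ 0)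
    (hh22 : h22' = 1 / 2 - (105 + s * (56 * √3)) / 4 * h31' ^ 2)
    (hh40 : h40' = 1 / 14 * (28 * h22' ^ 2 - 21 * h31' ^ 2 - 12 * h22' - 1)) :
    ∀ η : ℝ, 0 < η → ∃ c00 c02 c11 c20 h31 h22 h40 : ℝ,
      |c00 - c00'| < η ∧ |c02 - c02'| < η ∧ |c11 - c11'| < η ∧ |c20 - c20'| < η ∧
      |h31 - h31'| < η ∧ |h22 - h22'| < η ∧ |h40 - h40'| < η ∧
      ∀ p q : ℝ → ℝ → ℝ, IsOddCubic p → IsOddCubic q → HasDivergence p q c00 c02 c11 c20 →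
        ∃ ε : ℝ, 0 < ε ∧ ε < η ∧
          5 ≤ (limitCyclesNear (normalField h31 h22 h40 p q ε) (0, 0) η).encard ∧
          5 ≤ (limitCyclesNear (symField h31 h22 h40 p q ε) (0, 1) η).encard ∧
          5 ≤ (limitCyclesNear (symField h31 h22 h40 p q ε) (0, -1) η).encard ∧
          10 ≤ (limitCyclesNear (symField h31 h22 h40 p q ε) (0, 1) η ∪
            limitCyclesNear (symField h31 h22 h40 p q ε) (0, -1) η).encard := by
  intro η hη
  -- With w = s√3 both signs are treated at once; afterwards only w² = 3 matters.
  obtain ⟨w, hw, hws⟩ : ∃ w : ℝ, w ^ 2 = 3 ∧ s * (56 * √3) = 56 * w := by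
    refine ⟨s * √3, ?_, by ring⟩
    have : s ^ 2 = 1 := by rcases hs with rfl | rfl <;> norm_num
    rw [mul_pow, this, Real.sq_sqrt (by norm_num), one_mul]
  rw [hws] at hh22
  set l₀ := (105 + 56 * w) * h31' ^ 2 with hl₀
  set n₀ := (63 + 32 * w) * h31' ^ 2 with hn₀
  have hl : l₀ = 2 - 4 * h22' := by rw [hl₀, hh22]; ring
  have hn : n₀ = (1 - 2 * h22') ^ 2 - 2 * h40' := by
    have h1 : n₀ = 3 * h31' ^ 2 + 4 * l₀ / 7 := by rw [hl₀, hn₀]; ring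
    rw [h1, hl, hh40]
    ring
  have hsolve : c02' = solveC02 h31' c11' l₀ n₀ := by
    rw [hc02, solveC02, hl, hn, ← mul_div_mul_left _ (4 * _) (two_ne_zero (α := ℝ)),
      div_mul_eq_mul_div, ← mul_div_mul_left _ (-2 + _ + _ - _) (four_ne_zero (α := ℝ))]
    congr 1 <;> ring
  -- A radius at most 1 keeps the neighbourhoods of the two centres disjoint.
  set r := min η 1 with hr
  have hr0 : 0 < r := lt_min hη one_pos
  obtain ⟨T, τ, R, ω, hR, hω, hchart⟩ := exists_chart h31' l₀ n₀ hr0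
  have hfam : IsChartFamily h31' l₀ n₀ T τ R ω := fun l n h1 h2 =>
    ⟨(hchart l n h1 h2).1, (hchart l n h1 h2).2.1⟩
  obtain ⟨σ, hfreq⟩ := frequently_alternates hw hh31 hc11 hR hω hfam hsolve
  rw [← hl₀, ← hn₀] at hfreq
  have e20 : 3 * h31' * c11' + (4 - l₀) * c02' = c20' := by rw [hc20, hl]; ring
  rw [e20, ← hc00] at hfreq
  -- The bound η/2 leaves room for the second change of c₀₀, the one that makes the zeros simple.
  have hclose : ∀ f : ℝ × ℝ × ℝ × ℝ × ℝ → ℝ, Continuous f → ∀ a, f (l₀, n₀, c02', c20', c00') = a →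
      ∀ᶠ θ in 𝓝 (l₀, n₀, c02', c20', c00'), |f θ - a| < η / 2 := fun f hf a ha => by
    have : Continuous fun θ => |f θ - a| := by fun_prop
    exact this.continuousAt.eventually (gt_mem_nhds (by simpa [ha] using hη))
  have hclose22 := hclose (fun θ => (2 - θ.1) / 4) (by fun_prop) h22' (by simp only [hl]; ring)
  have hclose40 := hclose (fun θ => ((θ.1 / 2) ^ 2 - θ.2.1) / 2) (by fun_prop) h40'
    (by simp only [hl, hn]; ring)
  have hclose02 := hclose (fun θ => θ.2.2.1) (by fun_prop) c02' rfl
  have hclose20 := hclose (fun θ => θ.2.2.2.1) (by fun_prop) c20' rfl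
  have hclose00 := hclose (fun θ => θ.2.2.2.2) (by fun_prop) c00' rfl
  obtain ⟨⟨l, n, c02, c20, c00⟩, ⟨⟨hlω, hnω⟩, halt⟩, h22b, h40b, h02b, h20b, h00b⟩ :=
    (hfreq.and_eventually (hclose22.and (hclose40.and (hclose02.and
      (hclose20.and hclose00))))).exists
  obtain ⟨hch, -, hnear⟩ := hchart l n hlω hnω
  obtain ⟨c, hc, x, hx, hzero⟩ := hch.exists_simple_zeros halt (half_pos hη)
  -- The passage from (l, n) back to h₂₂ = (2 - l)/4 and h₄₀ = ((l/2)² - n)/2; h₃₁ and c₁₁ keep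
  -- their original values.
  have el : l = 2 - 4 * ((2 - l) / 4) := by ring
  have en : n = (1 - 2 * ((2 - l) / 4)) ^ 2 - 2 * (((l / 2) ^ 2 - n) / 2) := by ring
  refine ⟨c, c02, c11', c20, h31', (2 - l) / 4, ((l / 2) ^ 2 - n) / 2, ?_, by linarith,
    by simpa using hη, by linarith, by simpa using hη, by linarith, by linarith, ?_⟩
  · have := abs_sub_le c c00 c00'
    dsimp only at h00b
    linarith
  intro p q hp hq hd
  dsimp only at hch hnear hzero
  generalize hT : (fun s => T (s, l, n)) = T' at hch hzero
  have hev := IsChart.eventually_le_encard (h22 := (2 - l) / 4) (h40 := ((l / 2) ^ 2 - n) / 2)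
    (by rwa [← el, ← en]) (by rwa [← el, ← en]) hx (by rwa [← el, ← en]) hp hq hd
  obtain ⟨ε, h5, hε⟩ := (hev.and (Ioo_mem_nhdsGT hη)).exists
  have hmono : ∀ X z₀, (limitCyclesNear X z₀ r).encard ≤ (limitCyclesNear X z₀ η).encard :=
    fun X z₀ => encard_le_encard (limitCyclesNear_mono (min_le_left _ _))
  have h5' := h5.trans (encard_limitCyclesNear_le_neg h31' ((2 - l) / 4) (((l / 2) ^ 2 - n) / 2) ε
    r hp hq)
  refine ⟨ε, hε.1, hε.2, (h5.trans (encard_limitCyclesNear_symField_le _ _ _ _ _ _ _)).trans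
    (hmono _ _), h5.trans (hmono _ _), h5'.trans (hmono _ _), ?_⟩
  refine le_trans ?_ (encard_le_encard (union_subset_union
    (limitCyclesNear_mono (min_le_left η 1)) (limitCyclesNear_mono (min_le_left η 1))))
  rw [encard_union_eq (disjoint_limitCyclesNear _ (min_le_right _ _))]
  exact (by norm_num : (10 : ℕ∞) = 5 + 5) ▸ add_le_add h5 h5'
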